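/- Let $A$ be a Noetherian reduced commutative ring and let $R=\bigoplus_{n\ge 0}[R]_n$ be a finitely generated $\mathbb{N}$-graded commutative $A$-algebra (with $A$ mapping into degree $0$) such that $[R]_0$ is a finitely generated $A$-module (for instance $[R]_0=A$). Let $\mathfrak{m}=[R]_+=\bigoplus_{n>0}[R]_n$. Let $M$ be a finitely generated $\mathbb{Z}$-graded $R$-module having rank, i.e. $M\otimes_R Q$ is a free $Q$-module of finite rank, where $Q$ is the total ring of fractions of $R$. Let $M^1=M/\tau_R(M)$, where $\tau_R(M)$ is the submodule of elements killed by a non-zero-divisor of $R$, and fix a graded embedding $\iota: M^1\hookrightarrow F$ (injective, homogeneous of degree $0$) into a finitely generated graded free $R$-module $F=\bigoplus_{j=1}^s R(-\mu_j)$. For $\mathfrak{p}\in\operatorname{Spec}(A)$ with residue field $k(\mathfrak{p})$, the specialization of $M$ at $\mathfrak p$ is the graded $(R\otimes_A k(\mathfrak{p}))$-module $$S_{\mathfrak p}(M)=\operatorname{Im}\big(\iota\otimes_A k(\mathfrak p): M^1\otimes_A k(\mathfrak p)\to F\otimes_A k(\mathfrak p)\big).$$ For a finitely generated graded $(R\otimes_A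 k(\mathfrak p))$-module $N$, write $H^i_{\mathfrak m}(N)$ for its graded local cohomology (computed by the graded Čech complex on homogeneous elements $x_1,\dots,x_r$ of positive degree generating $\mathfrak m$), and set $a^i(N)=\sup\{n\in\mathbb{Z} : [H^i_{\mathfrak m}(N)]_n\ne 0\}$ (so $a^i(N)=-\infty$ if $H^i_{\mathfrak m}(N)=0$) and $\operatorname{reg}(N)=\sup\{a^i(N)+i : i\ge 0\}$. Let $\dim N$ be the Krull dimension of $N$ over $R\otimes_A k(\mathfrak p)$ (with $\dim 0=-\infty$) and $\operatorname{depth} N$ the supremum of the lengths of $N$-regular sequences in $\mathfrak m(R\otimes_A k(\mathfrak p))$ (with $\operatorname{depth} 0=\infty$). Then there exists a dense open subset $\mathcal{U}\subset\operatorname{Spec}(A)$ such that the functions (i) $\mathfrak p\mapsto \dim(S_{\mathfrak p}(M))$, (ii) $\mathfrak p\mapsto \operatorname{depth}(S_{\mathfrak p}(M))$, (iii) $\mathfrak p\mapsto a^i(S_{\mathfrak p}(M))$, for every $i\ge 0$, and (iv) $\mathfrak p\mapsto \operatorname{reg}(S_{\mathfrak p}(M))$ are locally constant on $\mathcal{U}$.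 -/

import Mathlib

open scoped TensorProduct

noncomputable section

/-- A `ℤ`-graded module `M = ⨁ₙ ℳ n` over the `ℕ`-graded `A`-algebra `R = ⨁ₙ 𝒜 n`. -/
structure IsGradedModule {A R M : Type*} [CommRing A] [CommRing R] [Algebra A R]
    [AddCommGroup M] [Module A M] [Module R M]
    (𝒜 : ℕ → Submodule A R) (ℳ : ℤ → Submodule A M) : Prop where
  isInternal : DirectSum.IsInternal ℳ
  smul_mem : ∀ (k : ℕ) (n : ℤ) (r : R) (m : M),
    r ∈ 𝒜 k → m ∈ ℳ n → r • m ∈ ℳ ((k : ℤ) + n)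

/-- `M` has a rank: `M ⊗_R Q` is a free `Q`-module of finite rank, where `Q` is the total ring of
fractions of `R`. -/
def HasRank (R M : Type*) [CommRing R] [AddCommGroup M] [Module R M] : Prop :=
  ∃ m : ℕ, Nonempty (LocalizedModule (nonZeroDivisors R) M
    ≃ₗ[Localization (nonZeroDivisors R)] (Fin m → Localization (nonZeroDivisors R)))

/-- The component `[R]_n` for `n : ℤ`; it is zero for `n < 0`. -/
def intComponent {A R : Type*} [CommRing A] [CommRing R] [Algebra A R]
    (𝒜 : ℕ → Submodule A R) (n : ℤ) : Submodule A R :=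
  if 0 ≤ n then 𝒜 n.toNat else ⊥

/-- The degree-`n` component of the graded free module `⨁ⱼ R(-μⱼ)`, whose `j`-th basis vector
has degree `μⱼ`. -/
def freeComponent {A R : Type*} [CommRing A] [CommRing R] [Algebra A R]
    (𝒜 : ℕ → Submodule A R) {s : ℕ} (μ : Fin s → ℤ) (n : ℤ) : Submodule A (Fin s → R) :=
  Submodule.pi Set.univ fun j => intComponent 𝒜 (n - μ j)

/-- The torsion-free quotient `M¹ = M / τ_R(M)`, where `τ_R(M)` consists of the elements killed
by a non-zero-divisor of `R`. -/
abbrev TorsionFreeQuotient (R M : Type*) [CommRing R] [AddCommGroup M] [Module R M] : Type _ :=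
  M ⧸ Submodule.torsion R M

/-- A graded embedding (injective and homogeneous of degree zero) of `M¹ = M / τ_R(M)` into the
finitely generated graded free module `⨁ⱼ R(-μⱼ)`. The degree-`n` component of `M¹` is the image
of that of `M`. -/
structure IsGradedEmbedding {A R M : Type*} [CommRing A] [CommRing R] [Algebra A R]
    [AddCommGroup M] [Module A M] [Module R M]
    (𝒜 : ℕ → Submodule A R) (ℳ : ℤ → Submodule A M) {s : ℕ} (μ : Fin s → ℤ)
    (ι : TorsionFreeQuotient R M →ₗ[R] (Fin s → R)) : Prop where
  injective : Function.Injective ι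
  homogeneous : ∀ (n : ℤ) (m : M), m ∈ ℳ n →
    ι (Submodule.Quotient.mk m) ∈ freeComponent 𝒜 μ n

/-- The fibre ring `R ⊗_A k(𝔭)`, with `k(𝔭)` the residue field of `A` at `𝔭`. -/
abbrev FiberRing (A R : Type*) [CommRing A] [CommRing R] [Algebra A R]
    (p : PrimeSpectrum A) : Type _ :=
  R ⊗[A] p.asIdeal.ResidueField

/-- The specialization `S_𝔭(M)`: the image of `ι ⊗_A k(𝔭) : M¹ ⊗_A k(𝔭) → F ⊗_A k(𝔭)`. Here
`N ⊗_A k(𝔭)` is written as the base change `(R ⊗_A k(𝔭)) ⊗_R N` of an `R`-module `N`, so that the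
image is a module over the fibre ring. -/
def specialization {A R M : Type*} [CommRing A] [CommRing R] [Algebra A R]
    [AddCommGroup M] [Module R M] {s : ℕ}
    (ι : TorsionFreeQuotient R M →ₗ[R] (Fin s → R)) (p : PrimeSpectrum A) :
    Submodule (FiberRing A R p) (FiberRing A R p ⊗[R] (Fin s → R)) :=
  LinearMap.range (ι.baseChange (FiberRing A R p))

/-- The degree-`n` component of `S_𝔭(M)`: the `k(𝔭)`-span of the images of the elements of degree
`n` of `M`. -/
def specializationComponent {A R M : Type*} [CommRing A] [CommRing R] [Algebra A R]
    [AddCommGroup M] [Module A M] [Module R M] (ℳ : ℤ → Submodule A M) {s : ℕ}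
    (ι : TorsionFreeQuotient R M →ₗ[R] (Fin s → R)) (p : PrimeSpectrum A) (n : ℤ) :
    AddSubgroup (specialization ι p) :=
  AddSubgroup.closure {y | ∃ (c : p.asIdeal.ResidueField) (m : M), m ∈ ℳ n ∧
    (y : FiberRing A R p ⊗[R] (Fin s → R)) =
      ((1 : R) ⊗ₜ[A] c) ⊗ₜ[R] ι (Submodule.Quotient.mk m)}

/-- The localization `N_{x_I}` of `N` at the powers of `x_I = ∏_{i ∈ I} xᵢ`. -/
abbrev CechLocalization {B : Type*} (N : Type*) [CommRing B] [AddCommGroup N] [Module B N] {r : ℕ}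
    (x : Fin r → B) (I : Finset (Fin r)) : Type _ :=
  LocalizedModule (Submonoid.powers (∏ i ∈ I, x i)) N

theorem cech_isUnit {B : Type*} (N : Type*) [CommRing B] [AddCommGroup N] [Module B N] {r : ℕ}
    (x : Fin r → B) {I J : Finset (Fin r)} (h : I ⊆ J)
    (y : Submonoid.powers (∏ i ∈ I, x i)) :
    IsUnit (algebraMap B (Module.End B (CechLocalization N x J)) (y : B)) := by
  obtain ⟨_, k, rfl⟩ := y
  have hu := IsLocalizedModule.map_units
    (S := Submonoid.powers (∏ i ∈ J, x i))
    (LocalizedModule.mkLinearMap (Submonoid.powers (∏ i ∈ J, x i)) N)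
    ⟨∏ i ∈ J, x i, Submonoid.mem_powers _⟩
  have hd : (∏ i ∈ I, x i) ∣ ∏ i ∈ J, x i := Finset.prod_dvd_prod_of_subset I J x h
  have h1 : IsUnit (algebraMap B (Module.End B (CechLocalization N x J)) (∏ i ∈ I, x i)) := by
    obtain ⟨c, hc⟩ := hd
    have hu' : IsUnit (algebraMap B (Module.End B (CechLocalization N x J))
        ((∏ i ∈ I, x i) * c)) := by rw [← hc]; exact hu
    rw [map_mul] at hu'
    have hcomm : Commute (algebraMap B (Module.End B (CechLocalization N x J)) (∏ i ∈ I, x i))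
        (algebraMap B (Module.End B (CechLocalization N x J)) c) := Algebra.commutes _ _
    exact (hcomm.isUnit_mul_iff.mp hu').1
  simpa using h1.pow k

/-- The canonical map `N_{x_I} → N_{x_J}` for `I ⊆ J`. -/
def cechRestrict {B : Type*} (N : Type*) [CommRing B] [AddCommGroup N] [Module B N] {r : ℕ}
    (x : Fin r → B) {I J : Finset (Fin r)} (h : I ⊆ J) :
    CechLocalization N x I →ₗ[B] CechLocalization N x J :=
  LocalizedModule.lift _ (LocalizedModule.mkLinearMap _ N) (cech_isUnit N x h)

/-- The differential of the Čech complex of `N` with respect to `x₁, …, x_r`, on the direct sum of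
all its terms: `(d c)_J = ∑_{j ∈ J} (-1)^{#{i ∈ J : i < j}} c_{J \ {j}}`. -/
def cechDifferential {B : Type*} (N : Type*) [CommRing B] [AddCommGroup N] [Module B N] {r : ℕ}
    (x : Fin r → B) :
    ((I : Finset (Fin r)) → CechLocalization N x I) →ₗ[B]
      ((I : Finset (Fin r)) → CechLocalization N x I) :=
  LinearMap.pi fun J => ∑ j ∈ J, ((-1 : B) ^ (J.filter (· < j)).card) •
    (cechRestrict N x (Finset.erase_subset j J) ∘ₗ LinearMap.proj (J.erase j))

/-- For `xᵢ` homogeneous of degree `dᵢ` and `N` graded with components `𝒩`, the degree-`n`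
component of `N_{x_I}`: the fractions `m / x_I^k` with `m` of degree `n + k ∑_{i ∈ I} dᵢ`. -/
def localizationComponent {B N : Type*} [CommRing B] [AddCommGroup N] [Module B N] {r : ℕ}
    (x : Fin r → B) (d : Fin r → ℕ) (𝒩 : ℤ → AddSubgroup N) (I : Finset (Fin r)) (n : ℤ) :
    AddSubgroup (CechLocalization N x I) :=
  AddSubgroup.closure {y | ∃ (k : ℕ) (m : N), m ∈ 𝒩 (n + k * ∑ i ∈ I, (d i : ℤ)) ∧
    y = LocalizedModule.mk m ((⟨∏ i ∈ I, x i, Submonoid.mem_powers _⟩ :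
      Submonoid.powers (∏ i ∈ I, x i)) ^ k)}

/-- The Čech cochains of cohomological degree `i` and internal degree `n`: the degree-`n` component
of `⨁_{|I| = i} N_{x_I}`. -/
def cechCochains {B N : Type*} [CommRing B] [AddCommGroup N] [Module B N] {r : ℕ}
    (x : Fin r → B) (d : Fin r → ℕ) (𝒩 : ℤ → AddSubgroup N) (i : ℕ) (n : ℤ) :
    AddSubgroup ((I : Finset (Fin r)) → CechLocalization N x I) :=
  AddSubgroup.pi Set.univ fun I => if I.card = i then localizationComponent x d 𝒩 I n else ⊥

/-- The Čech cocycles of cohomological degree `i` and internal degree `n`. -/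
def cechCocycles {B N : Type*} [CommRing B] [AddCommGroup N] [Module B N] {r : ℕ}
    (x : Fin r → B) (d : Fin r → ℕ) (𝒩 : ℤ → AddSubgroup N) (i : ℕ) (n : ℤ) :
    AddSubgroup ((I : Finset (Fin r)) → CechLocalization N x I) :=
  cechCochains x d 𝒩 i n ⊓ (LinearMap.ker (cechDifferential N x)).toAddSubgroup

/-- The Čech coboundaries of cohomological degree `i` and internal degree `n`. -/
def cechCoboundaries {B N : Type*} [CommRing B] [AddCommGroup N] [Module B N] {r : ℕ}
    (x : Fin r → B) (d : Fin r → ℕ) (𝒩 : ℤ → AddSubgroup N) (i : ℕ) (n : ℤ) :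
    AddSubgroup ((I : Finset (Fin r)) → CechLocalization N x I) :=
  match i with
  | 0 => ⊥
  | i + 1 => (cechCochains x d 𝒩 i n).map (cechDifferential N x).toAddMonoidHom

/-- `[H^i_𝔪(N)]_n`, the degree-`n` component of the `i`-th local cohomology module of the graded
module `N` with respect to the ideal `𝔪` generated by the homogeneous elements `x₁, …, x_r` of
degrees `d₁, …, d_r`, computed by the graded Čech complex. -/
abbrev GradedLocalCohomology {B N : Type*} [CommRing B] [AddCommGroup N] [Module B N] {r : ℕ}
    (x : Fin r → B) (d : Fin r → ℕ) (𝒩 : ℤ → AddSubgroup N) (i : ℕ) (n : ℤ) : Type _ :=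
  cechCocycles x d 𝒩 i n ⧸ (cechCoboundaries x d 𝒩 i n).addSubgroupOf (cechCocycles x d 𝒩 i n)

/-- The `a`-invariant `a^i(N) = max {n : [H^i_𝔪(N)]_n ≠ 0}`, equal to `-∞` if `H^i_𝔪(N) = 0`. -/
def aInvariant {B N : Type*} [CommRing B] [AddCommGroup N] [Module B N] {r : ℕ}
    (x : Fin r → B) (d : Fin r → ℕ) (𝒩 : ℤ → AddSubgroup N) (i : ℕ) : EReal :=
  sSup ((fun n : ℤ => ((n : ℝ) : EReal)) ''
    {n : ℤ | Nontrivial (GradedLocalCohomology x d 𝒩 i n)})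

/-- The Castelnuovo–Mumford regularity `reg(N) = max {a^i(N) + i : i ≥ 0}`. -/
def regularity {B N : Type*} [CommRing B] [AddCommGroup N] [Module B N] {r : ℕ}
    (x : Fin r → B) (d : Fin r → ℕ) (𝒩 : ℤ → AddSubgroup N) : EReal :=
  ⨆ i : ℕ, aInvariant x d 𝒩 i + (((i : ℕ) : ℝ) : EReal)

/-- The depth of `N` with respect to the ideal `J`: the supremum of the lengths of the sequences in
`J` that are weakly regular on `N` (so it is `∞` when `N = 0`; when `J N ≠ N` all these sequences
are regular). -/
def idealDepth {B : Type*} [CommRing B] (J : Ideal B) (N : Type*) [AddCommGroup N] [Module B N] :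
    ℕ∞ :=
  ⨆ (rs : List B) (_ : ∀ b ∈ rs, b ∈ J) (_ : RingTheory.Sequence.IsWeaklyRegular N rs),
    (rs.length : ℕ∞)

end

/-! The problem reduces to one finitely generated graded module over a polynomial ring. Since
`[R]_0` is finite over A and `x` generates the irrelevant ideal, R is finite over S = A[X_1, …, X_r]
with deg X_i = d_i (`finite_of_span_eq_irrelevant`), hence so are M¹ and the cokernel of ι. Fix a
minimal prime q of A. As A is reduced, A_q is a field, and every finite S-module becomes A-flat
after inverting one element outside q (`genericallyFlat_mvPolynomial`). Flatness of coker ι keeps ι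
⊗ k injective for every field k over that localization, so there the specialization is simply the
graded k[X]-module M¹ ⊗_A k. It suffices to show that its invariants are the same for all such k:
one basic open set is found for each minimal prime, and their union is dense
(`exists_constant_invariants`, `dense_iSup_basicOpen`).

The difficulty with local cohomology is that infinitely many degrees n must be controlled by one
localization, although H^i is not finitely generated. Everything is therefore expressed by
dimensions of graded pieces of finite modules Y ⊗ k. For these a single localization serves all n,
because each Y_n is a direct summand of a generically flat Y and so has locally constant rank
(`PolyFiber.exists_finrank_component`).

Choose 0 → Z → G → Y → 0 with G graded free. Where Y is flat the sequence stays exact over k, and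
H^i(G_k) = 0 for i < r. Thus H^i(Y_k) ≅ H^{i+1}(Z_k) for i + 1 < r, while H^{r-1}(Y_k) is the kernel
of H^r(Z_k) → H^r(G_k). The top cohomology is handled by graded local duality, made explicit through
residues: H^r(Y_k)_n = 0 exactly when Hom(Y_k, k[X]) is zero in degree e = -n - ∑ d_i, and the map
above is injective in degree n exactly when Hom(G_k, k[X]) → Hom(Z_k, k[X]) is onto in degree e
(`top_injective_iff_gradedDual_surjective`). Left exactness of Hom turns this surjectivity into an
equality of dimensions. Finally dim Hom(Y_k, k[X])_e is constant in k, being read off from a free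
presentation of Y and the base change of the cokernel of the transposed matrix
(`exists_finrank_gradedDual`). Descending induction on i concludes
(`IsPolyGrading.hasConstantCohomology`).

The a-invariants and the regularity are defined by the vanishing of graded pieces of cohomology. The
depth is the first non-vanishing cohomological degree (`idealDepth_span_range`). The dimension is
recovered from the Hilbert function: its growth exponent is the number of variables of a Noether
normalization. The normalization need not be graded, because two commuting polynomial actions over
which N is finite have comparable growth (`IsPolyGrading.growthExponents_eq`). -/

section GenericFlatness

/-! ### Flatness criteria and generic flatness at a minimal prime of a reduced ring. -/

theorem Module.Flat.of_forall_exists_injective {A N : Type*} [CommRing A] [AddCommGroup N] [Module A N]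
    {ι : Type*} (P : ι → Submodule A N) (hP : ∀ i, Module.Flat A (P i))
    (h : ∀ (l : ℕ) (x : Fin l → N), ∃ i, ∀ j, x j ∈ P i) : Module.Flat A N := by
  rw [Module.Flat.iff_forall_isTrivialRelation]
  intro l f x hfx
  obtain ⟨i, hi⟩ := h l x
  have := hP i
  have h0 : ∑ j, f j • (⟨x j, hi j⟩ : P i) = 0 := by
    apply Subtype.ext
    simpa using hfx
  obtain ⟨k, a, y, h1, h2⟩ := Module.Flat.isTrivialRelation_of_sum_smul_eq_zero h0
  refine ⟨k, a, fun j => (y j : N), fun j => ?_, h2⟩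
  simpa using congrArg Subtype.val (h1 j)

theorem Module.Flat.of_exact {A N' N N'' : Type*} [CommRing A] [AddCommGroup N'] [Module A N']
    [AddCommGroup N] [Module A N] [AddCommGroup N''] [Module A N'']
    (f : N' →ₗ[A] N) (g : N →ₗ[A] N'') (hf : Function.Injective f) (hg : Function.Surjective g)
    (hfg : Function.Exact f g) [Module.Flat A N'] [Module.Flat A N''] : Module.Flat A N := by
  rw [Module.Flat.iff_rTensor_injectiveₛ]
  intro P _ _ I
  let : AddCommGroup P := Module.addCommMonoidToAddCommGroup A
  rw [injective_iff_map_eq_zero]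
  intro t ht
  have h1 : (g.lTensor I) t = 0 := by
    apply Module.Flat.rTensor_preserves_injective_linearMap (M := N'') I.subtype
      (Submodule.injective_subtype I)
    rw [← LinearMap.comp_apply, LinearMap.rTensor_comp_lTensor, ← LinearMap.lTensor_comp_rTensor,
      LinearMap.comp_apply, ht]
    simp
  obtain ⟨u, rfl⟩ := (_root_.lTensor_exact I hfg hg t).1 h1
  have h2 : (I.subtype.rTensor N') u = 0 := by
    -- Second use of the flatness of N'': tensoring the sequence with P keeps f injective.
    apply LinearMap.lTensor_injective_of_exact_of_flat g hg f hf hfg P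
    rw [← LinearMap.comp_apply, LinearMap.lTensor_comp_rTensor, ← LinearMap.rTensor_comp_lTensor,
      LinearMap.comp_apply, ht, map_zero]
  have h3 : u = 0 := by
    apply Module.Flat.rTensor_preserves_injective_linearMap (M := N') I.subtype
      (Submodule.injective_subtype I)
    rw [h2, map_zero]
  rw [h3, map_zero]

/-- The localization of `N` at the powers of `a` is flat. -/
def FlatAway {A : Type*} [CommRing A] (a : A) (N : Type*) [AddCommGroup N] [Module A N] : Prop :=
  Module.Flat A (Localization.Away a ⊗[A] N)

namespace FlatAway

variable {A : Type*} [CommRing A] {a b : A} {N N' N'' : Type*} [AddCommGroup N] [Module A N]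
  [AddCommGroup N'] [Module A N'] [AddCommGroup N''] [Module A N'']

theorem iff_flat_localization :
    FlatAway a N ↔ Module.Flat (Localization.Away a) (Localization.Away a ⊗[A] N) :=
  (Module.flat_iff_of_isLocalization (Localization.Away a) (Submonoid.powers a) _).symm

theorem of_dvd (h : FlatAway a N) (hab : a ∣ b) : FlatAway b N := by
  rw [iff_flat_localization] at h ⊢
  have hu : IsUnit (algebraMap A (Localization.Away b) a) :=
    isUnit_of_dvd_unit (map_dvd _ hab) (IsLocalization.Away.algebraMap_isUnit b)
  let : Algebra (Localization.Away a) (Localization.Away b) :=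
    (IsLocalization.Away.lift a hu).toAlgebra
  have : IsScalarTower A (Localization.Away a) (Localization.Away b) :=
    IsScalarTower.of_algebraMap_eq fun x => (IsLocalization.Away.lift_eq a hu x).symm
  exact Module.Flat.of_linearEquiv
    (TensorProduct.AlgebraTensorModule.cancelBaseChange A (Localization.Away a)
      (Localization.Away b) (Localization.Away b) N).symm

theorem of_linearEquiv (e : N ≃ₗ[A] N') (h : FlatAway a N) : FlatAway a N' := by
  have : Module.Flat A (Localization.Away a ⊗[A] N) := h
  exact Module.Flat.of_linearEquiv (LinearEquiv.lTensor (Localization.Away a) e).symm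

theorem of_retract (i : N' →ₗ[A] N) (p : N →ₗ[A] N') (hp : p ∘ₗ i = LinearMap.id)
    (h : FlatAway a N) : FlatAway a N' := by
  have : Module.Flat A (Localization.Away a ⊗[A] N) := h
  refine Module.Flat.of_retract (i.lTensor (Localization.Away a)) (p.lTensor (Localization.Away a)) ?_
  rw [← LinearMap.lTensor_comp, hp, LinearMap.lTensor_id]

theorem of_exact (f : N' →ₗ[A] N) (g : N →ₗ[A] N'') (hf : Function.Injective f)
    (hg : Function.Surjective g) (hfg : Function.Exact f g) (h' : FlatAway a N')
    (h'' : FlatAway a N'') : FlatAway a N := by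
  have : Module.Flat A (Localization.Away a ⊗[A] N') := h'
  have : Module.Flat A (Localization.Away a ⊗[A] N'') := h''
  have : Module.Flat A (Localization.Away a) := IsLocalization.flat _ (Submonoid.powers a)
  exact Module.Flat.of_exact (f.lTensor _) (g.lTensor _)
    (Module.Flat.lTensor_preserves_injective_linearMap f hf)
    (LinearMap.lTensor_surjective _ hg) (_root_.lTensor_exact _ hfg hg)

/-- Flatness of A_a identifies each A_a ⊗ P i with its image in A_a ⊗ N. These images form an
increasing exhaustive chain, so any finite relation already lives in one flat member and the
equational criterion applies. -/
theorem of_iUnion (P : ℕ → Submodule A N) (hmono : Monotone P) (htop : ∀ n, ∃ i, n ∈ P i)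
    (hP : ∀ i, FlatAway a (P i)) : FlatAway a N := by
  have : Module.Flat A (Localization.Away a) := IsLocalization.flat _ (Submonoid.powers a)
  refine Module.Flat.of_forall_exists_injective
    (fun i => LinearMap.range ((P i).subtype.lTensor (Localization.Away a))) (fun i => ?_) ?_
  · have : Module.Flat A (Localization.Away a ⊗[A] P i) := hP i
    exact Module.Flat.of_linearEquiv (LinearEquiv.ofInjective _
      (Module.Flat.lTensor_preserves_injective_linearMap (P i).subtype
        (Submodule.injective_subtype _))).symm
  · have hm : ∀ i j, i ≤ j → LinearMap.range ((P i).subtype.lTensor (Localization.Away a)) ≤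
        LinearMap.range ((P j).subtype.lTensor (Localization.Away a)) := by
      intro i j hij
      rw [← Submodule.subtype_comp_inclusion _ _ (hmono hij), LinearMap.lTensor_comp]
      exact LinearMap.range_comp_le_range _ _
    have h1 : ∀ t : Localization.Away a ⊗[A] N, ∃ i,
        t ∈ LinearMap.range ((P i).subtype.lTensor (Localization.Away a)) := by
      intro t
      induction t with
      | zero => exact ⟨0, zero_mem _⟩
      | tmul s n =>
        obtain ⟨i, hi⟩ := htop n
        exact ⟨i, s ⊗ₜ ⟨n, hi⟩, by simp⟩
      | add t u ht hu =>
        obtain ⟨i, hi⟩ := ht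
        obtain ⟨j, hj⟩ := hu
        exact ⟨max i j, add_mem (hm _ _ (le_max_left _ _) hi) (hm _ _ (le_max_right _ _) hj)⟩
    intro l x
    choose i hi using fun j => h1 (x j)
    exact ⟨Finset.univ.sup i, fun j => hm _ _ (Finset.le_sup (Finset.mem_univ j)) (hi j)⟩

end FlatAway

/-- Every finite `B`-module becomes flat over `A` after inverting an element outside `q`. -/
def GenericallyFlat.{w} {A : Type*} [CommRing A] (q : Ideal A) (B : Type*) [CommRing B] [Algebra A B] :
    Prop :=
  ∀ (N : Type w) [AddCommGroup N] [Module A N] [Module B N] [IsScalarTower A B N]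
    [Module.Finite B N], ∃ a ∉ q, FlatAway a N

theorem GenericallyFlat.of_surjective.{w} {A : Type*} [CommRing A] {q : Ideal A} {B C : Type*} [CommRing B]
    [Algebra A B] [CommRing C] [Algebra A C] (f : B →ₐ[A] C) (hf : Function.Surjective f)
    (h : GenericallyFlat.{w} q B) : GenericallyFlat.{w} q C := by
  intro N _ _ _ _ _
  let : Module B N := Module.compHom N f.toRingHom
  let : Algebra B C := f.toRingHom.toAlgebra
  have : IsScalarTower B C N := ⟨fun b c n => by
    change (f b * c) • n = f b • c • n
    rw [mul_smul]⟩
  have : IsScalarTower A B N := ⟨fun a b n => by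
    change f (a • b) • n = a • f b • n
    rw [map_smul, smul_assoc]⟩
  have : Module.Finite B C := Module.Finite.of_surjective (Algebra.linearMap B C) hf
  have : Module.Finite B N := Module.Finite.trans C N
  exact h N

open Polynomial in
-- Filter N by the B-submodules generated by X^i s with i ≤ j, for s a finite generating set. The
-- successive quotients are all quotients of `P 1` by an increasing chain of kernels. Since B is
-- Noetherian, only finitely many of them occur up to isomorphism, so one element makes all of them
-- flat; extensions and the union are then flat.
theorem GenericallyFlat.polynomial.{w} {A : Type*} [CommRing A] {q : Ideal A} [hq : q.IsPrime] {B : Type*}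
    [CommRing B] [IsNoetherianRing B] [Algebra A B] (h : GenericallyFlat.{w} q B) :
    GenericallyFlat.{w} q B[X] := by
  intro N _ _ _ _ hfin
  let : Module B N := Module.compHom N (C : B →+* B[X])
  have hCs : ∀ (b : B) (n : N), b • n = (C b : B[X]) • n := fun _ _ => rfl
  have : IsScalarTower B B[X] N := ⟨fun b c n => by rw [hCs, ← mul_smul, smul_eq_C_mul]⟩
  have : IsScalarTower A B N := ⟨fun a b n => by
    rw [hCs, hCs, ← smul_assoc, smul_C]⟩
  obtain ⟨s, hs⟩ := hfin.fg_top
  let μ : N →ₗ[B] N := LinearMap.restrictScalars B (LinearMap.lsmul B[X] N X)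
  have hμ : ∀ n, μ n = (X : B[X]) • n := fun _ => rfl
  obtain ⟨P, hPz, hPs⟩ : ∃ P : ℕ → Submodule B N, P 0 = Submodule.span B (s : Set N) ∧
      ∀ j, P (j + 1) = P j ⊔ (P j).map μ :=
    ⟨fun j => Nat.rec (Submodule.span B (s : Set N)) (fun _ Q => Q ⊔ Q.map μ) j, rfl, fun _ => rfl⟩
  have hmono : Monotone P := monotone_nat_of_le_succ fun j => by rw [hPs]; exact le_sup_left
  have hμP : ∀ j n, n ∈ P j → μ n ∈ P (j + 1) := fun j n hn => by
    rw [hPs]; exact Submodule.mem_sup_right ⟨n, hn, rfl⟩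
  have hfg : ∀ j, (P j).FG := by
    intro j
    induction j with
    | zero => exact ⟨s, hPz.symm⟩
    | succ j ih => rw [hPs]; exact ih.sup (ih.map μ)
  have htop : ∀ n, ∃ j, n ∈ P j := by
    intro n
    have hn : n ∈ Submodule.span B[X] (s : Set N) := hs ▸ Submodule.mem_top
    induction hn using Submodule.span_induction with
    | mem n hn => exact ⟨0, hPz ▸ Submodule.subset_span hn⟩
    | zero => exact ⟨0, zero_mem _⟩
    | add m n _ _ hm hn =>
      obtain ⟨i, hi⟩ := hm
      obtain ⟨j, hj⟩ := hn
      exact ⟨max i j, add_mem (hmono (le_max_left _ _) hi) (hmono (le_max_right _ _) hj)⟩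
    | smul p n _ hn =>
      obtain ⟨j, hj⟩ := hn
      induction p using Polynomial.induction_on' with
      | add p p' hp hp' =>
        obtain ⟨i, hi⟩ := hp
        obtain ⟨j, hj⟩ := hp'
        exact ⟨max i j, by
          rw [add_smul]
          exact add_mem (hmono (le_max_left _ _) hi) (hmono (le_max_right _ _) hj)⟩
      | monomial k b =>
        refine ⟨j + k, ?_⟩
        have : ∀ k, (μ ^ k) n ∈ P (j + k) := by
          intro k
          induction k with
          | zero => exact hj
          | succ k ih => rw [pow_succ', ← add_assoc]; exact hμP _ _ ih
        have h2 : (monomial k b : B[X]) • n = b • (μ ^ k) n := by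
          have h3 : ∀ k, (μ ^ k) n = (X ^ k : B[X]) • n := by
            intro k
            induction k with
            | zero => simp
            | succ k ih => rw [pow_succ', pow_succ', mul_smul, ← ih]; rfl
          rw [h3, hCs, ← mul_smul, C_mul_X_pow_eq_monomial]
        rw [h2]
        exact Submodule.smul_mem _ _ (this k)
  -- Multiplication by X^j carries `P 1` onto P (j+1) / P j.
  let φ : ∀ j : ℕ, ↥(P 1) →ₗ[B] N ⧸ P j := fun j => (P j).mkQ ∘ₗ (μ ^ j) ∘ₗ (P 1).subtype
  have hpow : ∀ i j n, n ∈ P i → (μ ^ j) n ∈ P (i + j) := by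
    intro i j n hn
    induction j with
    | zero => exact hn
    | succ k ih => rw [pow_succ', ← add_assoc]; exact hμP _ _ ih
  have hrange : ∀ j, (P (j + 1)).map (P j).mkQ = LinearMap.range (φ j) := by
    intro j
    apply le_antisymm
    · induction j with
      | zero =>
        rintro _ ⟨n, hn, rfl⟩
        exact ⟨⟨n, hn⟩, rfl⟩
      | succ j ih =>
        rw [hPs (j + 1), Submodule.map_sup, sup_le_iff]
        constructor
        · rintro _ ⟨n, hn, rfl⟩
          have h0 : (P (j + 1)).mkQ n = 0 := (Submodule.Quotient.mk_eq_zero _).2 hn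
          rw [h0]
          exact zero_mem _
        · rintro _ ⟨_, ⟨n, hn, rfl⟩, rfl⟩
          obtain ⟨⟨v, hv⟩, hv'⟩ := ih ⟨n, hn, rfl⟩
          refine ⟨⟨v, hv⟩, ?_⟩
          have hd : (μ ^ j) v - n ∈ P j := (Submodule.Quotient.eq _).1 hv'
          refine (Submodule.Quotient.eq _).2 ?_
          have := hμP _ _ hd
          rw [map_sub] at this
          simpa [pow_succ'] using this
    · rintro _ ⟨⟨v, hv⟩, rfl⟩
      refine ⟨(μ ^ j) v, ?_, rfl⟩
      rw [add_comm]
      exact hpow 1 j v hv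
  have hker : Monotone fun j => LinearMap.ker (φ j) := by
    refine monotone_nat_of_le_succ fun j => ?_
    rintro ⟨v, hv⟩ hv'
    have h1 : (μ ^ j) v ∈ P j := (Submodule.Quotient.mk_eq_zero _).1 hv'
    refine (Submodule.Quotient.mk_eq_zero _).2 ?_
    have := hμP _ _ h1
    simpa [pow_succ'] using this
  have : Module.Finite B (P 1) := Module.Finite.iff_fg.2 (hfg 1)
  have : Module.Finite B (P 0) := Module.Finite.iff_fg.2 (hfg 0)
  obtain ⟨J, hJ⟩ := WellFoundedGT.monotone_chain_condition
    (⟨fun j => LinearMap.ker (φ j), hker⟩ : ℕ →o Submodule B (P 1))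
  obtain ⟨a₀, ha₀, hP0⟩ := h (P 0)
  choose a ha hgr using fun j => h (P 1 ⧸ LinearMap.ker (φ j))
  -- The kernels are constant from index J on, so `a 0, …, a J` handle every graded piece, and `a₀`
  -- handles the bottom step `P 0`.
  let c := a₀ * ∏ j ∈ Finset.range (J + 1), a j
  have hc : c ∉ q := hq.mul_notMem ha₀ fun h' => by
    obtain ⟨j, -, hj⟩ := (Ideal.IsPrime.prod_mem_iff).1 h'
    exact ha j hj
  have hgr' : ∀ j, FlatAway c (LinearMap.range (φ j)) := by
    intro j
    have h1 : FlatAway c (P 1 ⧸ LinearMap.ker (φ j)) := by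
      by_cases hj : j ≤ J
      · exact (hgr j).of_dvd (Dvd.dvd.mul_left (Finset.dvd_prod_of_mem a
          (Finset.mem_range.2 (Nat.lt_succ_of_le hj))) _)
      · have h2 : LinearMap.ker (φ J) = LinearMap.ker (φ j) := hJ j (le_of_not_ge hj)
        rw [← h2]
        exact (hgr J).of_dvd (Dvd.dvd.mul_left (Finset.dvd_prod_of_mem a
          (Finset.mem_range.2 (Nat.lt_succ_self J))) _)
    exact h1.of_linearEquiv ((φ j).quotKerEquivRange.restrictScalars A)
  refine ⟨c, hc, ?_⟩
  refine FlatAway.of_iUnion (fun j => (P j).restrictScalars A) hmono htop fun j => ?_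
  induction j with
  | zero => exact hP0.of_dvd (Dvd.intro _ rfl)
  | succ j ih =>
    let g : P (j + 1) →ₗ[B] LinearMap.range (φ j) :=
      LinearMap.codRestrict _ ((P j).mkQ ∘ₗ (P (j + 1)).subtype) fun n => by
        rw [← hrange]; exact ⟨n, n.2, rfl⟩
    refine FlatAway.of_exact (N := P (j + 1))
      ((Submodule.inclusion (hmono (Nat.le_succ j) : P j ≤ P (j + 1))).restrictScalars A)
      (g.restrictScalars A) 
      (Submodule.inclusion_injective (hmono (Nat.le_succ j) : P j ≤ P (j + 1))) ?_ ?_ ih (hgr' j)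
    · rintro ⟨y, hy⟩
      have hy' := hy
      rw [← hrange] at hy'
      obtain ⟨n, hn, rfl⟩ := hy'
      exact ⟨⟨n, hn⟩, rfl⟩
    · intro n
      constructor
      · intro hn
        have : (n : N) ∈ P j := (Submodule.Quotient.mk_eq_zero _).1 (congrArg Subtype.val hn)
        exact ⟨⟨n, this⟩, rfl⟩
      · rintro ⟨m, rfl⟩
        exact Subtype.ext ((Submodule.Quotient.mk_eq_zero _).2 m.2)

/-- The localization of a reduced ring at a minimal prime is reduced of dimension zero, hence a
field. So N is free at q, and freeness of a finitely presented module spreads to a basic open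
neighbourhood. -/
theorem genericallyFlat_self.{w} {A : Type*} [CommRing A] [IsNoetherianRing A] [IsReduced A]
    {q : Ideal A} (hq : q ∈ minimalPrimes A) : GenericallyFlat.{w} q A := by
  intro N _ m₁ m₂ hst hfin
  -- Two A-actions on N are supplied, one for A as base ring and one for A as algebra over itself;
  -- the scalar tower forces them to agree.
  obtain rfl : m₁ = m₂ := by
    ext a n
    have h1 := hst.smul_assoc a 1 n
    rw [@one_smul A N _ m₂.toMulAction, smul_eq_mul, mul_one] at h1
    exact h1.symm
  have hqp : q.IsPrime := hq.1.1
  have hfield : IsField (Localization.AtPrime q) := by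
    have : Ring.KrullDimLE 0 (Localization.AtPrime q) := by
      exact Ring.KrullDimLE.of_isLocalization q hq _
    exact Ring.KrullDimLE.isField_of_isReduced
  let := hfield.toField
  have : Module.FinitePresentation A N := Module.finitePresentation_of_finite A N
  obtain ⟨a, ha, hfree, -⟩ := Module.FinitePresentation.exists_free_localizedModule_powers
    q.primeCompl (LocalizedModule.mkLinearMap q.primeCompl N) (Localization.AtPrime q)
  refine ⟨a, ha, ?_⟩
  rw [FlatAway.iff_flat_localization]
  have : Module.Flat (Localization.Away a) (LocalizedModule.Away a N) := inferInstance
  exact Module.Flat.of_linearEquiv (LocalizedModule.equivTensorProduct (.powers a) N).symm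

theorem genericallyFlat_mvPolynomial.{w} {A : Type*} [CommRing A] [IsNoetherianRing A] [IsReduced A]
    {q : Ideal A} (hq : q ∈ minimalPrimes A) (n : ℕ) :
    GenericallyFlat.{w} q (MvPolynomial (Fin n) A) := by
  have hqp : q.IsPrime := hq.1.1
  induction n with
  | zero =>
    exact (genericallyFlat_self hq).of_surjective (MvPolynomial.isEmptyAlgEquiv A (Fin 0)).symm.toAlgHom
      (MvPolynomial.isEmptyAlgEquiv A (Fin 0)).symm.surjective
  | succ n ih =>
    exact ih.polynomial.of_surjective (MvPolynomial.finSuccEquiv A n).symm.toAlgHom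
      (MvPolynomial.finSuccEquiv A n).symm.surjective

namespace FlatAway

variable {A : Type*} [CommRing A] {a : A} {N N' N'' : Type*} [AddCommGroup N] [Module A N]
  [AddCommGroup N'] [Module A N'] [AddCommGroup N''] [Module A N'']

/-- The obstruction is Tor_1 of k with N''. Since a is invertible in k, it can be computed after
base change to A_a, where the cokernel is flat. -/
theorem lTensor_injective (f : N' →ₗ[A] N) (g : N →ₗ[A] N'') (hf : Function.Injective f)
    (hg : Function.Surjective g) (hfg : Function.Exact f g) (h : FlatAway a N'')
    (k : Type*) [CommRing k] [Algebra A k] (ha : IsUnit (algebraMap A k a)) :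
    Function.Injective (f.lTensor k) := by
  have : Module.Flat A (Localization.Away a ⊗[A] N'') := h
  have : Module.Flat A (Localization.Away a) := IsLocalization.flat _ (Submonoid.powers a)
  let : Algebra (Localization.Away a) k := (IsLocalization.Away.lift a ha).toAlgebra
  have : IsScalarTower A (Localization.Away a) k :=
    IsScalarTower.of_algebraMap_eq fun x => (IsLocalization.Away.lift_eq a ha x).symm
  have h1 := LinearMap.lTensor_injective_of_exact_of_flat (g.lTensor (Localization.Away a))
    (LinearMap.lTensor_surjective _ hg) (f.lTensor (Localization.Away a))
    (Module.Flat.lTensor_preserves_injective_linearMap f hf) (_root_.lTensor_exact _ hfg hg) k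
  let j' : k ⊗[A] N' →ₗ[A] k ⊗[A] (Localization.Away a ⊗[A] N') :=
    (TensorProduct.mk A (Localization.Away a) N' 1).lTensor k
  let j : k ⊗[A] N →ₗ[A] k ⊗[A] (Localization.Away a ⊗[A] N) :=
    (TensorProduct.mk A (Localization.Away a) N 1).lTensor k
  have hj : Function.Injective j' := by
    -- As k is an A_a-algebra, multiplying the factor A_a into k gives a retraction of `j'`.
    let ρ : k ⊗[A] (Localization.Away a ⊗[A] N') →ₗ[A] k ⊗[A] N' :=
      ((LinearMap.mul' A k ∘ₗ (Algebra.linearMap (Localization.Away a) k |>.restrictScalars A).lTensor k).rTensor N')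
        ∘ₗ (TensorProduct.assoc A k (Localization.Away a) N').symm.toLinearMap
    have : ρ ∘ₗ j' = LinearMap.id := by
      ext c n
      simp [ρ, j']
    exact Function.LeftInverse.injective (g := ρ) fun x => LinearMap.congr_fun this x
  have hcomm : j ∘ₗ f.lTensor k = (f.lTensor (Localization.Away a)).lTensor k ∘ₗ j' := by
    ext c n
    simp [j, j']
  have h2 : Function.Injective (j ∘ₗ f.lTensor k) := by
    rw [hcomm]
    exact h1.comp hj
  exact Function.Injective.of_comp h2

end FlatAway

/-- The open set `D(a)` is nonempty and all its points specialize the minimal prime `q`. -/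
structure IsGoodAt {A : Type*} [CommRing A] (q : Ideal A) (a : A) : Prop where
  notMem : a ∉ q
  le_of_notMem : ∀ p : Ideal A, p.IsPrime → a ∉ p → q ≤ p

theorem IsGoodAt.mul {A : Type*} [CommRing A] {q : Ideal A} [hq : q.IsPrime] {a b : A}
    (ha : IsGoodAt q a) (hb : b ∉ q) : IsGoodAt q (a * b) :=
  ⟨hq.mul_notMem ha.1 hb, fun p hp h => ha.2 p hp fun h' => h (Ideal.mul_mem_right _ _ h')⟩

/-- There are finitely many minimal primes. Multiply elements lying in each of the others but not in
q: a prime avoiding the product can contain no minimal prime except q. -/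
theorem exists_isGoodAt {A : Type*} [CommRing A] [IsNoetherianRing A] {q : Ideal A}
    (hq : q ∈ minimalPrimes A) : ∃ a, IsGoodAt q a := by
  have hqp : q.IsPrime := hq.1.1
  have hfin : (minimalPrimes A).Finite := minimalPrimes.finite_of_isNoetherianRing A
  have h1 : ∀ p ∈ minimalPrimes A, ∃ b, b ∉ q ∧ (p ≠ q → b ∈ p) := by
    intro p hp
    by_cases hpq : p = q
    · exact ⟨1, (Ideal.ne_top_iff_one q).1 hqp.ne_top, fun h => absurd hpq h⟩
    · have : ¬ p ≤ q := fun hle => hpq (le_antisymm hle (hq.2 hp.1 hle))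
      obtain ⟨b, hb, hb'⟩ := Set.not_subset.1 this
      exact ⟨b, hb', fun _ => hb⟩
  choose! b hb hb' using h1
  refine ⟨∏ p ∈ hfin.toFinset, b p, fun h => ?_, fun p hp h => ?_⟩
  · obtain ⟨p, hp, hp'⟩ := (Ideal.IsPrime.prod_mem_iff).1 h
    exact hb p (hfin.mem_toFinset.1 hp) hp'
  · obtain ⟨p', hp', hle⟩ := Ideal.exists_minimalPrimes_le (I := ⊥) (J := p) bot_le
    by_cases hpq : p' = q
    · exact hpq ▸ hle
    · exfalso
      apply h
      exact (Ideal.IsPrime.prod_mem_iff).2 ⟨p', hfin.mem_toFinset.2 hp', hle (hb' p' hp' hpq)⟩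

/-- Every prime of A_a contains q A_a, so the rank of a finite flat module, which does not change
along specializations, equals its rank at q A_a everywhere. -/
theorem FlatAway.exists_finrank_eq {A : Type*} [CommRing A] {q : Ideal A} [hqp : q.IsPrime] {a : A}
    (ha : IsGoodAt q a) {N : Type*} [AddCommGroup N] [Module A N] [Module.Finite A N]
    (h : FlatAway a N) : ∃ ρ : ℕ, ∀ (k : Type*) [Field k] [Algebra A k],
      algebraMap A k a ≠ 0 → Module.finrank k (k ⊗[A] N) = ρ := by
  rw [FlatAway.iff_flat_localization] at h
  have hdisj : Disjoint (Submonoid.powers a : Set A) q :=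
    (Ideal.disjoint_powers_iff_notMem a hqp.isRadical).2 ha.1
  have hQ := IsLocalization.isPrime_of_isPrime_disjoint (Submonoid.powers a) (Localization.Away a)
    q hqp hdisj
  refine ⟨Module.rankAtStalk (R := Localization.Away a) (Localization.Away a ⊗[A] N) ⟨_, hQ⟩,
    fun k _ _ hk => ?_⟩
  have hu : IsUnit (algebraMap A k a) := isUnit_iff_ne_zero.2 hk
  let : Algebra (Localization.Away a) k := (IsLocalization.Away.lift a hu).toAlgebra
  have : IsScalarTower A (Localization.Away a) k :=
    IsScalarTower.of_algebraMap_eq fun x => (IsLocalization.Away.lift_eq a hu x).symm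
  rw [← (TensorProduct.AlgebraTensorModule.cancelBaseChange A (Localization.Away a) k k N).finrank_eq]
  have h1 := Module.rankAtStalk_baseChange (R := Localization.Away a)
    (M := Localization.Away a ⊗[A] N) (S := k) ⊥
  rw [Module.rankAtStalk_eq_finrank_of_free] at h1
  refine h1.trans ?_
  symm
  -- The two points compared are q A_a and the kernel of A_a → k, which contains it.
  apply Module.rankAtStalk_eq_of_le_of_finite_of_flat
  change Ideal.map _ _ ≤ Ideal.comap _ _
  rw [Ideal.map_le_iff_le_comap, Ideal.comap_comap, ← IsScalarTower.algebraMap_eq]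
  refine ha.2 _ inferInstance fun h' => hk ?_
  exact h'

end GenericFlatness

/-! ### Calculus of fractions in the Čech complex. -/

section Fractions

variable {B N : Type*} [CommRing B] [AddCommGroup N] [Module B N] {r : ℕ}

/-- The fraction `m / x_I ^ k` in `N_{x_I}`. -/
noncomputable def cechFrac (x : Fin r → B) (I : Finset (Fin r)) (k : ℕ) : N →ₗ[B] CechLocalization N x I where
  toFun m := LocalizedModule.mk m ((⟨∏ i ∈ I, x i, Submonoid.mem_powers _⟩ :
    Submonoid.powers (∏ i ∈ I, x i)) ^ k)
  map_add' m m' := by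
    rw [LocalizedModule.mk_add_mk, ← smul_add, LocalizedModule.mk_cancel_common_left]
  map_smul' b m := by simp [LocalizedModule.smul'_mk]

variable {x : Fin r → B} {I J K : Finset (Fin r)}

theorem exists_cechFrac (y : CechLocalization N x I) : ∃ k m, y = cechFrac x I k m := by
  induction y using LocalizedModule.induction_on with
  | h m s =>
    obtain ⟨_, k, rfl⟩ := s
    exact ⟨k, m, rfl⟩

theorem cechFrac_eq_iff {k l : ℕ} {m n : N} : cechFrac x I k m = cechFrac x I l n ↔
    ∃ t : ℕ, (∏ i ∈ I, x i) ^ (t + l) • m = (∏ i ∈ I, x i) ^ (t + k) • n := by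
  refine LocalizedModule.mk_eq.trans ⟨?_, ?_⟩
  · rintro ⟨⟨_, t, rfl⟩, h⟩
    exact ⟨t, by simpa [pow_add, mul_smul, Submonoid.smul_def] using h⟩
  · rintro ⟨t, h⟩
    exact ⟨⟨_, t, rfl⟩, by simpa [pow_add, mul_smul, Submonoid.smul_def] using h⟩

theorem cechFrac_eq_zero_iff {k : ℕ} {m : N} : cechFrac x I k m = 0 ↔
    ∃ t : ℕ, (∏ i ∈ I, x i) ^ t • m = 0 := by
  rw [← (cechFrac x I 0).map_zero, cechFrac_eq_iff]
  simp

theorem cechFrac_add (k l : ℕ) (m : N) :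
    cechFrac x I (k + l) ((∏ i ∈ I, x i) ^ l • m) = cechFrac x I k m := by
  rw [cechFrac_eq_iff]
  exact ⟨0, by rw [← mul_smul, ← pow_add]; ring_nf⟩

@[simp]
theorem cechRestrict_cechFrac (h : I ⊆ J) (k : ℕ) (m : N) :
    cechRestrict N x h (cechFrac x I k m) = cechFrac x J k ((∏ i ∈ J \ I, x i) ^ k • m) := by
  -- x_I acts invertibly on N_{x_J}, so the identity may be checked after clearing the denominator
  -- x_I^k.
  have hinj : Function.Injective fun y : CechLocalization N x J => (∏ i ∈ I, x i) ^ k • y := by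
    have hu := cech_isUnit N x h (⟨∏ i ∈ I, x i, Submonoid.mem_powers _⟩ ^ k)
    exact ((Module.End.isUnit_iff _).1 hu).injective
  apply hinj
  have h1 : ∀ (I : Finset (Fin r)) (m : N), (cechFrac x I 0) m = LocalizedModule.mkLinearMap _ N m := by
    intro I m
    simp [cechFrac]
  have h2 : (∏ i ∈ I, x i) ^ k • cechFrac x I k m = cechFrac x I 0 m := by
    rw [← map_smul, ← cechFrac_add 0 k, zero_add]
  change (∏ i ∈ I, x i) ^ k • cechRestrict N x h _ = (∏ i ∈ I, x i) ^ k • _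
  rw [← map_smul (cechRestrict N x h), h2, h1, ← map_smul (cechFrac x J k), ← mul_smul, ← mul_pow, mul_comm, Finset.prod_sdiff h]
  have h3 := cechFrac_add (x := x) (I := J) 0 k m
  rw [zero_add] at h3
  rw [h3, h1]
  rw [cechRestrict, LocalizedModule.mkLinearMap_apply, LocalizedModule.lift_mk_one]

theorem cechRestrict_trans (h : I ⊆ J) (h' : J ⊆ K) (y : CechLocalization N x I) :
    cechRestrict N x h' (cechRestrict N x h y) = cechRestrict N x (h.trans h') y := by
  obtain ⟨k, m, rfl⟩ := exists_cechFrac y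
  rw [cechRestrict_cechFrac, cechRestrict_cechFrac, cechRestrict_cechFrac, ← mul_smul, ← mul_pow,
    ← Finset.prod_union]
  · congr 3
    congr 1
    ext i
    simp only [Finset.mem_union, Finset.mem_sdiff]
    have := @h i
    have := @h' i
    tauto
  · exact Finset.disjoint_left.2 fun i hi hi' => (Finset.mem_sdiff.1 hi).2 (Finset.mem_sdiff.1 hi').1

/-- The restriction of the component of index `I` of a cochain, zero unless `I ⊆ J`. -/
noncomputable def cechEval (J I : Finset (Fin r)) (c : (I : Finset (Fin r)) → CechLocalization N x I) :
    CechLocalization N x J :=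
  if h : I ⊆ J then cechRestrict N x h (c I) else 0

theorem cechDifferential_apply (c : (I : Finset (Fin r)) → CechLocalization N x I) (J) :
    cechDifferential N x c J = ∑ j ∈ J, (-1 : B) ^ (J.filter (· < j)).card •
      cechRestrict N x (Finset.erase_subset j J) (c (J.erase j)) := by
  simp [cechDifferential]

theorem cechDifferential_apply' (c : (I : Finset (Fin r)) → CechLocalization N x I) (J) :
    cechDifferential N x c J = ∑ j ∈ J, (-1 : B) ^ (J.filter (· < j)).card •
      cechEval J (J.erase j) c := by
  rw [cechDifferential_apply]
  refine Finset.sum_congr rfl fun j hj => ?_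
  rw [cechEval, dif_pos (Finset.erase_subset j J)]

theorem cechDifferential_cechDifferential (c : (I : Finset (Fin r)) → CechLocalization N x I) :
    cechDifferential N x (cechDifferential N x c) = 0 := by
  funext J
  rw [cechDifferential_apply]
  have h1 : ∀ j ∈ J, (-1 : B) ^ (J.filter (· < j)).card •
      cechRestrict N x (Finset.erase_subset j J) (cechDifferential N x c (J.erase j)) =
      ∑ l ∈ J.erase j, ((-1 : B) ^ (J.filter (· < j)).card *
        (-1) ^ ((J.erase j).filter (· < l)).card) • cechEval J ((J.erase j).erase l) c := by
    intro j hj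
    rw [cechDifferential_apply, map_sum, Finset.smul_sum]
    refine Finset.sum_congr rfl fun l hl => ?_
    rw [map_smul, smul_smul, cechRestrict_trans, cechEval, dif_pos]
  rw [Finset.sum_congr rfl h1, Finset.sum_sigma', Pi.zero_apply]
  have hcard : ∀ j ∈ J, ∀ l ∈ J, j < l →
      (J.filter (· < l)).card = ((J.erase j).filter (· < l)).card + 1 ∧
      (J.filter (· < j)).card = ((J.erase l).filter (· < j)).card := by
    intro j hj l hl hjl
    constructor
    · rw [Finset.filter_erase, Finset.card_erase_add_one]
      exact Finset.mem_filter.2 ⟨hj, hjl⟩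
    · rw [Finset.filter_erase, Finset.erase_eq_of_notMem]
      simp [hjl.le]
  -- Deleting j then l, or l then j, reaches the same component with opposite signs: for j < l,
  -- removing j lowers the position of l by one, while removing l leaves the position of j
  -- unchanged.
  refine Finset.sum_involution (fun a _ => ⟨a.2, a.1⟩) ?_ ?_ ?_ ?_
  · rintro ⟨j, l⟩ hjl
    simp only [Finset.mem_sigma, Finset.mem_erase] at hjl
    obtain ⟨hj, hne, hl⟩ := hjl
    simp only
    rw [Finset.erase_right_comm (a := l) (b := j), ← add_smul]
    convert zero_smul B _
    rcases lt_or_gt_of_ne hne with h | h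
    · obtain ⟨h1, h2⟩ := hcard l hl j hj h
      rw [h1, h2]
      ring
    · obtain ⟨h1, h2⟩ := hcard j hj l hl h
      rw [h1, h2]
      ring
  · rintro ⟨j, l⟩ hjl - h
    simp only [Finset.mem_sigma, Finset.mem_erase] at hjl
    exact hjl.2.1 (congrArg Sigma.fst h)
  · rintro ⟨j, l⟩ hjl
    simp only [Finset.mem_sigma, Finset.mem_erase] at hjl ⊢
    exact ⟨hjl.2.2, hjl.2.1.symm, hjl.1⟩
  · rintro ⟨j, l⟩ hjl
    rfl

end Fractions

/-! ### Functoriality of the Čech complex along additive maps between modules over different rings.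
-/

section Functoriality

variable {B N B' N' : Type*} [CommRing B] [AddCommGroup N] [Module B N] [CommRing B']
  [AddCommGroup N'] [Module B' N'] {r : ℕ} {x : Fin r → B} {x' : Fin r → B'}

theorem map_prod_pow_smul {f : N →+ N'} (hf : ∀ i m, f (x i • m) = x' i • f m)
    (I : Finset (Fin r)) (k : ℕ) (m : N) :
    f ((∏ i ∈ I, x i) ^ k • m) = (∏ i ∈ I, x' i) ^ k • f m := by
  have h1 : ∀ m, f ((∏ i ∈ I, x i) • m) = (∏ i ∈ I, x' i) • f m := by
    induction I using Finset.induction_on with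
    | empty => simp
    | insert a s ha ih =>
      intro m
      rw [Finset.prod_insert ha, Finset.prod_insert ha, mul_smul, mul_smul, hf, ih]
  induction k generalizing m with
  | zero => simp
  | succ k ih => rw [pow_succ, pow_succ, mul_smul, mul_smul, ih, h1]

/-- The source and target are modules over unrelated rings, so the universal property of
localization is not available. Compatibility of f with the `x i` alone makes the formula on
fractions independent of the representative. -/
theorem exists_cechLocalizationMap (f : N →+ N') (hf : ∀ i m, f (x i • m) = x' i • f m)
    (I : Finset (Fin r)) : ∃ φ : CechLocalization N x I →+ CechLocalization N' x' I,
      ∀ k m, φ (cechFrac x I k m) = cechFrac x' I k (f m) := by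
  choose k m h using fun y : CechLocalization N x I => exists_cechFrac y
  have key : ∀ k' m', cechFrac x' I (k (cechFrac x I k' m')) (f (m (cechFrac x I k' m'))) =
      cechFrac x' I k' (f m') := by
    intro k' m'
    obtain ⟨t, ht⟩ := cechFrac_eq_iff.1 (h (cechFrac x I k' m'))
    refine cechFrac_eq_iff.2 ⟨t, ?_⟩
    rw [← map_prod_pow_smul hf, ← map_prod_pow_smul hf, ht]
  refine ⟨AddMonoidHom.mk' (fun y => cechFrac x' I (k y) (f (m y))) fun y z => ?_, key⟩
  have h1 : y + z = cechFrac x I (k y + k z)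
      ((∏ i ∈ I, x i) ^ k z • m y + (∏ i ∈ I, x i) ^ k y • m z) := by
    rw [map_add, cechFrac_add, add_comm (k y), cechFrac_add, ← h, ← h]
  conv_lhs => rw [h1, key, map_add, map_add, map_prod_pow_smul hf, map_prod_pow_smul hf,
    cechFrac_add, add_comm (k y), cechFrac_add]

/-- The map `N_{x_I} → N'_{x'_I}` induced by an additive map compatible with `x` and `x'`. -/
noncomputable def cechLocalizationMap (f : N →+ N') (hf : ∀ i m, f (x i • m) = x' i • f m)
    (I : Finset (Fin r)) : CechLocalization N x I →+ CechLocalization N' x' I :=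
  (exists_cechLocalizationMap f hf I).choose

@[simp]
theorem cechLocalizationMap_cechFrac (f : N →+ N') (hf : ∀ i m, f (x i • m) = x' i • f m)
    (I : Finset (Fin r)) (k : ℕ) (m : N) :
    cechLocalizationMap f hf I (cechFrac x I k m) = cechFrac x' I k (f m) :=
  (exists_cechLocalizationMap f hf I).choose_spec k m

theorem cechLocalizationMap_cechRestrict (f : N →+ N') (hf : ∀ i m, f (x i • m) = x' i • f m)
    {I J : Finset (Fin r)} (h : I ⊆ J) (y : CechLocalization N x I) :
    cechLocalizationMap f hf J (cechRestrict N x h y) =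
      cechRestrict N' x' h (cechLocalizationMap f hf I y) := by
  obtain ⟨k, m, rfl⟩ := exists_cechFrac y
  rw [cechRestrict_cechFrac, cechLocalizationMap_cechFrac, cechLocalizationMap_cechFrac,
    cechRestrict_cechFrac, map_prod_pow_smul hf]

theorem AddMonoidHom.map_neg_one_pow_smul {P P' : Type*} [AddCommGroup P] [Module B P]
    [AddCommGroup P'] [Module B' P'] (f : P →+ P') (n : ℕ) (y : P) :
    f ((-1 : B) ^ n • y) = (-1 : B') ^ n • f y := by
  rcases neg_one_pow_eq_or ℤ n with h | h
  · have h1 : Even n := by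
      by_contra h2
      rw [(Nat.not_even_iff_odd.1 h2).neg_one_pow] at h
      norm_num at h
    simp [h1.neg_one_pow]
  · have h1 : Odd n := by
      by_contra h2
      rw [(Nat.not_odd_iff_even.1 h2).neg_one_pow] at h
      norm_num at h
    simp [h1.neg_one_pow]

/-- The map of Čech cochains induced by an additive map compatible with `x` and `x'`. -/
noncomputable def cechMap (f : N →+ N') (hf : ∀ i m, f (x i • m) = x' i • f m) :
    ((I : Finset (Fin r)) → CechLocalization N x I) →+
      ((I : Finset (Fin r)) → CechLocalization N' x' I) :=
  AddMonoidHom.pi fun I => (cechLocalizationMap f hf I).comp (Pi.evalAddMonoidHom _ I)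

@[simp]
theorem cechMap_apply (f : N →+ N') (hf : ∀ i m, f (x i • m) = x' i • f m)
    (c : (I : Finset (Fin r)) → CechLocalization N x I) (I : Finset (Fin r)) :
    cechMap f hf c I = cechLocalizationMap f hf I (c I) := rfl

theorem cechDifferential_cechMap (f : N →+ N') (hf : ∀ i m, f (x i • m) = x' i • f m)
    (c : (I : Finset (Fin r)) → CechLocalization N x I) :
    cechDifferential N' x' (cechMap f hf c) = cechMap f hf (cechDifferential N x c) := by
  funext J
  simp only [cechDifferential_apply, cechMap_apply, map_sum]
  refine Finset.sum_congr rfl fun j _ => ?_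
  rw [AddMonoidHom.map_neg_one_pow_smul (B' := B'), cechLocalizationMap_cechRestrict]

end Functoriality

/-! ### The graded Čech complex. -/

section Graded

variable {B N : Type*} [CommRing B] [AddCommGroup N] [Module B N] {r : ℕ} {x : Fin r → B}
  {d : Fin r → ℕ} {𝒩 : ℤ → AddSubgroup N}

/-- Multiplication by `x i` raises degrees by `d i`. -/
def IsHomogeneousAction (x : Fin r → B) (d : Fin r → ℕ) (𝒩 : ℤ → AddSubgroup N) : Prop :=
  ∀ i n m, m ∈ 𝒩 n → x i • m ∈ 𝒩 (n + d i)

/-- Putting the whole module in every degree recovers the ungraded Čech complex. The internal degree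
is then a dummy and is written 0 below. -/
theorem IsHomogeneousAction.top : IsHomogeneousAction x d (fun _ => (⊤ : AddSubgroup N)) :=
  fun _ _ _ _ => AddSubgroup.mem_top _

theorem IsHomogeneousAction.prod_pow_smul (hx : IsHomogeneousAction x d 𝒩) (I : Finset (Fin r))
    (k : ℕ) {n : ℤ} {m : N} (hm : m ∈ 𝒩 n) :
    (∏ i ∈ I, x i) ^ k • m ∈ 𝒩 (n + k * ∑ i ∈ I, (d i : ℤ)) := by
  have h1 : ∀ n m, m ∈ 𝒩 n → (∏ i ∈ I, x i) • m ∈ 𝒩 (n + ∑ i ∈ I, (d i : ℤ)) := by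
    induction I using Finset.induction_on with
    | empty => simp
    | insert a s ha ih =>
      intro n m hm
      rw [Finset.prod_insert ha, Finset.sum_insert ha, mul_smul, add_comm (d a : ℤ), ← add_assoc]
      exact hx _ _ _ (ih n m hm)
  induction k generalizing n m with
  | zero => simpa using hm
  | succ k ih =>
    rw [pow_succ, mul_smul]
    convert ih (h1 n m hm) using 2
    push_cast
    ring

/-- The generating fractions are already closed under addition, since passing to a common
denominator preserves degrees. -/
theorem mem_localizationComponent (hx : IsHomogeneousAction x d 𝒩) {I : Finset (Fin r)} {n : ℤ}
    {y : CechLocalization N x I} : y ∈ localizationComponent x d 𝒩 I n ↔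
      ∃ (k : ℕ) (m : N), m ∈ 𝒩 (n + k * ∑ i ∈ I, (d i : ℤ)) ∧ y = cechFrac x I k m := by
  refine ⟨fun hy => ?_, fun h => AddSubgroup.subset_closure h⟩
  induction hy using AddSubgroup.closure_induction with
  | mem y hy => exact hy
  | zero => exact ⟨0, 0, zero_mem _, by simp⟩
  | add y z _ _ hy hz =>
    obtain ⟨k, m, hm, rfl⟩ := hy
    obtain ⟨l, m', hm', rfl⟩ := hz
    refine ⟨k + l, (∏ i ∈ I, x i) ^ l • m + (∏ i ∈ I, x i) ^ k • m', add_mem ?_ ?_, ?_⟩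
    · convert hx.prod_pow_smul I l hm using 2
      push_cast
      ring
    · convert hx.prod_pow_smul I k hm' using 2
      push_cast
      ring
    · rw [map_add, cechFrac_add, add_comm k, cechFrac_add]
  | neg y _ hy =>
    obtain ⟨k, m, hm, rfl⟩ := hy
    exact ⟨k, -m, neg_mem hm, by rw [map_neg]⟩

theorem mem_localizationComponent_top {I : Finset (Fin r)} {n : ℤ} (y : CechLocalization N x I) :
    y ∈ localizationComponent x d (fun _ => ⊤) I n := by
  obtain ⟨k, m, rfl⟩ := exists_cechFrac y
  exact (mem_localizationComponent .top).2 ⟨k, m, AddSubgroup.mem_top _, rfl⟩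

theorem cechRestrict_mem (hx : IsHomogeneousAction x d 𝒩) {I J : Finset (Fin r)} (h : I ⊆ J) {n : ℤ}
    {y : CechLocalization N x I} (hy : y ∈ localizationComponent x d 𝒩 I n) :
    cechRestrict N x h y ∈ localizationComponent x d 𝒩 J n := by
  obtain ⟨k, m, hm, rfl⟩ := (mem_localizationComponent hx).1 hy
  refine (mem_localizationComponent hx).2 ⟨k, _, ?_, cechRestrict_cechFrac h k m⟩
  convert hx.prod_pow_smul (J \ I) k hm using 2
  rw [← Finset.sum_sdiff h]
  ring

theorem mem_cechCochains {i : ℕ} {n : ℤ} {c : (I : Finset (Fin r)) → CechLocalization N x I} :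
    c ∈ cechCochains x d 𝒩 i n ↔ (∀ I, I.card = i → c I ∈ localizationComponent x d 𝒩 I n) ∧
      ∀ I, I.card ≠ i → c I = 0 := by
  rw [cechCochains, AddSubgroup.mem_pi]
  constructor
  · intro h
    refine ⟨fun I hI => ?_, fun I hI => ?_⟩
    · simpa [hI] using h I (Set.mem_univ _)
    · simpa [hI] using h I (Set.mem_univ _)
  · rintro ⟨h1, h2⟩ I -
    by_cases hI : I.card = i
    · simpa [hI] using h1 I hI
    · simpa [hI] using h2 I hI

/-- The cochains of cohomological degree `i - 1`. -/
def predCochains (x : Fin r → B) (d : Fin r → ℕ) (𝒩 : ℤ → AddSubgroup N) (i : ℕ) (n : ℤ) :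
    AddSubgroup ((I : Finset (Fin r)) → CechLocalization N x I) :=
  match i with
  | 0 => ⊥
  | i + 1 => cechCochains x d 𝒩 i n

theorem mem_cechCoboundaries {i : ℕ} {n : ℤ} {c : (I : Finset (Fin r)) → CechLocalization N x I} :
    c ∈ cechCoboundaries x d 𝒩 i n ↔ ∃ b ∈ predCochains x d 𝒩 i n, cechDifferential N x b = c := by
  cases i with
  | zero =>
    constructor
    · intro h
      exact ⟨0, zero_mem _, by rw [map_zero]; exact ((AddSubgroup.mem_bot).1 h).symm⟩
    · rintro ⟨b, hb, rfl⟩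
      rw [(AddSubgroup.mem_bot).1 hb, map_zero]
      exact zero_mem _
  | succ i => rfl

theorem cechDifferential_mem (hx : IsHomogeneousAction x d 𝒩) {i : ℕ} {n : ℤ}
    {c : (I : Finset (Fin r)) → CechLocalization N x I} (hc : c ∈ cechCochains x d 𝒩 i n) :
    cechDifferential N x c ∈ cechCochains x d 𝒩 (i + 1) n := by
  rw [mem_cechCochains] at hc ⊢
  refine ⟨fun J hJ => ?_, fun J hJ => ?_⟩
  · rw [cechDifferential_apply]
    refine sum_mem fun j hj => ?_
    have h1 : cechRestrict N x (Finset.erase_subset j J) (c (J.erase j)) ∈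
        localizationComponent x d 𝒩 J n := by
      refine cechRestrict_mem hx _ (hc.1 _ ?_)
      rw [Finset.card_erase_of_mem hj, hJ, Nat.add_sub_cancel]
    rcases neg_one_pow_eq_or B (J.filter (· < j)).card with h | h
    · rwa [h, one_smul]
    · rw [h, neg_one_smul]
      exact neg_mem h1
  · rw [cechDifferential_apply]
    refine Finset.sum_eq_zero fun j hj => ?_
    rw [hc.2, map_zero, smul_zero]
    rw [Finset.card_erase_of_mem hj]
    have := Finset.card_pos.2 ⟨j, hj⟩
    omega

/-- The vanishing of `[H^i_𝔪(N)]_n`. -/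
def CechVanishes (x : Fin r → B) (d : Fin r → ℕ) (𝒩 : ℤ → AddSubgroup N) (i : ℕ) (n : ℤ) : Prop :=
  ∀ c ∈ cechCochains x d 𝒩 i n, cechDifferential N x c = 0 → c ∈ cechCoboundaries x d 𝒩 i n

theorem nontrivial_gradedLocalCohomology_iff {i : ℕ} {n : ℤ} :
    Nontrivial (GradedLocalCohomology x d 𝒩 i n) ↔ ¬ CechVanishes x d 𝒩 i n := by
  rw [← not_subsingleton_iff_nontrivial, QuotientAddGroup.subsingleton_iff, not_iff_not,
    AddSubgroup.addSubgroupOf_eq_top]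
  exact ⟨fun h c hc hd => h ⟨hc, hd⟩, fun h c hc => h c hc.1 hc.2⟩

theorem cechVanishes_of_lt {i : ℕ} (hi : r < i) (n : ℤ) : CechVanishes x d 𝒩 i n := by
  intro c hc _
  have : c = 0 := by
    funext I
    refine (mem_cechCochains.1 hc).2 I ?_
    have := Finset.card_le_univ I
    rw [Fintype.card_fin] at this
    omega
  rw [this]
  exact zero_mem _

end Graded

/-! ### The portions of the long exact cohomology sequence that are needed. -/

section ShortExact

variable {B₁ N₁ B₂ N₂ B₃ N₃ : Type*} [CommRing B₁] [AddCommGroup N₁] [Module B₁ N₁]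
  [CommRing B₂] [AddCommGroup N₂] [Module B₂ N₂] [CommRing B₃] [AddCommGroup N₃] [Module B₃ N₃]
  {r : ℕ} {x₁ : Fin r → B₁} {x₂ : Fin r → B₂} {x₃ : Fin r → B₃} {d : Fin r → ℕ}
  {𝒩₁ : ℤ → AddSubgroup N₁} {𝒩₂ : ℤ → AddSubgroup N₂} {𝒩₃ : ℤ → AddSubgroup N₃}

theorem cechLocalizationMap_mem (h₁ : IsHomogeneousAction x₁ d 𝒩₁)
    {f : N₁ →+ N₂} (hf : ∀ i m, f (x₁ i • m) = x₂ i • f m) (hfm : ∀ n m, m ∈ 𝒩₁ n → f m ∈ 𝒩₂ n)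
    {I : Finset (Fin r)} {n : ℤ} {y : CechLocalization N₁ x₁ I}
    (hy : y ∈ localizationComponent x₁ d 𝒩₁ I n) :
    cechLocalizationMap f hf I y ∈ localizationComponent x₂ d 𝒩₂ I n := by
  obtain ⟨k, m, hm, rfl⟩ := (mem_localizationComponent h₁).1 hy
  exact AddSubgroup.subset_closure ⟨k, _, hfm _ _ hm, cechLocalizationMap_cechFrac f hf I k m⟩

theorem cechMap_mem (h₁ : IsHomogeneousAction x₁ d 𝒩₁)
    {f : N₁ →+ N₂} (hf : ∀ i m, f (x₁ i • m) = x₂ i • f m) (hfm : ∀ n m, m ∈ 𝒩₁ n → f m ∈ 𝒩₂ n)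
    {i : ℕ} {n : ℤ} {c : (I : Finset (Fin r)) → CechLocalization N₁ x₁ I}
    (hc : c ∈ cechCochains x₁ d 𝒩₁ i n) : cechMap f hf c ∈ cechCochains x₂ d 𝒩₂ i n := by
  rw [mem_cechCochains] at hc ⊢
  refine ⟨fun I hI => cechLocalizationMap_mem h₁ hf hfm (hc.1 I hI), fun I hI => ?_⟩
  rw [cechMap_apply, hc.2 I hI, map_zero]

/-- A short exact sequence of graded modules `0 → N₁ → N₂ → N₃ → 0`, possibly over different
rings, compatible with the elements `x₁`, `x₂`, `x₃`. -/
structure IsCechExact (x₁ : Fin r → B₁) (x₂ : Fin r → B₂) (x₃ : Fin r → B₃) (d : Fin r → ℕ)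
    (𝒩₁ : ℤ → AddSubgroup N₁) (𝒩₂ : ℤ → AddSubgroup N₂) (𝒩₃ : ℤ → AddSubgroup N₃)
    (f : N₁ →+ N₂) (g : N₂ →+ N₃) : Prop where
  hom₁ : IsHomogeneousAction x₁ d 𝒩₁
  hom₂ : IsHomogeneousAction x₂ d 𝒩₂
  hom₃ : IsHomogeneousAction x₃ d 𝒩₃
  map_smul_left : ∀ i m, f (x₁ i • m) = x₂ i • f m
  map_smul_right : ∀ i m, g (x₂ i • m) = x₃ i • g m
  injective : Function.Injective f
  map_mem_left : ∀ n m, m ∈ 𝒩₁ n → f m ∈ 𝒩₂ n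
  map_mem_right : ∀ n m, m ∈ 𝒩₂ n → g m ∈ 𝒩₃ n
  comp_eq_zero : ∀ m, g (f m) = 0
  exists_of_eq_zero : ∀ n m, m ∈ 𝒩₂ n → g m = 0 → ∃ m' ∈ 𝒩₁ n, f m' = m
  exists_preimage : ∀ n m, m ∈ 𝒩₃ n → ∃ m' ∈ 𝒩₂ n, g m' = m

namespace IsCechExact

variable {f : N₁ →+ N₂} {g : N₂ →+ N₃} (h : IsCechExact x₁ x₂ x₃ d 𝒩₁ 𝒩₂ 𝒩₃ f g)
include h

theorem cechMap_injective : Function.Injective (cechMap f h.map_smul_left) := by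
  rw [injective_iff_map_eq_zero]
  intro c hc
  funext I
  obtain ⟨k, m, hm⟩ := exists_cechFrac (c I)
  have h1 := congrFun hc I
  rw [cechMap_apply, hm, cechLocalizationMap_cechFrac, Pi.zero_apply, cechFrac_eq_zero_iff] at h1
  obtain ⟨t, ht⟩ := h1
  rw [hm, Pi.zero_apply, cechFrac_eq_zero_iff]
  refine ⟨t, h.injective ?_⟩
  rw [map_prod_pow_smul h.map_smul_left, ht, map_zero]

theorem cechMap_cechMap (c : (I : Finset (Fin r)) → CechLocalization N₁ x₁ I) :
    cechMap g h.map_smul_right (cechMap f h.map_smul_left c) = 0 := by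
  funext I
  obtain ⟨k, m, hm⟩ := exists_cechFrac (c I)
  simp [hm, h.comp_eq_zero]

theorem exists_cechMap_eq {i : ℕ} {n : ℤ} {c : (I : Finset (Fin r)) → CechLocalization N₂ x₂ I}
    (hc : c ∈ cechCochains x₂ d 𝒩₂ i n) (hgc : cechMap g h.map_smul_right c = 0) :
    ∃ b ∈ cechCochains x₁ d 𝒩₁ i n, cechMap f h.map_smul_left b = c := by
  rw [mem_cechCochains] at hc
  have h1 : ∀ I, ∃ y : CechLocalization N₁ x₁ I, (I.card = i → y ∈ localizationComponent x₁ d 𝒩₁ I n) ∧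
      (I.card ≠ i → y = 0) ∧ cechLocalizationMap f h.map_smul_left I y = c I := by
    intro I
    by_cases hI : I.card = i
    · obtain ⟨k, m, hm, hy⟩ := (mem_localizationComponent h.hom₂).1 (hc.1 I hI)
      have h2 := congrFun hgc I
      rw [cechMap_apply, hy, cechLocalizationMap_cechFrac, Pi.zero_apply, cechFrac_eq_zero_iff] at h2
      obtain ⟨t, ht⟩ := h2
      rw [← map_prod_pow_smul h.map_smul_right] at ht
      -- The image of m dies only after multiplication by x_I^t, so the fraction is rewritten with
      -- numerator x_I^t m before lifting to N₁.
      obtain ⟨m', hm', hfm⟩ := h.exists_of_eq_zero _ _ (h.hom₂.prod_pow_smul I t hm) ht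
      refine ⟨cechFrac x₁ I (k + t) m', fun _ => (mem_localizationComponent h.hom₁).2
        ⟨k + t, m', ?_, rfl⟩, fun h3 => absurd hI h3, ?_⟩
      · convert hm' using 2
        push_cast
        ring
      · rw [cechLocalizationMap_cechFrac, hfm, hy, cechFrac_add]
    · exact ⟨0, fun h3 => absurd h3 hI, fun _ => rfl, by rw [map_zero, hc.2 I hI]⟩
  choose b hb1 hb2 hb3 using h1
  exact ⟨b, mem_cechCochains.2 ⟨hb1, hb2⟩, funext hb3⟩

theorem exists_cechMap_eq' {i : ℕ} {n : ℤ} {c : (I : Finset (Fin r)) → CechLocalization N₃ x₃ I}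
    (hc : c ∈ cechCochains x₃ d 𝒩₃ i n) :
    ∃ b ∈ cechCochains x₂ d 𝒩₂ i n, cechMap g h.map_smul_right b = c := by
  rw [mem_cechCochains] at hc
  have h1 : ∀ I, ∃ y : CechLocalization N₂ x₂ I, (I.card = i → y ∈ localizationComponent x₂ d 𝒩₂ I n) ∧
      (I.card ≠ i → y = 0) ∧ cechLocalizationMap g h.map_smul_right I y = c I := by
    intro I
    by_cases hI : I.card = i
    · obtain ⟨k, m, hm, hy⟩ := (mem_localizationComponent h.hom₃).1 (hc.1 I hI)
      obtain ⟨m', hm', rfl⟩ := h.exists_preimage _ _ hm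
      refine ⟨cechFrac x₂ I k m', fun _ => (mem_localizationComponent h.hom₂).2
        ⟨k, m', hm', rfl⟩, fun h3 => absurd hI h3, ?_⟩
      rw [cechLocalizationMap_cechFrac, hy]
    · exact ⟨0, fun h3 => absurd h3 hI, fun _ => rfl, by rw [map_zero, hc.2 I hI]⟩
  choose b hb1 hb2 hb3 using h1
  exact ⟨b, mem_cechCochains.2 ⟨hb1, hb2⟩, funext hb3⟩

/-- If `H^i(N₂) = 0` and `H^{i+1}(N₁) → H^{i+1}(N₂)` is injective then `H^i(N₃) = 0`. -/
theorem vanishes_right_of_injective {i : ℕ} {n : ℤ} (h₂ : CechVanishes x₂ d 𝒩₂ i n)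
    (hinj : ∀ c ∈ cechCochains x₁ d 𝒩₁ (i + 1) n, cechDifferential N₁ x₁ c = 0 →
      cechMap f h.map_smul_left c ∈ cechCoboundaries x₂ d 𝒩₂ (i + 1) n →
      c ∈ cechCoboundaries x₁ d 𝒩₁ (i + 1) n) : CechVanishes x₃ d 𝒩₃ i n := by
  intro c'' hc'' hd
  obtain ⟨c, hc, rfl⟩ := h.exists_cechMap_eq' hc''
  rw [cechDifferential_cechMap] at hd
  -- The connecting homomorphism: lift the cocycle to N₂, and its differential comes from N₁.
  obtain ⟨c', hc', hfc⟩ := h.exists_cechMap_eq (cechDifferential_mem h.hom₂ hc) hd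
  have h3 : cechDifferential N₁ x₁ c' = 0 := by
    apply h.cechMap_injective
    rw [← cechDifferential_cechMap, hfc, cechDifferential_cechDifferential, map_zero]
  obtain ⟨b', hb', hdb'⟩ := mem_cechCoboundaries.1 (hinj c' hc' h3 ⟨c, hc, hfc.symm⟩)
  -- Subtracting the image of `b'` turns the lift into a cocycle of N₂ without changing its image in
  -- N₃.
  obtain ⟨b, hb, hdb⟩ := mem_cechCoboundaries.1 (h₂ (c - cechMap f h.map_smul_left b')
    (sub_mem hc (cechMap_mem h.hom₁ _ h.map_mem_left hb')) (by
      rw [map_sub, cechDifferential_cechMap, hdb', hfc, sub_self]))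
  refine mem_cechCoboundaries.2 ⟨cechMap g h.map_smul_right b, ?_, ?_⟩
  · cases i with
    | zero => rw [(AddSubgroup.mem_bot).1 hb, map_zero]; exact zero_mem _
    | succ i => exact cechMap_mem h.hom₂ _ h.map_mem_right hb
  · rw [cechDifferential_cechMap, hdb, map_sub, h.cechMap_cechMap, sub_zero]

theorem vanishes_right {i : ℕ} {n : ℤ} (h₂ : CechVanishes x₂ d 𝒩₂ i n)
    (h₁ : CechVanishes x₁ d 𝒩₁ (i + 1) n) : CechVanishes x₃ d 𝒩₃ i n :=
  h.vanishes_right_of_injective h₂ fun c hc hd _ => h₁ c hc hd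

/-- If `H^{i-1}(N₃) = 0` then `H^i(N₁) → H^i(N₂)` is injective. -/
theorem mem_coboundaries_left {i : ℕ} {n : ℤ} (h₃ : ∀ j, j + 1 = i → CechVanishes x₃ d 𝒩₃ j n)
    {c : (I : Finset (Fin r)) → CechLocalization N₁ x₁ I}
    (hfc : cechMap f h.map_smul_left c ∈ cechCoboundaries x₂ d 𝒩₂ i n) :
    c ∈ cechCoboundaries x₁ d 𝒩₁ i n := by
  obtain ⟨e, he, hde⟩ := mem_cechCoboundaries.1 hfc
  cases i with
  | zero =>
    rw [(AddSubgroup.mem_bot).1 he, map_zero] at hde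
    have : c = 0 := h.cechMap_injective (by rw [← hde, map_zero])
    rw [this]
    exact zero_mem _
  | succ i =>
    have he' : e ∈ cechCochains x₂ d 𝒩₂ i n := he
    obtain ⟨b'', hb'', hdb''⟩ := mem_cechCoboundaries.1 (h₃ i rfl (cechMap g h.map_smul_right e)
      (cechMap_mem h.hom₂ _ h.map_mem_right he') (by
        rw [cechDifferential_cechMap, hde, h.cechMap_cechMap]))
    obtain ⟨b, hb, rfl⟩ : ∃ b ∈ predCochains x₂ d 𝒩₂ i n, cechMap g h.map_smul_right b = b'' := by
      cases i with
      | zero =>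
        exact ⟨0, zero_mem _, by rw [(AddSubgroup.mem_bot).1 hb'', map_zero]⟩
      | succ i => exact h.exists_cechMap_eq' hb''
    have hdb : cechDifferential N₂ x₂ b ∈ cechCochains x₂ d 𝒩₂ i n := by
      cases i with
      | zero => rw [(AddSubgroup.mem_bot).1 hb, map_zero]; exact zero_mem _
      | succ i => exact cechDifferential_mem h.hom₂ hb
    -- Changing the primitive e by the coboundary of b makes it vanish in N₃, so it descends to a
    -- primitive in N₁.
    obtain ⟨e', he', hfe'⟩ := h.exists_cechMap_eq (sub_mem he' hdb) (by
      rw [map_sub, ← cechDifferential_cechMap, hdb'', sub_self])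
    refine mem_cechCoboundaries.2 ⟨e', he', h.cechMap_injective ?_⟩
    rw [← cechDifferential_cechMap, hfe', map_sub, cechDifferential_cechDifferential, sub_zero, hde]

theorem vanishes_left {i : ℕ} {n : ℤ} (h₃ : ∀ j, j + 1 = i → CechVanishes x₃ d 𝒩₃ j n)
    (h₂ : CechVanishes x₂ d 𝒩₂ i n) : CechVanishes x₁ d 𝒩₁ i n := fun c hc hd =>
  h.mem_coboundaries_left h₃ (h₂ _ (cechMap_mem h.hom₁ _ h.map_mem_left hc) (by
    rw [cechDifferential_cechMap, hd, map_zero]))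

end IsCechExact

end ShortExact

/-! ### Comparison of the graded and the ungraded Čech cohomology. -/

section Projections

/-- The maps `p n` are the projections onto the components of a grading of `N`. -/
structure IsGradingProjection {N : Type*} [AddCommGroup N] (𝒩 : ℤ → AddSubgroup N)
    (p : ℤ → N →+ N) : Prop where
  mem : ∀ n m, p n m ∈ 𝒩 n
  eq_self : ∀ n, ∀ m ∈ 𝒩 n, p n m = m
  eq_zero : ∀ n n', n ≠ n' → ∀ m ∈ 𝒩 n', p n m = 0
  exists_sum : ∀ m, ∃ F : Finset ℤ, ∑ n ∈ F, p n m = m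

variable {B N : Type*} [CommRing B] [AddCommGroup N] [Module B N] {r : ℕ} {x : Fin r → B}
  {d : Fin r → ℕ} {𝒩 : ℤ → AddSubgroup N} {p : ℤ → N →+ N}

theorem IsGradingProjection.map_smul (hp : IsGradingProjection 𝒩 p) (hx : IsHomogeneousAction x d 𝒩)
    (i : Fin r) (n : ℤ) (m : N) : p (n + d i) (x i • m) = x i • p n m := by
  obtain ⟨F, hF⟩ := hp.exists_sum m
  have h1 : ∀ n', p (n + d i) (x i • p n' m) = if n' = n then x i • p n m else 0 := by
    intro n'
    split_ifs with h
    · rw [h, hp.eq_self _ _ (hx i _ _ (hp.mem n m))]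
    · exact hp.eq_zero _ _ (fun h' => h (by omega)) _ (hx i _ _ (hp.mem n' m))
  have h2 : ∀ n', p n (p n' m) = if n' = n then p n m else 0 := by
    intro n'
    split_ifs with h
    · rw [h, hp.eq_self _ _ (hp.mem n m)]
    · exact hp.eq_zero _ _ (fun h' => h h'.symm) _ (hp.mem n' m)
  have h3 : p n m = ∑ n' ∈ F, if n' = n then p n m else 0 := by
    conv_lhs => rw [← hF, map_sum]
    exact Finset.sum_congr rfl fun n' _ => h2 n'
  conv_lhs => rw [← hF, Finset.smul_sum, map_sum]
  rw [Finset.sum_congr rfl fun n' _ => h1 n']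
  conv_rhs => rw [h3, Finset.smul_sum]
  refine Finset.sum_congr rfl fun n' _ => ?_
  split_ifs <;> simp

theorem IsGradingProjection.map_prod_pow_smul (hp : IsGradingProjection 𝒩 p)
    (hx : IsHomogeneousAction x d 𝒩) (I : Finset (Fin r)) (k : ℕ) (n : ℤ) (m : N) :
    p (n + k * ∑ i ∈ I, (d i : ℤ)) ((∏ i ∈ I, x i) ^ k • m) = (∏ i ∈ I, x i) ^ k • p n m := by
  have h1 : ∀ n m, p (n + ∑ i ∈ I, (d i : ℤ)) ((∏ i ∈ I, x i) • m) = (∏ i ∈ I, x i) • p n m := by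
    induction I using Finset.induction_on with
    | empty => simp
    | insert a s ha ih =>
      intro n m
      rw [Finset.prod_insert ha, Finset.sum_insert ha, mul_smul, add_comm (d a : ℤ), ← add_assoc,
        hp.map_smul hx, ih, mul_smul]
  induction k generalizing n m with
  | zero => simp
  | succ k ih =>
    rw [pow_succ, mul_smul, mul_smul, ← h1, ← ih]
    congr 2
    push_cast
    ring

/-- The projection of `N_{x_I}` onto its component of degree `n`. -/
theorem exists_cechProjection (hp : IsGradingProjection 𝒩 p) (hx : IsHomogeneousAction x d 𝒩)
    (I : Finset (Fin r)) (n : ℤ) : ∃ φ : CechLocalization N x I →+ CechLocalization N x I,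
      ∀ k m, φ (cechFrac x I k m) = cechFrac x I k (p (n + k * ∑ i ∈ I, (d i : ℤ)) m) := by
  choose k m h using fun y : CechLocalization N x I => exists_cechFrac y
  have key : ∀ k' m', cechFrac x I (k (cechFrac x I k' m'))
      (p (n + k (cechFrac x I k' m') * ∑ i ∈ I, (d i : ℤ)) (m (cechFrac x I k' m'))) =
      cechFrac x I k' (p (n + k' * ∑ i ∈ I, (d i : ℤ)) m') := by
    intro k' m'
    obtain ⟨t, ht⟩ := cechFrac_eq_iff.1 (h (cechFrac x I k' m'))
    refine cechFrac_eq_iff.2 ⟨t, ?_⟩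
    rw [← hp.map_prod_pow_smul hx, ← hp.map_prod_pow_smul hx, ht]
    congr 2
    push_cast
    ring
  refine ⟨AddMonoidHom.mk' (fun y => cechFrac x I (k y) (p (n + k y * ∑ i ∈ I, (d i : ℤ)) (m y)))
    fun y z => ?_, key⟩
  have h1 : y + z = cechFrac x I (k y + k z)
      ((∏ i ∈ I, x i) ^ k z • m y + (∏ i ∈ I, x i) ^ k y • m z) := by
    rw [map_add, cechFrac_add, add_comm (k y), cechFrac_add, ← h, ← h]
  have h2 : ∀ k l m, p (n + (k + l : ℕ) * ∑ i ∈ I, (d i : ℤ)) ((∏ i ∈ I, x i) ^ l • m) =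
      (∏ i ∈ I, x i) ^ l • p (n + k * ∑ i ∈ I, (d i : ℤ)) m := by
    intro k l m
    rw [← hp.map_prod_pow_smul hx]
    congr 2
    push_cast
    ring
  conv_lhs => rw [h1, key, map_add, map_add, h2, add_comm (k y), h2, cechFrac_add,
    add_comm (k z), cechFrac_add]

/-- The projection of `N_{x_I}` onto its component of degree `n`. -/
noncomputable def cechProjection (hp : IsGradingProjection 𝒩 p) (hx : IsHomogeneousAction x d 𝒩)
    (I : Finset (Fin r)) (n : ℤ) : CechLocalization N x I →+ CechLocalization N x I :=
  (exists_cechProjection hp hx I n).choose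

section

variable (hp : IsGradingProjection 𝒩 p) (hx : IsHomogeneousAction x d 𝒩) {I J : Finset (Fin r)} {n : ℤ}
include hp hx

@[simp]
theorem cechProjection_cechFrac (k : ℕ) (m : N) : cechProjection hp hx I n (cechFrac x I k m) =
    cechFrac x I k (p (n + k * ∑ i ∈ I, (d i : ℤ)) m) :=
  (exists_cechProjection hp hx I n).choose_spec k m

theorem cechProjection_mem (y : CechLocalization N x I) :
    cechProjection hp hx I n y ∈ localizationComponent x d 𝒩 I n := by
  obtain ⟨k, m, rfl⟩ := exists_cechFrac y
  rw [cechProjection_cechFrac]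
  exact (mem_localizationComponent hx).2 ⟨k, _, hp.mem _ _, rfl⟩

theorem cechProjection_eq_self {y : CechLocalization N x I}
    (hy : y ∈ localizationComponent x d 𝒩 I n) : cechProjection hp hx I n y = y := by
  obtain ⟨k, m, hm, rfl⟩ := (mem_localizationComponent hx).1 hy
  rw [cechProjection_cechFrac, hp.eq_self _ _ hm]

theorem cechProjection_eq_zero {n' : ℤ} (hn : n ≠ n') {y : CechLocalization N x I}
    (hy : y ∈ localizationComponent x d 𝒩 I n') : cechProjection hp hx I n y = 0 := by
  obtain ⟨k, m, hm, rfl⟩ := (mem_localizationComponent hx).1 hy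
  rw [cechProjection_cechFrac, hp.eq_zero _ _ (by omega) _ hm, map_zero]

theorem cechProjection_exists_sum (y : CechLocalization N x I) :
    ∃ F : Finset ℤ, ∑ n ∈ F, cechProjection hp hx I n y = y := by
  obtain ⟨k, m, rfl⟩ := exists_cechFrac y
  obtain ⟨F, hF⟩ := hp.exists_sum m
  refine ⟨F.image fun n => n - k * ∑ i ∈ I, (d i : ℤ), ?_⟩
  rw [Finset.sum_image fun a _ b _ h => by simpa using h]
  simp only [cechProjection_cechFrac, sub_add_cancel]
  rw [← map_sum, hF]

theorem cechProjection_cechRestrict (h : I ⊆ J) (y : CechLocalization N x I) :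
    cechProjection hp hx J n (cechRestrict N x h y) =
      cechRestrict N x h (cechProjection hp hx I n y) := by
  obtain ⟨k, m, rfl⟩ := exists_cechFrac y
  rw [cechRestrict_cechFrac, cechProjection_cechFrac, cechProjection_cechFrac,
    cechRestrict_cechFrac, ← hp.map_prod_pow_smul hx]
  congr 2
  rw [← Finset.sum_sdiff h, mul_add, add_comm (_ * _), add_assoc]

theorem cechDifferential_cechProjection (c : (I : Finset (Fin r)) → CechLocalization N x I) :
    cechDifferential N x (fun I => cechProjection hp hx I n (c I)) =
      fun I => cechProjection hp hx I n (cechDifferential N x c I) := by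
  funext J
  simp only [cechDifferential_apply, map_sum]
  refine Finset.sum_congr rfl fun j _ => ?_
  rw [AddMonoidHom.map_neg_one_pow_smul (B' := B), cechProjection_cechRestrict]

omit hp hx in
theorem mem_cechCochains_top {i : ℕ} {n : ℤ} {c : (I : Finset (Fin r)) → CechLocalization N x I} :
    c ∈ cechCochains x d (fun _ => (⊤ : AddSubgroup N)) i n ↔ ∀ I, I.card ≠ i → c I = 0 :=
  mem_cechCochains.trans ⟨fun h => h.2, fun h => ⟨fun _ _ => mem_localizationComponent_top _, h⟩⟩

/-- The projections to degree n commute with the differential, and a cochain has finitely many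
components, each with finitely many homogeneous parts. So the ungraded cohomology vanishes exactly
when all of its graded pieces do. Regular sequences see the left side, a-invariants the right. -/
theorem cechVanishes_top_iff (i : ℕ) :
    CechVanishes x d (fun _ => (⊤ : AddSubgroup N)) i 0 ↔ ∀ n, CechVanishes x d 𝒩 i n := by
  constructor
  · intro h n c hc hd
    rw [mem_cechCochains] at hc
    obtain ⟨b, hb, rfl⟩ := mem_cechCoboundaries.1 (h c ((mem_cechCochains_top).2 hc.2) hd)
    refine mem_cechCoboundaries.2 ⟨fun I => cechProjection hp hx I n (b I), ?_, ?_⟩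
    · cases i with
      | zero =>
        rw [(AddSubgroup.mem_bot).1 hb]
        simp only [Pi.zero_apply, map_zero]
        exact zero_mem _
      | succ i =>
        refine mem_cechCochains.2 ⟨fun I _ => cechProjection_mem hp hx _, fun I hI => ?_⟩
        rw [(mem_cechCochains_top).1 hb I hI, map_zero]
    · rw [cechDifferential_cechProjection]
      funext I
      by_cases hI : I.card = i
      · exact cechProjection_eq_self hp hx (hc.1 I hI)
      · rw [hc.2 I hI, map_zero]
  · intro h c hc hd
    rw [mem_cechCochains_top] at hc
    choose F hF using fun I => cechProjection_exists_sum hp hx (c I)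
    have h1 : ∀ I, ∀ n ∉ F I, cechProjection hp hx I n (c I) = 0 := by
      intro I n hn
      rw [← hF I, map_sum]
      exact Finset.sum_eq_zero fun n' hn' => cechProjection_eq_zero hp hx
        (by rintro rfl; exact hn hn') (cechProjection_mem hp hx _)
    let F' := Finset.univ.biUnion F
    have h2 : c = ∑ n ∈ F', fun I => cechProjection hp hx I n (c I) := by
      funext I
      rw [Finset.sum_apply]
      conv_lhs => rw [← hF I]
      exact Finset.sum_subset (fun n hn => Finset.mem_biUnion.2 ⟨I, Finset.mem_univ _, hn⟩)
        fun n _ hn => h1 I n hn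
    rw [h2]
    refine sum_mem fun n _ => ?_
    obtain ⟨b, hb, hb'⟩ := mem_cechCoboundaries.1 (h n (fun I => cechProjection hp hx I n (c I))
      (mem_cechCochains.2 ⟨fun I _ => cechProjection_mem hp hx _, fun I hI => by
        rw [hc I hI, map_zero]⟩) (by
      rw [cechDifferential_cechProjection, hd]
      funext I
      simp))
    refine mem_cechCoboundaries.2 ⟨b, ?_, hb'⟩
    cases i with
    | zero => exact hb
    | succ i => exact (mem_cechCochains_top).2 (mem_cechCochains.1 hb).2

end

end Projections

/-! ### Čech cohomology classes are torsion with respect to the ideal generated by `x`. -/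

section Torsion

variable {B N : Type*} [CommRing B] [AddCommGroup N] [Module B N] {r : ℕ} {x : Fin r → B}
  {d : Fin r → ℕ}

theorem cechCoboundaries_top_smul {i : ℕ} (b : B) {c : (I : Finset (Fin r)) → CechLocalization N x I}
    (hc : c ∈ cechCoboundaries x d (fun _ => (⊤ : AddSubgroup N)) i 0) :
    b • c ∈ cechCoboundaries x d (fun _ => (⊤ : AddSubgroup N)) i 0 := by
  obtain ⟨e, he, rfl⟩ := mem_cechCoboundaries.1 hc
  refine mem_cechCoboundaries.2 ⟨b • e, ?_, map_smul _ _ _⟩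
  cases i with
  | zero => rw [(AddSubgroup.mem_bot).1 he, smul_zero]; exact zero_mem _
  | succ i =>
    refine mem_cechCochains.2 ⟨fun I _ => mem_localizationComponent_top _, fun I hI => ?_⟩
    rw [Pi.smul_apply, (mem_cechCochains.1 he).2 I hI, smul_zero]

/-- After inverting x_j the Čech complex is contractible. The contraction is written with
denominators cleared, and the elements it fails to account for are killed by a further power of x_j.
-/
theorem exists_pow_smul_mem_cechCoboundaries {i : ℕ} {c : (I : Finset (Fin r)) → CechLocalization N x I}
    (hc : c ∈ cechCochains x d (fun _ => (⊤ : AddSubgroup N)) i 0) (hd : cechDifferential N x c = 0)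
    (j : Fin r) : ∃ t : ℕ, x j ^ t • c ∈ cechCoboundaries x d (fun _ => (⊤ : AddSubgroup N)) i 0 := by
  have hc' := (mem_cechCochains.1 hc).2
  choose k m hkm using fun I => exists_cechFrac (c I)
  let K := Finset.univ.sup k
  have h1 : ∀ I, ∃ m, c I = cechFrac x I K m := fun I => by
    refine ⟨(∏ i ∈ I, x i) ^ (K - k I) • m I, ?_⟩
    rw [hkm I, ← cechFrac_add (k I) (K - k I),
      Nat.add_sub_cancel' (Finset.le_sup (Finset.mem_univ I))]
  choose m hm using h1
  -- The homotopy: read the numerator of c at I ∪ {j} over x_I^K instead of (x_j x_I)^K. Restricting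
  -- back to I ∪ {j} costs exactly the factor x_j^K.
  let b : (I : Finset (Fin r)) → CechLocalization N x I := fun I =>
    if j ∉ I ∧ I.card + 1 = i then
      (-1 : B) ^ ((insert j I).filter (· < j)).card • cechFrac x I K (m (insert j I)) else 0
  have hb0 : ∀ I, j ∈ I → b I = 0 := fun I hI => if_neg fun h => h.1 hI
  have hb1 : ∀ J, j ∈ J → cechDifferential N x b J = x j ^ K • c J := by
    intro J hJ
    rw [cechDifferential_apply, Finset.sum_eq_single j]
    · by_cases hcard : J.card = i
      · have h2 : b (J.erase j) = (-1 : B) ^ (J.filter (· < j)).card •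
            cechFrac x (J.erase j) K (m J) := by
          simp only [b]
          rw [if_pos, Finset.insert_erase hJ]
          refine ⟨Finset.notMem_erase j J, ?_⟩
          rw [Finset.card_erase_add_one hJ, hcard]
        rw [h2, map_smul, smul_smul, ← mul_pow, neg_one_mul, neg_neg, one_pow, one_smul,
          cechRestrict_cechFrac, hm J, ← map_smul]
        congr 3
        rw [Finset.sdiff_erase_self hJ, Finset.prod_singleton]
      · have h2 : b (J.erase j) = 0 := by
          simp only [b]
          refine if_neg fun h => hcard ?_
          rw [← h.2, Finset.card_erase_add_one hJ]
        rw [h2, hc' J hcard]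
        simp
    · intro l hl hlj
      rw [hb0 _ (Finset.mem_erase.2 ⟨hlj.symm, hJ⟩), map_zero, smul_zero]
    · exact fun h => absurd hJ h
  let e := cechDifferential N x b - x j ^ K • c
  have he1 : ∀ J, j ∈ J → e J = 0 := fun J hJ => by
    simp only [e, Pi.sub_apply, Pi.smul_apply]
    rw [hb1 J hJ, sub_self]
  have he2 : cechDifferential N x e = 0 := by
    rw [map_sub, map_smul, hd, smul_zero, cechDifferential_cechDifferential, sub_zero]
  -- The defect e is a cocycle vanishing on all indices that contain j. For j ∉ J, the component of
  -- d e at J ∪ {j} has the single term ± the restriction of `e J`, so `e J` dies in N localized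
  -- further at x_j.
  have he3 : ∀ J, ∃ t, x j ^ t • e J = 0 := by
    intro J
    by_cases hJ : j ∈ J
    · exact ⟨0, by rw [he1 J hJ, smul_zero]⟩
    have h2 := congrFun he2 (insert j J)
    rw [cechDifferential_apply', Finset.sum_eq_single j] at h2
    · rw [Finset.erase_insert hJ, cechEval, dif_pos (Finset.subset_insert j J), Pi.zero_apply] at h2
      have h3 : cechRestrict N x (Finset.subset_insert j J) (e J) = 0 := by
        rcases neg_one_pow_eq_or B ((insert j J).filter (· < j)).card with h | h
        · rwa [h, one_smul] at h2
        · rwa [h, neg_one_smul, neg_eq_zero] at h2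
      obtain ⟨l, n, hn⟩ := exists_cechFrac (e J)
      rw [hn, cechRestrict_cechFrac, cechFrac_eq_zero_iff] at h3
      obtain ⟨t, ht⟩ := h3
      rw [Finset.insert_sdiff_cancel hJ, Finset.prod_singleton, Finset.prod_insert hJ, mul_pow,
        mul_comm, mul_smul, ← mul_smul (x j ^ t), ← pow_add] at ht
      refine ⟨t + l, ?_⟩
      rw [hn, ← map_smul, cechFrac_eq_zero_iff]
      exact ⟨t, ht⟩
    · intro l hl hlj
      rw [cechEval, dif_pos (Finset.erase_subset _ _), he1 _ (Finset.mem_erase.2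
        ⟨hlj.symm, Finset.mem_insert_self _ _⟩), map_zero, smul_zero]
    · exact fun h => absurd (Finset.mem_insert_self _ _) h
  choose t ht using he3
  let T := Finset.univ.sup t
  have he4 : x j ^ T • e = 0 := by
    funext J
    rw [Pi.smul_apply, ← Nat.sub_add_cancel (show t J ≤ T from Finset.le_sup (f := t) (Finset.mem_univ J)), pow_add,
      mul_smul, ht, smul_zero, Pi.zero_apply]
  refine ⟨T + K, mem_cechCoboundaries.2 ⟨x j ^ T • b, ?_, ?_⟩⟩
  · cases i with
    | zero =>
      have : b = 0 := funext fun I => if_neg fun h => by omega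
      rw [this, smul_zero]
      exact zero_mem _
    | succ i =>
      refine mem_cechCochains.2 ⟨fun I _ => mem_localizationComponent_top _, fun I hI => ?_⟩
      rw [Pi.smul_apply]
      have : b I = 0 := if_neg fun h => hI (by omega)
      rw [this, smul_zero]
  · rw [map_smul, pow_add, mul_smul, ← sub_eq_zero, ← smul_sub]
    exact he4

/-- The multipliers sending c into the coboundaries form an ideal, and its radical contains every
x_j. -/
theorem exists_pow_smul_mem_of_mem_span {i : ℕ} {c : (I : Finset (Fin r)) → CechLocalization N x I}
    (hc : c ∈ cechCochains x d (fun _ => (⊤ : AddSubgroup N)) i 0) (hd : cechDifferential N x c = 0)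
    {b : B} (hb : b ∈ Ideal.span (Set.range x)) :
    ∃ t : ℕ, b ^ t • c ∈ cechCoboundaries x d (fun _ => (⊤ : AddSubgroup N)) i 0 := by
  let 𝔞 : Ideal B :=
    { carrier := {b | b • c ∈ cechCoboundaries x d (fun _ => (⊤ : AddSubgroup N)) i 0}
      add_mem' := fun {a b} ha hb => by
        change (a + b) • c ∈ cechCoboundaries x d (fun _ => (⊤ : AddSubgroup N)) i 0
        rw [add_smul]
        exact add_mem ha hb
      zero_mem' := by
        change (0 : B) • c ∈ cechCoboundaries x d (fun _ => (⊤ : AddSubgroup N)) i 0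
        rw [zero_smul]
        exact zero_mem _
      smul_mem' := fun a b hb => by
        change (a * b) • c ∈ cechCoboundaries x d (fun _ => (⊤ : AddSubgroup N)) i 0
        rw [mul_smul]
        exact cechCoboundaries_top_smul a hb }
  have h1 : Ideal.span (Set.range x) ≤ 𝔞.radical := by
    rw [Ideal.span_le]
    rintro _ ⟨j, rfl⟩
    obtain ⟨t, ht⟩ := exists_pow_smul_mem_cechCoboundaries hc hd j
    exact ⟨t, ht⟩
  exact h1 hb

end Torsion

/-! ### Depth and the vanishing of Čech cohomology. -/

section Depth

open RingTheory.Sequence Pointwise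

variable {B N : Type*} [CommRing B] [AddCommGroup N] [Module B N] {r : ℕ} {x : Fin r → B}
  {d : Fin r → ℕ}

theorem isCechExact_of_isSMulRegular {b : B} (hb : IsSMulRegular N b) :
    IsCechExact x x x d (fun _ => (⊤ : AddSubgroup N)) (fun _ => (⊤ : AddSubgroup N))
      (fun _ => (⊤ : AddSubgroup (QuotSMulTop b N))) (LinearMap.lsmul B N b).toAddMonoidHom
      (Submodule.mkQ (b • (⊤ : Submodule B N))).toAddMonoidHom where
  hom₁ := .top
  hom₂ := .top
  hom₃ := .top
  map_smul_left i m := smul_comm b (x i) m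
  map_smul_right i m := map_smul (Submodule.mkQ (b • (⊤ : Submodule B N))) _ _
  injective := hb
  map_mem_left _ _ _ := AddSubgroup.mem_top _
  map_mem_right _ _ _ := AddSubgroup.mem_top _
  comp_eq_zero m := (Submodule.Quotient.mk_eq_zero _).2
    (Submodule.smul_mem_pointwise_smul m b ⊤ Submodule.mem_top)
  exists_of_eq_zero n m _ h := by
    obtain ⟨m', -, hm'⟩ := (Submodule.Quotient.mk_eq_zero _).1 h
    exact ⟨m', AddSubgroup.mem_top _, hm'⟩
  exists_preimage n m _ := by
    obtain ⟨m', hm'⟩ := Submodule.mkQ_surjective _ m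
    exact ⟨m', AddSubgroup.mem_top _, hm'⟩

theorem cechMap_lsmul (b : B) (hb : ∀ i m, (LinearMap.lsmul B N b).toAddMonoidHom (x i • m) =
    x i • (LinearMap.lsmul B N b).toAddMonoidHom m)
    (c : (I : Finset (Fin r)) → CechLocalization N x I) : cechMap _ hb c = b • c := by
  funext I
  obtain ⟨k, m, hm⟩ := exists_cechFrac (c I)
  rw [cechMap_apply, Pi.smul_apply, hm, cechLocalizationMap_cechFrac, ← map_smul]
  rfl

/-- For the first element b of the sequence, vanishing for N/bN one degree lower makes
multiplication by b injective on H^i(N). Every class is killed by a power of b, hence is zero. -/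
theorem cechVanishes_of_isWeaklyRegular (rs : List B) (hrs : ∀ b ∈ rs, b ∈ Ideal.span (Set.range x))
    (hreg : IsWeaklyRegular N rs) (i : ℕ) (hi : i < rs.length) :
    CechVanishes x d (fun _ => (⊤ : AddSubgroup N)) i 0 := by
  induction rs generalizing N i with
  | nil => exact absurd hi (Nat.not_lt_zero _)
  | cons b rs ih =>
    rw [isWeaklyRegular_cons_iff] at hreg
    have h := isCechExact_of_isSMulRegular (x := x) (d := d) hreg.1
    intro c hc hd
    obtain ⟨t, ht⟩ := exists_pow_smul_mem_of_mem_span hc hd (hrs b List.mem_cons_self)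
    induction t generalizing c with
    | zero => simpa using ht
    | succ t iht =>
      refine h.mem_coboundaries_left (fun j hj => ih (fun b' hb' => hrs b' (List.mem_cons_of_mem _ hb'))
        hreg.2 j ?_) ?_
      · rw [List.length_cons] at hi
        omega
      · rw [cechMap_lsmul]
        refine iht (b • c) ?_ ?_ ?_
        · rw [mem_cechCochains_top] at hc ⊢
          intro I hI
          rw [Pi.smul_apply, hc I hI, smul_zero]
        · rw [map_smul, hd, smul_zero]
        · rwa [← mul_smul, ← pow_succ]

/-- If every element of the ideal is a zero divisor, prime avoidance puts the ideal inside one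
associated prime; the corresponding element of N is then a nonzero class in H^0. -/
theorem exists_isSMulRegular_of_cechVanishes [IsNoetherianRing B] [Module.Finite B N]
    (h : CechVanishes x d (fun _ => (⊤ : AddSubgroup N)) 0 0) :
    ∃ b ∈ Ideal.span (Set.range x), IsSMulRegular N b := by
  by_contra hcon
  push Not at hcon
  have h1 : (Ideal.span (Set.range x) : Set B) ⊆ ⋃ p ∈ associatedPrimes B N, (p : Set B) := by
    intro b hb
    rw [biUnion_associatedPrimes_eq_zero_divisors]
    have := hcon b hb
    rw [isSMulRegular_iff_right_eq_zero_of_smul] at this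
    push Not at this
    obtain ⟨m, hm, hm0⟩ := this
    exact ⟨m, hm0, hm⟩
  obtain ⟨P, hP, hle⟩ := ((Ideal.span (Set.range x)).subset_union_prime_finite
    (associatedPrimes.finite B N) (f := id) 0 0 fun _ h _ _ => h.isPrime).1 h1
  obtain ⟨hPp, m, hm⟩ := isAssociatedPrime_iff.1 hP
  have hxm : ∀ j, x j • m = 0 := fun j => by
    have : x j ∈ P := hle (Ideal.subset_span ⟨j, rfl⟩)
    rw [hm] at this
    simpa [Submodule.mem_colon_singleton] using this
  have hm0 : m ≠ 0 := by
    rintro rfl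
    apply hPp.ne_top
    rw [hm, Ideal.eq_top_iff_one]
    simp [Submodule.mem_colon_singleton]
  -- The 0-cochain given by m. It is a cocycle because every x_j kills m, and the component at ∅ is
  -- N localized at powers of 1, so its vanishing there means m = 0.
  let c : (I : Finset (Fin r)) → CechLocalization N x I := fun I =>
    if I = ∅ then cechFrac x I 0 m else 0
  have hc : c ∈ cechCoboundaries x d (fun _ => (⊤ : AddSubgroup N)) 0 0 := by
    refine h c (mem_cechCochains_top.2 fun I hI => if_neg fun h => hI (by rw [h]; rfl)) ?_
    funext J
    rw [cechDifferential_apply]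
    refine Finset.sum_eq_zero fun j hj => ?_
    by_cases hJ : J.erase j = ∅
    · simp only [c]
      rw [if_pos hJ, cechRestrict_cechFrac]
      have : cechFrac x J 0 ((∏ i ∈ J \ J.erase j, x i) ^ 0 • m) = 0 := by
        rw [cechFrac_eq_zero_iff]
        refine ⟨1, ?_⟩
        rw [← Finset.insert_erase hj, hJ]
        simp [hxm]
      rw [this, smul_zero]
    · simp only [c]
      rw [if_neg hJ, map_zero, smul_zero]
  have hc0 : c ∅ = 0 := by
    rw [(AddSubgroup.mem_bot).1 hc]
    rfl
  simp only [c, if_true] at hc0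
  rw [cechFrac_eq_zero_iff] at hc0
  obtain ⟨t, ht⟩ := hc0
  simp at ht
  exact hm0 ht

/-- Vanishing of H^i and H^{i+1} for N gives vanishing of H^i for N/bN, so dividing by a regular
element loses exactly one cohomological degree. -/
theorem exists_isWeaklyRegular_of_cechVanishes [IsNoetherianRing B] [Module.Finite B N] (t : ℕ)
    (h : ∀ i < t, CechVanishes x d (fun _ => (⊤ : AddSubgroup N)) i 0) :
    ∃ rs : List B, (∀ b ∈ rs, b ∈ Ideal.span (Set.range x)) ∧ IsWeaklyRegular N rs ∧
      rs.length = t := by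
  induction t generalizing N with
  | zero => exact ⟨[], by simp, IsWeaklyRegular.nil B N, rfl⟩
  | succ t ih =>
    obtain ⟨b, hb, hreg⟩ := exists_isSMulRegular_of_cechVanishes (h 0 (Nat.succ_pos t))
    have hex := isCechExact_of_isSMulRegular (x := x) (d := d) hreg
    obtain ⟨rs, h1, h2, h3⟩ := ih (N := QuotSMulTop b N) fun i hi =>
      hex.vanishes_right (h i (Nat.lt_succ_of_lt hi)) (h (i + 1) (Nat.succ_lt_succ hi))
    exact ⟨b :: rs, by simpa using ⟨hb, h1⟩, (isWeaklyRegular_cons_iff _ _ _).2 ⟨hreg, h2⟩,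
      by simp [h3]⟩

/-- The depth with respect to `(x₁, …, x_r)` is determined by the vanishing of the Čech cohomology. -/
theorem idealDepth_span_range [IsNoetherianRing B] [Module.Finite B N] :
    idealDepth (Ideal.span (Set.range x)) N =
      ⨆ (t : ℕ) (_ : ∀ i < t, CechVanishes x d (fun _ => (⊤ : AddSubgroup N)) i 0), (t : ℕ∞) := by
  apply le_antisymm
  · refine iSup_le fun rs => iSup_le fun hrs => iSup_le fun hreg => ?_
    exact le_iSup₂_of_le rs.length
      (fun i hi => cechVanishes_of_isWeaklyRegular rs hrs hreg i hi) le_rfl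
  · refine iSup_le fun t => iSup_le fun ht => ?_
    obtain ⟨rs, h1, h2, rfl⟩ := exists_isWeaklyRegular_of_cechVanishes t ht
    exact le_iSup_of_le rs (le_iSup₂_of_le h1 h2 le_rfl)

end Depth

/-! ### Graded modules over a weighted polynomial ring. -/

section GradedPolynomialModules

/-- A grading of a module over a polynomial ring with weights `d`, given together with the
projections onto its components. -/
structure IsPolyGrading {A Y : Type*} [CommRing A] {r : ℕ} [AddCommGroup Y] [Module A Y]
    [Module (MvPolynomial (Fin r) A) Y] (d : Fin r → ℕ) (𝒴 : ℤ → Submodule A Y)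
    (p : ℤ → Y →ₗ[A] Y) : Prop where
  proj : IsGradingProjection (fun n => (𝒴 n).toAddSubgroup) (fun n => (p n).toAddMonoidHom)
  hom : IsHomogeneousAction (MvPolynomial.X : Fin r → MvPolynomial (Fin r) A) d
    (fun n => (𝒴 n).toAddSubgroup)

variable {A : Type*} [CommRing A] {r : ℕ} (d : Fin r → ℕ)

variable (A) in
/-- The component of degree `n` of the polynomial ring with weights `d`. -/
noncomputable abbrev polyComponent (n : ℤ) : Submodule A (MvPolynomial (Fin r) A) :=
  MvPolynomial.weightedHomogeneousSubmodule A (fun i => (d i : ℤ)) n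

variable (A) in
/-- The component of degree `n` of the graded free module whose `j`-th basis vector has
degree `e j`. -/
noncomputable def polyFreeComponent {b : ℕ} (e : Fin b → ℤ) (n : ℤ) :
    Submodule A (Fin b → MvPolynomial (Fin r) A) :=
  Submodule.pi Set.univ fun j => polyComponent A d (n - e j)

variable (A) in
/-- The projection of the graded free module onto its component of degree `n`. -/
noncomputable def polyFreeProjection {b : ℕ} (e : Fin b → ℤ) (n : ℤ) :
    (Fin b → MvPolynomial (Fin r) A) →ₗ[A] (Fin b → MvPolynomial (Fin r) A) :=
  LinearMap.pi fun j => MvPolynomial.weightedHomogeneousComponent (fun i => (d i : ℤ)) (n - e j) ∘ₗ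
    LinearMap.proj j

theorem mem_polyFreeComponent {b : ℕ} {e : Fin b → ℤ} {n : ℤ} {v : Fin b → MvPolynomial (Fin r) A} :
    v ∈ polyFreeComponent A d e n ↔ ∀ j, v j ∈ polyComponent A d (n - e j) := by
  simp [polyFreeComponent, Submodule.mem_pi]

theorem X_mul_mem_polyComponent {n : ℤ} (i : Fin r) {p : MvPolynomial (Fin r) A}
    (hp : p ∈ polyComponent A d n) : MvPolynomial.X i * p ∈ polyComponent A d (n + d i) := by
  rw [add_comm]
  exact MvPolynomial.IsWeightedHomogeneous.mul (MvPolynomial.isWeightedHomogeneous_X A _ i) hp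

theorem isPolyGrading_free {b : ℕ} (e : Fin b → ℤ) :
    IsPolyGrading d (polyFreeComponent A d e) (polyFreeProjection A d e) where
  proj :=
    { mem := fun n m => (mem_polyFreeComponent d).2 fun j =>
        MvPolynomial.weightedHomogeneousComponent_mem _ _ _
      eq_self := fun n m hm => by
        funext j
        have h := (mem_polyFreeComponent d).1 hm j
        exact MvPolynomial.weightedHomogeneousComponent_eq_self h
      eq_zero := fun n n' hn m hm => by
        funext j
        have h := (mem_polyFreeComponent d).1 hm j
        exact MvPolynomial.IsWeightedHomogeneous.weightedHomogeneousComponent_ne (w := fun i => (d i : ℤ))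
          _ h (by omega)
      exists_sum := fun m => by
        refine ⟨Finset.univ.biUnion fun j => (m j).support.image fun α =>
          Finsupp.weight (fun i => (d i : ℤ)) α + e j, ?_⟩
        funext j
        rw [Finset.sum_apply]
        ext α
        rw [MvPolynomial.coeff_sum]
        simp only [polyFreeProjection, LinearMap.toAddMonoidHom_coe, LinearMap.pi_apply,
          LinearMap.comp_apply, LinearMap.proj_apply, MvPolynomial.coeff_weightedHomogeneousComponent]
        rw [Finset.sum_eq_single (Finsupp.weight (fun i => (d i : ℤ)) α + e j)]
        · rw [if_pos (by ring)]
        · intro n _ hn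
          rw [if_neg (by omega)]
        · intro hn
          rw [if_pos (by ring)]
          by_contra h
          exact hn (Finset.mem_biUnion.2 ⟨j, Finset.mem_univ _, Finset.mem_image.2
            ⟨α, MvPolynomial.mem_support_iff.2 h, rfl⟩⟩) }
  hom := fun i n m hm => (mem_polyFreeComponent d).2 fun j => by
    have h := (mem_polyFreeComponent d).1 hm j
    have h2 := X_mul_mem_polyComponent d i h
    rwa [sub_add_eq_add_sub] at h2

end GradedPolynomialModules

theorem finite_weight_eq {r : ℕ} {d : Fin r → ℕ} (hd : ∀ i, 0 < d i) (n : ℤ) :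
    {α : Fin r →₀ ℕ | Finsupp.weight (fun i => (d i : ℤ)) α = n}.Finite := by
  refine (Finsupp.finite_of_nat_weight_le d (fun i => (hd i).ne') n.toNat).subset fun α hα => ?_
  have h1 : ((Finsupp.weight d α : ℕ) : ℤ) = Finsupp.weight (fun i => (d i : ℤ)) α := by
    simp [Finsupp.weight_apply, Finsupp.sum]
  have h2 : Finsupp.weight (fun i => (d i : ℤ)) α = n := hα
  change Finsupp.weight d α ≤ n.toNat
  omega

theorem polyComponent_eq_span {A : Type*} [CommRing A] {r : ℕ} {d : Fin r → ℕ} (n : ℤ) :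
    polyComponent A d n = Submodule.span A ((fun α => MvPolynomial.monomial α (1 : A)) ''
      {α | Finsupp.weight (fun i => (d i : ℤ)) α = n}) := by
  apply le_antisymm
  · intro p hp
    rw [← MvPolynomial.support_sum_monomial_coeff p]
    refine sum_mem fun α hα => ?_
    rw [← mul_one (MvPolynomial.coeff α p), ← smul_eq_mul, ← MvPolynomial.smul_monomial]
    exact Submodule.smul_mem _ _ (Submodule.subset_span
      ⟨α, hp (MvPolynomial.mem_support_iff.1 hα), rfl⟩)
  · rw [Submodule.span_le]
    rintro _ ⟨α, hα, rfl⟩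
    exact MvPolynomial.isWeightedHomogeneous_monomial _ _ _ hα

theorem IsHomogeneousAction.monomial_smul_mem {A : Type*} [CommRing A] {r : ℕ} {d : Fin r → ℕ}
    {Y : Type*} [AddCommGroup Y] [Module A Y] [Module (MvPolynomial (Fin r) A) Y]
    [IsScalarTower A (MvPolynomial (Fin r) A) Y] {𝒴 : ℤ → Submodule A Y}
    (h : IsHomogeneousAction (MvPolynomial.X : Fin r → MvPolynomial (Fin r) A) d
      (fun n => (𝒴 n).toAddSubgroup)) (α : Fin r →₀ ℕ) (c : A) {n : ℤ}
    {y : Y} (hy : y ∈ 𝒴 n) :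
    MvPolynomial.monomial α c • y ∈ 𝒴 (n + Finsupp.weight (fun i => (d i : ℤ)) α) := by
  have key : ∀ (s : Finset (Fin r)) (e : Fin r → ℕ) (a : ℤ) (m : Y), m ∈ 𝒴 a →
      (∏ i ∈ s, (MvPolynomial.X i : MvPolynomial (Fin r) A) ^ e i) • m ∈
        𝒴 (a + ∑ i ∈ s, (e i : ℤ) * d i) := by
    intro s e
    induction s using Finset.induction_on with
    | empty => simp
    | insert i s hi ih =>
      intro a m hm
      have h1 := ih _ _ hm
      have h2 := h.prod_pow_smul {i} (e i) h1
      rw [Finset.prod_insert hi, Finset.sum_insert hi, mul_smul]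
      simp only [Finset.prod_singleton, Finset.sum_singleton] at h2
      have h3 : a + ((e i : ℤ) * d i + ∑ x ∈ s, (e x : ℤ) * d x) =
        a + ∑ x ∈ s, (e x : ℤ) * d x + (e i : ℤ) * d i := by ring
      rw [h3]
      exact h2
  have h1 : MvPolynomial.monomial α c = c • ∏ i ∈ α.support, (MvPolynomial.X i : MvPolynomial (Fin r) A) ^ α i := by
    rw [MvPolynomial.prod_X_pow_eq_monomial, MvPolynomial.smul_monomial, smul_eq_mul, mul_one]
  rw [h1, smul_assoc]
  have h2 := Submodule.smul_mem _ c (key α.support α n y hy)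
  rw [Finsupp.weight_apply]
  simpa [Finsupp.sum] using h2

/-! ### Vanishing of the cohomology of free modules below the top degree. -/

section FreeVanishing

variable {A : Type*} [CommRing A] {r : ℕ} {d : Fin r → ℕ}

open RingTheory.Sequence in
-- Membership in an ideal generated by variables is a condition on each monomial of the support, and
-- multiplying by a different variable does not affect it.
theorem MvPolynomial.isWeaklyRegular_X :
    IsWeaklyRegular (MvPolynomial (Fin r) A) (List.ofFn (MvPolynomial.X : Fin r → MvPolynomial (Fin r) A)) := by
  rw [isWeaklyRegular_iff]
  intro i hi
  rw [List.length_ofFn] at hi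
  have h1 : Ideal.ofList (List.take i (List.ofFn (MvPolynomial.X : Fin r → MvPolynomial (Fin r) A))) =
      Ideal.span (MvPolynomial.X '' {j : Fin r | (j : ℕ) < i}) := by
    rw [Ideal.ofList]
    congr 1
    ext p
    simp only [Set.mem_ofPred_eq, Set.mem_image, List.mem_take_iff_getElem, List.length_ofFn,
      List.getElem_ofFn]
    constructor
    · rintro ⟨j, hj, rfl⟩
      exact ⟨⟨j, by omega⟩, by simp; omega, rfl⟩
    · rintro ⟨j, hj, rfl⟩
      exact ⟨j, by omega, rfl⟩
  rw [isSMulRegular_iff_right_eq_zero_of_smul]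
  intro p hp
  obtain ⟨p, rfl⟩ := Submodule.mkQ_surjective _ p
  rw [← map_smul] at hp
  have hp' := (Submodule.Quotient.mk_eq_zero _).1 hp
  refine (Submodule.Quotient.mk_eq_zero _).2 ?_
  rw [smul_eq_mul, Ideal.mul_top, h1, MvPolynomial.mem_ideal_span_X_image] at hp' ⊢
  intro m hm
  rw [List.getElem_ofFn, smul_eq_mul] at hp'
  obtain ⟨j, hj, hj'⟩ := hp' (m + Finsupp.single ⟨i, hi⟩ 1) (by
    rw [MvPolynomial.mem_support_iff, add_comm, MvPolynomial.coeff_X_mul]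
    exact MvPolynomial.mem_support_iff.1 hm)
  refine ⟨j, hj, ?_⟩
  have hne : (⟨i, hi⟩ : Fin r) ≠ j := fun h => by
    rw [← h] at hj
    exact lt_irrefl i hj
  simpa [Finsupp.single_apply, hne] using hj'

theorem cechVanishes_mvPolynomial {i : ℕ} (hi : i < r) :
    CechVanishes (MvPolynomial.X : Fin r → MvPolynomial (Fin r) A) d
      (fun _ => (⊤ : AddSubgroup (MvPolynomial (Fin r) A))) i 0 := by
  refine cechVanishes_of_isWeaklyRegular (List.ofFn MvPolynomial.X) (fun b hb => ?_)
    MvPolynomial.isWeaklyRegular_X i (by rwa [List.length_ofFn])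
  obtain ⟨j, rfl⟩ := (List.mem_ofFn' _ _).1 hb
  exact Ideal.subset_span ⟨j, rfl⟩

/-- A cocycle with values in N^b is the sum of its coordinates, each pushed back along a coordinate
inclusion. -/
theorem CechVanishes.pi {B N : Type*} [CommRing B] [AddCommGroup N] [Module B N] {x : Fin r → B}
    {i : ℕ} (h : CechVanishes x d (fun _ => (⊤ : AddSubgroup N)) i 0) (b : ℕ) :
    CechVanishes x d (fun _ => (⊤ : AddSubgroup (Fin b → N))) i 0 := by
  intro c hc hd
  let pr : Fin b → (Fin b → N) →+ N := fun j => Pi.evalAddMonoidHom _ j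
  let inj : Fin b → N →+ (Fin b → N) := fun j => AddMonoidHom.single (fun _ => N) j
  have hpr : ∀ j l m, pr j (x l • m) = x l • pr j m := fun j l m => rfl
  have hinj : ∀ j l m, inj j (x l • m) = x l • inj j m := fun j l m => by
    funext l'
    by_cases h : l' = j
    · subst h; simp [inj]
    · simp [inj, h]
  have h1 : c = ∑ j, cechMap (inj j) (hinj j) (cechMap (pr j) (hpr j) c) := by
    funext I
    rw [Finset.sum_apply]
    obtain ⟨k, m, hm⟩ := exists_cechFrac (c I)
    simp only [cechMap_apply, hm, cechLocalizationMap_cechFrac]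
    rw [← map_sum]
    congr 1
    exact (Finset.univ_sum_single m).symm
  rw [h1]
  refine sum_mem fun j _ => ?_
  obtain ⟨e, he, hde⟩ := mem_cechCoboundaries.1 (h (cechMap (pr j) (hpr j) c)
    (cechMap_mem .top _ (fun _ _ _ => AddSubgroup.mem_top _) hc) (by
      rw [cechDifferential_cechMap, hd, map_zero]))
  refine mem_cechCoboundaries.2 ⟨cechMap (inj j) (hinj j) e, ?_, by
    rw [cechDifferential_cechMap, hde]⟩
  cases i with
  | zero => rw [(AddSubgroup.mem_bot).1 he, map_zero]; exact zero_mem _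
  | succ i => exact cechMap_mem .top _ (fun _ _ _ => AddSubgroup.mem_top _) he

theorem cechVanishes_polyFree {b : ℕ} (e : Fin b → ℤ) {i : ℕ} (hi : i < r) (n : ℤ) :
    CechVanishes (MvPolynomial.X : Fin r → MvPolynomial (Fin r) A) d
      (fun n => (polyFreeComponent A d e n).toAddSubgroup) i n :=
  (cechVanishes_top_iff (isPolyGrading_free d e).proj (isPolyGrading_free d e).hom i).1
    ((cechVanishes_mvPolynomial hi).pi b) n

end FreeVanishing

/-! ### The residue on the localization of the polynomial ring at the product of the variables. -/

section Residue

variable {k : Type*} [CommRing k] {r : ℕ}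

theorem MvPolynomial.prod_X_pow_eq_monomial_const (t : ℕ) :
    (∏ i : Fin r, (X i : MvPolynomial (Fin r) k)) ^ t =
      monomial (Finsupp.equivFunOnFinite.symm fun _ => t) 1 := by
  rw [← Finset.prod_pow, ← MvPolynomial.prod_X_pow_eq_monomial]
  symm
  refine Finset.prod_subset (Finset.subset_univ _) fun i _ hi => ?_
  rw [Finsupp.notMem_support_iff.1 hi, pow_zero]

variable (k r) in
theorem exists_residue : ∃ φ : CechLocalization (MvPolynomial (Fin r) k)
      (MvPolynomial.X : Fin r → MvPolynomial (Fin r) k) Finset.univ →ₗ[k] k,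
    ∀ t p, φ (cechFrac _ _ t p) = MvPolynomial.coeff (Finsupp.equivFunOnFinite.symm fun _ => t)
      ((∏ i, MvPolynomial.X i) * p) := by
  let x : Fin r → MvPolynomial (Fin r) k := MvPolynomial.X
  let U : Finset (Fin r) := Finset.univ
  let κ : ℕ → Fin r →₀ ℕ := fun t => Finsupp.equivFunOnFinite.symm fun _ => t
  have hκ : ∀ s t, κ (s + t) = κ s + κ t := fun s t => by ext; rfl
  have hX : ∀ t, (∏ i ∈ U, x i) ^ t = MvPolynomial.monomial (κ t) 1 := fun t =>
    MvPolynomial.prod_X_pow_eq_monomial_const t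
  -- The residue of p / (∏ X)^t is the coefficient of p at (t-1, …, t-1). Multiplying by ∏ X first
  -- avoids the subtraction, and the value is unchanged when the fraction is expanded.
  have hmul : ∀ s t (p : MvPolynomial (Fin r) k), MvPolynomial.coeff (κ (t + s))
      ((∏ i ∈ U, x i) * ((∏ i ∈ U, x i) ^ s • p)) = MvPolynomial.coeff (κ t) ((∏ i ∈ U, x i) * p) := by
    intro s t p
    rw [smul_eq_mul, mul_left_comm, hX s, add_comm, hκ, MvPolynomial.coeff_monomial_mul, one_mul]
  choose e m h using fun y : CechLocalization (MvPolynomial (Fin r) k) x U => exists_cechFrac y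
  let φ := fun y => MvPolynomial.coeff (κ (e y)) ((∏ i ∈ U, x i) * m y)
  have key : ∀ t p, φ (cechFrac x U t p) = MvPolynomial.coeff (κ t) ((∏ i ∈ U, x i) * p) := by
    intro t p
    obtain ⟨u, hu⟩ := cechFrac_eq_iff.1 (h (cechFrac x U t p))
    simp only [φ]
    rw [← hmul (u + t), ← hu, ← hmul (u + e (cechFrac x U t p)) t]
    congr 2
    ring
  refine ⟨{ toFun := φ, map_add' := fun y z => ?_, map_smul' := fun c y => ?_ }, key⟩
  · have h1 : y + z = cechFrac x U (e y + e z)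
        ((∏ i ∈ U, x i) ^ e z • m y + (∏ i ∈ U, x i) ^ e y • m z) := by
      rw [map_add, cechFrac_add, add_comm (e y), cechFrac_add, ← h, ← h]
    rw [h1, key, mul_add, MvPolynomial.coeff_add, hmul, add_comm (e y), hmul]
  · have h1 : c • y = cechFrac x U (e y) (c • m y) := by
      conv_lhs => rw [h y]
      rw [LinearMap.map_smul_of_tower]
    rw [h1, key, mul_smul_comm, MvPolynomial.coeff_smul]
    rfl

variable (k r) in
/-- The residue: the coefficient of `(X₀ ⋯ X_{r-1})⁻¹`. -/
noncomputable def residue : CechLocalization (MvPolynomial (Fin r) k)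
      (MvPolynomial.X : Fin r → MvPolynomial (Fin r) k) Finset.univ →ₗ[k] k :=
  (exists_residue k r).choose

theorem residue_cechFrac (t : ℕ) (p : MvPolynomial (Fin r) k) :
    residue k r (cechFrac _ _ t p) = MvPolynomial.coeff (Finsupp.equivFunOnFinite.symm fun _ => t)
      ((∏ i, MvPolynomial.X i) * p) :=
  (exists_residue k r).choose_spec t p

end Residue

/-! ### Explicit graded local duality for the top cohomology. -/

section Duality

variable {k : Type*} [CommRing k] {r : ℕ} (d : Fin r → ℕ)
  {N : Type*} [AddCommGroup N] [Module k N] [Module (MvPolynomial (Fin r) k) N]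
  [IsScalarTower k (MvPolynomial (Fin r) k) N] (𝒩 : ℤ → Submodule k N)

/-- The homomorphisms of degree `m` from a graded module to the polynomial ring. -/
def gradedDual (m : ℤ) : Submodule k (N →ₗ[MvPolynomial (Fin r) k] MvPolynomial (Fin r) k) where
  carrier := {f | ∀ a, ∀ y ∈ 𝒩 a, f y ∈ polyComponent k d (a + m)}
  add_mem' hf hg a y hy := add_mem (hf a y hy) (hg a y hy)
  zero_mem' _ _ _ := zero_mem _
  smul_mem' c _ hf a y hy := Submodule.smul_mem _ c (hf a y hy)

variable {N₁ : Type*} [AddCommGroup N₁] [Module k N₁] [Module (MvPolynomial (Fin r) k) N₁]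
  [IsScalarTower k (MvPolynomial (Fin r) k) N₁]

/-- The map of localizations at the product of the variables induced by a linear map. -/
noncomputable def localizationMapPoly (f : N →ₗ[MvPolynomial (Fin r) k] N₁) :
    CechLocalization N (MvPolynomial.X : Fin r → MvPolynomial (Fin r) k) Finset.univ →ₗ[k]
      CechLocalization N₁ (MvPolynomial.X : Fin r → MvPolynomial (Fin r) k) Finset.univ :=
  { cechLocalizationMap f.toAddMonoidHom (fun i m => f.map_smul _ m) Finset.univ with
    map_smul' := fun c y => by
      obtain ⟨t, m, rfl⟩ := exists_cechFrac y
      have h1 : c • cechFrac (MvPolynomial.X : Fin r → MvPolynomial (Fin r) k) Finset.univ t m =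
        cechFrac _ _ t (c • m) := (LinearMap.map_smul_of_tower _ c m).symm
      change cechLocalizationMap _ _ _ (c • _) = c • cechLocalizationMap _ _ _ _
      rw [h1]
      refine (cechLocalizationMap_cechFrac _ _ _ _ _).trans ?_
      refine Eq.trans ?_ (congrArg (c • ·) (cechLocalizationMap_cechFrac _ _ _ _ _).symm)
      refine Eq.trans ?_ (LinearMap.map_smul_of_tower _ c _)
      exact congrArg _ (f.map_smul_of_tower c m) }

theorem localizationMapPoly_cechFrac (f : N →ₗ[MvPolynomial (Fin r) k] N₁) (t : ℕ) (m : N) :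
    localizationMapPoly f (cechFrac _ _ t m) = cechFrac _ _ t (f m) :=
  cechLocalizationMap_cechFrac _ _ _ _ _

/-- The pairing of local cohomology classes with homomorphisms to the polynomial ring. -/
noncomputable def residuePairing (f : N →ₗ[MvPolynomial (Fin r) k] MvPolynomial (Fin r) k) :
    CechLocalization N (MvPolynomial.X : Fin r → MvPolynomial (Fin r) k) Finset.univ →ₗ[k] k :=
  residue k r ∘ₗ localizationMapPoly f

theorem residuePairing_cechFrac (f : N →ₗ[MvPolynomial (Fin r) k] MvPolynomial (Fin r) k) (t : ℕ)
    (m : N) : residuePairing f (cechFrac _ _ t m) =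
      MvPolynomial.coeff (Finsupp.equivFunOnFinite.symm fun _ => t)
        ((∏ i, MvPolynomial.X i) * f m) := by
  rw [residuePairing, LinearMap.comp_apply, localizationMapPoly_cechFrac, residue_cechFrac]

/-- The functionals on the localization of `N` at the product of the variables that vanish on
coboundaries and outside of degree `n`. -/
structure IsTopFunctional (n : ℤ) (l : CechLocalization N
    (MvPolynomial.X : Fin r → MvPolynomial (Fin r) k) Finset.univ →ₗ[k] k) : Prop where
  restrict : ∀ j y, l (cechRestrict N MvPolynomial.X (Finset.erase_subset j Finset.univ) y) = 0
  degree : ∀ n', n' ≠ n → ∀ y ∈ localizationComponent MvPolynomial.X d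
    (fun n => (𝒩 n).toAddSubgroup) Finset.univ n', l y = 0

omit [Module k N] [IsScalarTower k (MvPolynomial (Fin r) k) N] in
theorem cechRestrict_erase_cechFrac (j : Fin r) (t : ℕ) (m : N) :
    cechRestrict N (MvPolynomial.X : Fin r → MvPolynomial (Fin r) k)
      (Finset.erase_subset j Finset.univ) (cechFrac _ _ t m) =
      cechFrac _ _ t ((MvPolynomial.X j : MvPolynomial (Fin r) k) ^ t • m) := by
  rw [cechRestrict_cechFrac]
  congr 4
  rw [Finset.sdiff_erase (Finset.mem_univ j)]
  simp

variable {d 𝒩}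

theorem weight_const (t : ℕ) : Finsupp.weight (fun i => (d i : ℤ))
    (Finsupp.equivFunOnFinite.symm fun _ : Fin r => t) = t * ∑ i, (d i : ℤ) := by
  rw [Finsupp.weight_apply, Finsupp.sum_fintype _ _ (by simp), Finset.mul_sum]
  simp

/-- A fraction whose denominator omits some x_j has no (∏ X)⁻¹ term, so coboundaries pair to zero.
As (∏ X)⁻¹ has degree -∑ d_i, a homomorphism of degree m detects only the degree -m - ∑ d_i. -/
theorem isTopFunctional_residuePairing
    (h𝒩 : IsHomogeneousAction (MvPolynomial.X : Fin r → MvPolynomial (Fin r) k) d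
      (fun n => (𝒩 n).toAddSubgroup)) {m : ℤ}
    {f : N →ₗ[MvPolynomial (Fin r) k] MvPolynomial (Fin r) k} (hf : f ∈ gradedDual d 𝒩 m) :
    IsTopFunctional d 𝒩 (-m - ∑ i, (d i : ℤ)) (residuePairing f) where
  restrict j y := by
    obtain ⟨t, m, rfl⟩ := exists_cechFrac y
    rw [cechRestrict_erase_cechFrac, residuePairing_cechFrac, map_smul, smul_eq_mul,
      ← Finset.mul_prod_erase _ _ (Finset.mem_univ j)]
    have h1 : (MvPolynomial.X j * ∏ i ∈ Finset.univ.erase j, MvPolynomial.X i) *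
        (MvPolynomial.X j ^ t * f m) = MvPolynomial.monomial (Finsupp.single j (t + 1)) 1 *
          ((∏ i ∈ Finset.univ.erase j, MvPolynomial.X i) * f m) := by
      rw [← MvPolynomial.X_pow_eq_monomial]
      ring
    rw [h1, MvPolynomial.coeff_monomial_mul', if_neg]
    intro h
    have := h j
    simp at this
  degree n' hn y hy := by
    obtain ⟨t, z, hz, rfl⟩ := (mem_localizationComponent h𝒩).1 hy
    rw [residuePairing_cechFrac]
    have h1 := hf _ z hz
    have h2 := (isPolyGrading_free (A := k) d (fun _ : Fin 1 => (0 : ℤ))).hom.prod_pow_smul Finset.univ 1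
      (n := n' + t * ∑ i, (d i : ℤ) + m) (m := fun _ => f z) ((mem_polyFreeComponent d).2 fun j => by
        simpa using h1)
    have h3 := (mem_polyFreeComponent d).1 h2 0
    rw [pow_one, Pi.smul_apply, smul_eq_mul] at h3
    by_contra h4
    have h5 := h3 h4
    rw [weight_const] at h5
    apply hn
    push_cast at h5
    linarith

/-- A basic fraction whose residue against `f` is the coefficient of `f m` at `α`. -/
noncomputable def coeffFrac (α : Fin r →₀ ℕ) (m : N) :
    CechLocalization N (MvPolynomial.X : Fin r → MvPolynomial (Fin r) k) Finset.univ :=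
  -- This is X^{-α - (1, …, 1)} m. The total degree of α bounds each `α i`, so the truncated
  -- subtraction is exact.
  cechFrac _ _ (α.degree + 1) ((MvPolynomial.monomial
    (Finsupp.equivFunOnFinite.symm fun i => α.degree - α i) (1 : k)) • m)

omit [Module k N] [IsScalarTower k (MvPolynomial (Fin r) k) N] in
theorem coeffFrac_eq (α : Fin r →₀ ℕ) (m : N) (t : ℕ) (β : Fin r →₀ ℕ) (h : ∀ i, α i + β i = t) :
    coeffFrac (k := k) α m = cechFrac _ _ (t + 1) ((MvPolynomial.monomial β (1 : k)) • m) := by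
  refine cechFrac_eq_iff.2 ⟨0, ?_⟩
  rw [MvPolynomial.prod_X_pow_eq_monomial_const, MvPolynomial.prod_X_pow_eq_monomial_const,
    ← mul_smul, ← mul_smul, MvPolynomial.monomial_mul, MvPolynomial.monomial_mul]
  refine congrArg (fun γ => MvPolynomial.monomial γ (1 * 1 : k) • m) ?_
  ext i
  have h1 := Finsupp.le_degree i α
  have h2 := h i
  simp
  omega

theorem residuePairing_coeffFrac (f : N →ₗ[MvPolynomial (Fin r) k] MvPolynomial (Fin r) k)
    (α : Fin r →₀ ℕ) (m : N) : residuePairing f (coeffFrac α m) = MvPolynomial.coeff α (f m) := by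
  rw [coeffFrac, residuePairing_cechFrac, map_smul, smul_eq_mul, ← pow_one (∏ i, _),
    MvPolynomial.prod_X_pow_eq_monomial_const, ← mul_assoc, MvPolynomial.monomial_mul, one_mul]
  have h1 : (Finsupp.equivFunOnFinite.symm fun _ : Fin r => α.degree + 1) =
      ((Finsupp.equivFunOnFinite.symm fun _ : Fin r => 1) +
        Finsupp.equivFunOnFinite.symm fun i => α.degree - α i) + α := by
    ext i
    have h1 := Finsupp.le_degree i α
    simp
    omega
  rw [h1, MvPolynomial.coeff_monomial_mul, one_mul]

theorem residuePairing_injective : Function.Injective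
    (residuePairing (N := N) (k := k) (r := r)) := by
  intro f g h
  ext m α
  rw [← residuePairing_coeffFrac, ← residuePairing_coeffFrac, h]

omit [Module k N] [IsScalarTower k (MvPolynomial (Fin r) k) N] in
theorem coeffFrac_X_smul (α : Fin r →₀ ℕ) (i : Fin r) (m : N) :
    coeffFrac (k := k) (α + Finsupp.single i 1) ((MvPolynomial.X i : MvPolynomial (Fin r) k) • m) =
      coeffFrac α m := by
  rw [coeffFrac, ← mul_smul, MvPolynomial.X, MvPolynomial.monomial_mul, one_mul]
  symm
  refine coeffFrac_eq _ _ _ _ fun j => ?_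
  have h1 := Finsupp.le_degree j (α + Finsupp.single i 1)
  simp only [Finsupp.add_apply, Finsupp.equivFunOnFinite_symm_apply_apply] at h1 ⊢
  omega

/-- When `α i = 0` the denominator contains x_i only to the first power. The extra factor x_i
cancels it, so the fraction comes from the localization at the remaining variables. -/
theorem IsTopFunctional.coeffFrac_X_smul_eq_zero {n : ℤ} {l : CechLocalization N
    (MvPolynomial.X : Fin r → MvPolynomial (Fin r) k) Finset.univ →ₗ[k] k}
    (hl : IsTopFunctional d 𝒩 n l) {α : Fin r →₀ ℕ} {i : Fin r} (hα : α i = 0) (m : N) :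
    l (coeffFrac α ((MvPolynomial.X i : MvPolynomial (Fin r) k) • m)) = 0 := by
  have h1 : ∃ β : Fin r →₀ ℕ, (MvPolynomial.monomial
      (Finsupp.equivFunOnFinite.symm fun i => α.degree - α i) (1 : k)) * MvPolynomial.X i =
      MvPolynomial.X i ^ (α.degree + 1) * MvPolynomial.monomial β 1 := by
    refine ⟨(Finsupp.equivFunOnFinite.symm fun i => α.degree - α i) - Finsupp.single i α.degree, ?_⟩
    rw [MvPolynomial.X_pow_eq_monomial, MvPolynomial.X, MvPolynomial.monomial_mul,
      MvPolynomial.monomial_mul]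
    refine congrArg (fun γ => MvPolynomial.monomial γ (1 * 1 : k)) ?_
    ext j
    by_cases hj : j = i
    · subst hj
      simp [hα]
    · simp [Ne.symm hj]
  obtain ⟨β, hβ⟩ := h1
  rw [coeffFrac, ← mul_smul, hβ, mul_smul, ← cechRestrict_erase_cechFrac]
  exact hl.restrict _ _

theorem coeffFrac_mem (h𝒩 : IsHomogeneousAction (MvPolynomial.X : Fin r → MvPolynomial (Fin r) k) d
      (fun n => (𝒩 n).toAddSubgroup)) {a : ℤ} {m : N} (hm : m ∈ 𝒩 a) (α : Fin r →₀ ℕ) :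
    coeffFrac (k := k) α m ∈ localizationComponent MvPolynomial.X d (fun n => (𝒩 n).toAddSubgroup)
      Finset.univ (a - Finsupp.weight (fun i => (d i : ℤ)) α - ∑ i, (d i : ℤ)) := by
  refine (mem_localizationComponent h𝒩).2 ⟨_, _, ?_, rfl⟩
  have h1 := h𝒩.monomial_smul_mem (Finsupp.equivFunOnFinite.symm fun i => α.degree - α i) 1 hm
  have h2 : a - Finsupp.weight (fun i => (d i : ℤ)) α - ∑ i, (d i : ℤ) +
      (α.degree + 1 : ℕ) * ∑ i, (d i : ℤ) = a + Finsupp.weight (fun i => (d i : ℤ))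
        (Finsupp.equivFunOnFinite.symm fun i => α.degree - α i) := ?_
  · rw [h2]
    exact h1
  rw [Finsupp.weight_apply, Finsupp.weight_apply, Finsupp.sum_fintype _ _ (by simp),
    Finsupp.sum_fintype _ _ (by simp)]
  have h3 : ∀ i, ((α.degree - α i : ℕ) : ℤ) = α.degree - α i := fun i =>
    Nat.cast_sub (Finsupp.le_degree i α)
  simp only [Finsupp.equivFunOnFinite_symm_apply_apply, nsmul_eq_mul, h3, sub_mul,
    Finset.sum_sub_distrib, ← Finset.mul_sum]
  push_cast
  ring

end Duality

theorem IsGradingProjection.map_apply {N N' : Type*} [AddCommGroup N] [AddCommGroup N']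
    {𝒩 : ℤ → AddSubgroup N} {𝒩' : ℤ → AddSubgroup N'} {p : ℤ → N →+ N} {p' : ℤ → N' →+ N'}
    (h : IsGradingProjection 𝒩 p) (h' : IsGradingProjection 𝒩' p') (f : N →+ N')
    (hf : ∀ n, ∀ y ∈ 𝒩 n, f y ∈ 𝒩' n) (n : ℤ) (y : N) : f (p n y) = p' n (f y) := by
  have key : ∀ n' y, y ∈ 𝒩 n' → f (p n y) = p' n (f y) := by
    intro n' y hy
    by_cases hn : n = n'
    · subst hn
      rw [h.eq_self n y hy, h'.eq_self n _ (hf n y hy)]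
    · rw [h.eq_zero n n' hn y hy, h'.eq_zero n n' hn _ (hf n' y hy), map_zero]
  obtain ⟨F, hF⟩ := h.exists_sum y
  rw [← hF]
  simp only [map_sum]
  exact Finset.sum_congr rfl fun n' _ => key n' _ (h.mem n' y)

theorem IsGradingProjection.sum_eq_of_subset {N : Type*} [AddCommGroup N] {𝒩 : ℤ → AddSubgroup N}
    {p : ℤ → N →+ N} (h : IsGradingProjection 𝒩 p) {F F' : Finset ℤ} (hF : F ⊆ F') {y : N}
    (hy : ∑ n ∈ F, p n y = y) : ∑ n ∈ F', p n y = y := by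
  rw [← hy, ← Finset.sum_subset hF fun n _ hn => ?_, hy, hy]
  rw [map_sum]
  refine Finset.sum_eq_zero fun n' hn' => h.eq_zero n n' (fun h' => hn (h' ▸ hn')) _ (h.mem n' y)

section Duality

variable {k : Type*} [CommRing k] {r : ℕ} {d : Fin r → ℕ}
  {N : Type*} [AddCommGroup N] [Module k N] [Module (MvPolynomial (Fin r) k) N]
  [IsScalarTower k (MvPolynomial (Fin r) k) N] {𝒩 : ℤ → Submodule k N} {p : ℤ → N →ₗ[k] N}

omit [Module k N] [IsScalarTower k (MvPolynomial (Fin r) k) N] in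
theorem coeffFrac_add (α : Fin r →₀ ℕ) (m m' : N) :
    coeffFrac (k := k) α (m + m') = coeffFrac α m + coeffFrac α m' := by
  rw [coeffFrac, smul_add, map_add]
  rfl

omit [Module k N] [IsScalarTower k (MvPolynomial (Fin r) k) N] in
theorem coeffFrac_sum {ι : Type*} (F : Finset ι) (α : Fin r →₀ ℕ) (m : ι → N) :
    coeffFrac (k := k) α (∑ i ∈ F, m i) = ∑ i ∈ F, coeffFrac α (m i) :=
  map_sum (AddMonoidHom.mk' (fun m : N => coeffFrac (k := k) α m) (coeffFrac_add α)) m F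

theorem coeffFrac_smul (α : Fin r →₀ ℕ) (c : k) (m : N) :
    coeffFrac (k := k) α (c • m) = c • coeffFrac α m := by
  rw [coeffFrac, smul_comm, LinearMap.map_smul_of_tower]
  rfl

/-- Every functional on the top local cohomology in degree `-e - ∑ dᵢ` is given by a homomorphism
of degree `e` to the polynomial ring. -/
theorem IsTopFunctional.exists_eq_residuePairing (hd : ∀ i, 0 < d i) (h𝒩 : IsPolyGrading d 𝒩 p)
    {e : ℤ} {l : CechLocalization N
      (MvPolynomial.X : Fin r → MvPolynomial (Fin r) k) Finset.univ →ₗ[k] k}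
    (hl : IsTopFunctional d 𝒩 (-e - ∑ i, (d i : ℤ)) l) :
    ∃ f ∈ gradedDual d 𝒩 e, residuePairing f = l := by
  have hdeg : ∀ a, ∀ y ∈ 𝒩 a, ∀ α, Finsupp.weight (fun i => (d i : ℤ)) α ≠ a + e →
      l (coeffFrac α y) = 0 := fun a y hy α hα =>
    hl.degree _ (fun h => hα (by omega)) _ (coeffFrac_mem h𝒩.hom hy α)
  -- The value of the homomorphism at m is prescribed coefficient by coefficient. Only finitely many
  -- coefficients are nonzero, because l sees a single degree, m has finitely many homogeneous
  -- parts, and positive weights leave finitely many monomials of each weight.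
  have hex : ∀ m : N, ∃ q : MvPolynomial (Fin r) k, ∀ α, MvPolynomial.coeff α q =
      l (coeffFrac α m) := by
    intro m
    obtain ⟨F, hF⟩ := h𝒩.proj.exists_sum m
    have h1 : {α : Fin r →₀ ℕ | l (coeffFrac α m) ≠ 0}.Finite := by
      refine (F.finite_toSet.biUnion fun a _ => finite_weight_eq hd (a + e)).subset fun α hα => ?_
      by_contra h
      apply hα
      rw [← hF, coeffFrac_sum, map_sum]
      refine Finset.sum_eq_zero fun a ha => hdeg a _ (h𝒩.proj.mem a m) α fun h' => h ?_
      exact Set.mem_biUnion ha h'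
    refine ⟨∑ α ∈ h1.toFinset, MvPolynomial.monomial α (l (coeffFrac α m)), fun β => ?_⟩
    rw [MvPolynomial.coeff_sum]
    simp only [MvPolynomial.coeff_monomial, Finset.sum_ite_eq']
    split_ifs with h
    · rfl
    · rw [h1.mem_toFinset] at h
      by_contra h'
      exact h (Ne.symm h')
  choose f hf using hex
  have hadd : ∀ m m', f (m + m') = f m + f m' := fun m m' => by
    ext α
    rw [MvPolynomial.coeff_add, hf, hf, hf, coeffFrac_add, map_add]
  have hX : ∀ i m, f ((MvPolynomial.X i : MvPolynomial (Fin r) k) • m) = MvPolynomial.X i * f m := by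
    intro i m
    ext α
    rw [hf, MvPolynomial.coeff_X_mul']
    split_ifs with h
    · have h1 : α = (α - Finsupp.single i 1) + Finsupp.single i 1 := by
        rw [tsub_add_cancel_of_le]
        rw [Finsupp.single_le_iff]
        exact Nat.one_le_iff_ne_zero.2 (Finsupp.mem_support_iff.1 h)
      conv_lhs => rw [h1]
      rw [coeffFrac_X_smul, hf]
    · exact hl.coeffFrac_X_smul_eq_zero (Finsupp.notMem_support_iff.1 h) m
  have hsmul : ∀ (q : MvPolynomial (Fin r) k) m, f (q • m) = q • f m := by
    intro q
    induction q using MvPolynomial.induction_on with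
    | C c =>
      intro m
      ext α
      rw [← MvPolynomial.algebraMap_eq, algebraMap_smul, hf, coeffFrac_smul, map_smul, algebraMap_smul,
        MvPolynomial.coeff_smul, hf]
    | add q q' hq hq' => intro m; rw [add_smul, hadd, hq, hq', add_smul]
    | mul_X q i hq => intro m; rw [mul_smul, hq, hX, smul_eq_mul, smul_eq_mul, mul_assoc]
  let f' : N →ₗ[MvPolynomial (Fin r) k] MvPolynomial (Fin r) k := ⟨⟨f, hadd⟩, hsmul⟩
  refine ⟨f', fun a y hy α hα => ?_, ?_⟩
  · by_contra h
    exact hα ((hf y α).trans (hdeg a y hy α h))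
  · have h1 : ∀ t m, residuePairing f' (cechFrac _ _ (t + 1) m) = l (cechFrac _ _ (t + 1) m) := by
      intro t m
      have h2 : coeffFrac (k := k) (Finsupp.equivFunOnFinite.symm fun _ : Fin r => t) m =
          cechFrac _ _ (t + 1) m := by
        rw [coeffFrac_eq _ m t 0 (fun i => by simp)]
        simp
      rw [← h2, residuePairing_coeffFrac]
      exact hf m _
    ext y
    obtain ⟨t, m, rfl⟩ := exists_cechFrac y
    rw [← cechFrac_add t 1, h1]

omit [Module k N] [IsScalarTower k (MvPolynomial (Fin r) k) N] in
variable (k r N) in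
/-- The sum of the restriction maps to the localization at the product of all variables. -/
noncomputable def sumRestrict : ((j : Fin r) → CechLocalization N
      (MvPolynomial.X : Fin r → MvPolynomial (Fin r) k) (Finset.univ.erase j))
      →ₗ[MvPolynomial (Fin r) k]
    CechLocalization N (MvPolynomial.X : Fin r → MvPolynomial (Fin r) k) Finset.univ :=
  ∑ j, cechRestrict N MvPolynomial.X (Finset.erase_subset j Finset.univ) ∘ₗ LinearMap.proj j

omit [Module k N] [IsScalarTower k (MvPolynomial (Fin r) k) N] in
theorem sumRestrict_apply (y) : sumRestrict k r N y =
    ∑ j, cechRestrict N MvPolynomial.X (Finset.erase_subset j Finset.univ) (y j) := by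
  simp [sumRestrict]

omit [IsScalarTower k (MvPolynomial (Fin r) k) N] in
theorem cechProjection_sumRestrict (h𝒩 : IsPolyGrading d 𝒩 p) (n : ℤ) (y) :
    cechProjection h𝒩.proj h𝒩.hom Finset.univ n (sumRestrict k r N y) =
      sumRestrict k r N fun j => cechProjection h𝒩.proj h𝒩.hom _ n (y j) := by
  rw [sumRestrict_apply, sumRestrict_apply, map_sum]
  simp only [cechProjection_cechRestrict]

omit [IsScalarTower k (MvPolynomial (Fin r) k) N] in
-- In top degree the complex has the single component N_{x_1⋯x_r}, and signs do not affect the image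
-- of the differential. An ungraded primitive may be replaced by its projection to degree n.
theorem mem_cechCoboundaries_iff_mem_range (h𝒩 : IsPolyGrading d 𝒩 p) {n : ℤ}
    {c : (I : Finset (Fin r)) → CechLocalization N
      (MvPolynomial.X : Fin r → MvPolynomial (Fin r) k) I}
    (hc : c ∈ cechCochains MvPolynomial.X d (fun n => (𝒩 n).toAddSubgroup) r n) :
    c ∈ cechCoboundaries MvPolynomial.X d (fun n => (𝒩 n).toAddSubgroup) r n ↔
      c Finset.univ ∈ LinearMap.range (sumRestrict k r N) := by
  constructor
  · intro h
    obtain ⟨b, hb, rfl⟩ := mem_cechCoboundaries.1 h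
    rw [cechDifferential_apply]
    refine ⟨fun j => (-1 : MvPolynomial (Fin r) k) ^ (Finset.univ.filter (· < j)).card •
      b (Finset.univ.erase j), ?_⟩
    rw [sumRestrict_apply]
    simp only [map_smul]
  · rintro ⟨y, hy⟩
    have hzero : ∀ I, I ≠ Finset.univ → c I = 0 := fun I hI => (mem_cechCochains.1 hc).2 I fun h => hI
      ((Finset.card_eq_iff_eq_univ I).1 (by rw [h, Fintype.card_fin]))
    have hsingle : c = ∑ j, Pi.single Finset.univ
        (cechRestrict N MvPolynomial.X (Finset.erase_subset j Finset.univ)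
          (cechProjection h𝒩.proj h𝒩.hom _ n (y j))) := by
      have h1 := cechProjection_sumRestrict h𝒩 n y
      rw [hy, cechProjection_eq_self h𝒩.proj h𝒩.hom ((mem_cechCochains.1 hc).1 _ (by simp)), sumRestrict_apply] at h1
      funext I
      rw [Finset.sum_apply]
      by_cases hI : I = Finset.univ
      · subst hI
        simp only [Pi.single_eq_same]
        exact h1
      · simp [Pi.single_eq_of_ne hI, hzero I hI]
    rw [hsingle]
    refine sum_mem fun j _ => ?_
    obtain ⟨s, rfl⟩ : ∃ s, r = s + 1 := ⟨r - 1, by have := j.2; omega⟩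
    have hcard : (Finset.univ.erase j).card = s := by simp
    refine mem_cechCoboundaries.2 ⟨Pi.single (Finset.univ.erase j)
      ((-1 : MvPolynomial (Fin (s + 1)) k) ^ (Finset.univ.filter (· < j)).card •
        cechProjection h𝒩.proj h𝒩.hom _ n (y j)), ?_, ?_⟩
    · refine mem_cechCochains.2 ⟨fun I hI => ?_, fun I hI => ?_⟩
      · by_cases hI' : I = Finset.univ.erase j
        · subst hI'
          rw [Pi.single_eq_same]
          rcases neg_one_pow_eq_or (MvPolynomial (Fin (s + 1)) k)
            (Finset.univ.filter (· < j)).card with h | h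
          · rw [h, one_smul]
            exact cechProjection_mem _ _ _
          · rw [h, neg_one_smul]
            exact neg_mem (cechProjection_mem _ _ _)
        · rw [Pi.single_eq_of_ne hI']
          exact zero_mem _
      · rw [Pi.single_eq_of_ne]
        rintro rfl
        exact hI hcard
    · funext J
      rw [cechDifferential_apply]
      by_cases hJ : J = Finset.univ
      · subst hJ
        rw [Pi.single_eq_same, Finset.sum_eq_single j, Pi.single_eq_same, map_smul, smul_smul,
          ← pow_add, Even.neg_one_pow ⟨_, rfl⟩, one_smul]
        · intro i _ hi
          rw [Pi.single_eq_of_ne, map_zero, smul_zero]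
          intro h
          exact hi (Finset.erase_injOn _ (Finset.mem_univ i) (Finset.mem_univ j) h)
        · simp
      · rw [Pi.single_eq_of_ne hJ]
        refine Finset.sum_eq_zero fun i hi => ?_
        rw [Pi.single_eq_of_ne, map_zero, smul_zero]
        intro h
        apply hJ
        refine (Finset.card_eq_iff_eq_univ J).1 ?_
        rw [← Finset.card_erase_add_one hi, h, hcard, Fintype.card_fin]

theorem cechProjection_smul (h𝒩 : IsPolyGrading d 𝒩 p) (n : ℤ) (c : k) (y : CechLocalization N
    (MvPolynomial.X : Fin r → MvPolynomial (Fin r) k) Finset.univ) :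
    cechProjection h𝒩.proj h𝒩.hom Finset.univ n (c • y) =
      c • cechProjection h𝒩.proj h𝒩.hom Finset.univ n y := by
  obtain ⟨t, m, rfl⟩ := exists_cechFrac y
  rw [← LinearMap.map_smul_of_tower, cechProjection_cechFrac, cechProjection_cechFrac,
    ← LinearMap.map_smul_of_tower]
  congr 1
  exact (p _).map_smul c m

/-- The projection onto the component of degree `n` as a linear map. -/
noncomputable def cechProjectionLinear (h𝒩 : IsPolyGrading d 𝒩 p) (n : ℤ) : CechLocalization N
    (MvPolynomial.X : Fin r → MvPolynomial (Fin r) k) Finset.univ →ₗ[k] CechLocalization N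
    (MvPolynomial.X : Fin r → MvPolynomial (Fin r) k) Finset.univ :=
  { cechProjection h𝒩.proj h𝒩.hom Finset.univ n with
    map_smul' := fun c y => cechProjection_smul h𝒩 n c y }

theorem IsTopFunctional.sumRestrict_eq_zero {n : ℤ} {l : CechLocalization N
      (MvPolynomial.X : Fin r → MvPolynomial (Fin r) k) Finset.univ →ₗ[k] k}
    (hl : IsTopFunctional d 𝒩 n l) (y) : l (sumRestrict k r N y) = 0 := by
  rw [sumRestrict_apply, map_sum]
  exact Finset.sum_eq_zero fun j _ => hl.restrict j _

theorem isTopFunctional_comp_cechProjection (h𝒩 : IsPolyGrading d 𝒩 p) (n : ℤ)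
    (l : CechLocalization N
      (MvPolynomial.X : Fin r → MvPolynomial (Fin r) k) Finset.univ →ₗ[k] k)
    (hl : ∀ y, l (sumRestrict k r N y) = 0) :
    IsTopFunctional d 𝒩 n (l ∘ₗ cechProjectionLinear h𝒩 n) where
  restrict j y := by
    change l (cechProjection h𝒩.proj h𝒩.hom Finset.univ n _) = 0
    rw [cechProjection_cechRestrict, ← hl (Pi.single j (cechProjection h𝒩.proj h𝒩.hom _ n y)),
      sumRestrict_apply, Finset.sum_eq_single j, Pi.single_eq_same]
    · intro i _ hi
      rw [Pi.single_eq_of_ne hi, map_zero]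
    · simp
  degree n' hn y hy := by
    change l (cechProjection h𝒩.proj h𝒩.hom Finset.univ n _) = 0
    rw [cechProjection_eq_zero h𝒩.proj h𝒩.hom hn.symm hy, map_zero]

theorem IsTopFunctional.apply_cechProjection (h𝒩 : IsPolyGrading d 𝒩 p) {n : ℤ}
    {l : CechLocalization N
      (MvPolynomial.X : Fin r → MvPolynomial (Fin r) k) Finset.univ →ₗ[k] k}
    (hl : IsTopFunctional d 𝒩 n l) (y) :
    l (cechProjection h𝒩.proj h𝒩.hom Finset.univ n y) = l y := by
  obtain ⟨F, hF⟩ := cechProjection_exists_sum h𝒩.proj h𝒩.hom y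
  conv_rhs => rw [← hF, map_sum]
  have h1 : ∀ n' ∈ F, n' ≠ n → l (cechProjection h𝒩.proj h𝒩.hom Finset.univ n' y) = 0 :=
    fun n' _ hn => hl.degree n' hn _ (cechProjection_mem _ _ _)
  by_cases hn : n ∈ F
  · rw [Finset.sum_eq_single_of_mem n hn h1]
  · rw [Finset.sum_eq_zero fun n' hn' => h1 n' hn' fun h => hn (h ▸ hn')]
    have h2 : cechProjection h𝒩.proj h𝒩.hom Finset.univ n y = 0 := by
      conv_lhs => rw [← hF, map_sum]
      refine Finset.sum_eq_zero fun n' hn' => cechProjection_eq_zero _ _ (fun h => hn ?_)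
        (cechProjection_mem h𝒩.proj h𝒩.hom y)
      rwa [h]
    rw [h2, map_zero]

end Duality

/-! ### Injectivity on top cohomology as surjectivity on graded duals, over a field. -/

section FieldDuality

variable {k : Type*} [Field k] {r : ℕ} {d : Fin r → ℕ}
  {N₁ : Type*} [AddCommGroup N₁] [Module k N₁] [Module (MvPolynomial (Fin r) k) N₁]
  [IsScalarTower k (MvPolynomial (Fin r) k) N₁] {𝒩₁ : ℤ → Submodule k N₁} {p₁ : ℤ → N₁ →ₗ[k] N₁}
  {N₂ : Type*} [AddCommGroup N₂] [Module k N₂] [Module (MvPolynomial (Fin r) k) N₂]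
  [IsScalarTower k (MvPolynomial (Fin r) k) N₂] {𝒩₂ : ℤ → Submodule k N₂} {p₂ : ℤ → N₂ →ₗ[k] N₂}

theorem exists_linearMap_comp_eq {V V' : Type*} [AddCommGroup V] [Module k V] [AddCommGroup V']
    [Module k V'] (φ : V →ₗ[k] V') (l : V →ₗ[k] k) (h : ∀ v, φ v = 0 → l v = 0) :
    ∃ l' : V' →ₗ[k] k, l' ∘ₗ φ = l := by
  have h1 : l ∈ LinearMap.range φ.dualMap := by
    rw [LinearMap.range_dualMap_eq_dualAnnihilator_ker, Submodule.mem_dualAnnihilator]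
    exact fun v hv => h v hv
  obtain ⟨l', hl'⟩ := h1
  exact ⟨l', hl'⟩

/-- The map induced on the top local cohomology by a graded homomorphism is injective in degree
`-e - ∑ dᵢ` if and only if the map of duals is surjective in degree `e`. -/
theorem top_injective_iff_gradedDual_surjective (hd : ∀ i, 0 < d i) (h₁ : IsPolyGrading d 𝒩₁ p₁)
    (h₂ : IsPolyGrading d 𝒩₂ p₂) (f : N₁ →ₗ[MvPolynomial (Fin r) k] N₂)
    (hf : ∀ n, ∀ y ∈ 𝒩₁ n, f y ∈ 𝒩₂ n)
    (hfX : ∀ (i : Fin r) (m : N₁), f.toAddMonoidHom ((MvPolynomial.X i : MvPolynomial (Fin r) k) • m) =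
      (MvPolynomial.X i : MvPolynomial (Fin r) k) • f.toAddMonoidHom m) (e : ℤ) :
    (∀ c ∈ cechCochains MvPolynomial.X d (fun n => (𝒩₁ n).toAddSubgroup) r (-e - ∑ i, (d i : ℤ)),
      cechMap f.toAddMonoidHom hfX c ∈
        cechCoboundaries MvPolynomial.X d (fun n => (𝒩₂ n).toAddSubgroup) r (-e - ∑ i, (d i : ℤ)) →
      c ∈ cechCoboundaries MvPolynomial.X d (fun n => (𝒩₁ n).toAddSubgroup) r
        (-e - ∑ i, (d i : ℤ))) ↔
    ∀ g ∈ gradedDual d 𝒩₁ e, ∃ h ∈ gradedDual d 𝒩₂ e, h ∘ₗ f = g := by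
  let n := -e - ∑ i, (d i : ℤ)
  have hcomp : ∀ (h : N₂ →ₗ[MvPolynomial (Fin r) k] MvPolynomial (Fin r) k) y,
      residuePairing (h ∘ₗ f) y = residuePairing h (localizationMapPoly f y) := by
    intro h y
    obtain ⟨t, m, rfl⟩ := exists_cechFrac y
    rw [localizationMapPoly_cechFrac, residuePairing_cechFrac, residuePairing_cechFrac]
    rfl
  have hpi : ∀ y, localizationMapPoly f (cechProjection h₁.proj h₁.hom Finset.univ n y) =
      cechProjection h₂.proj h₂.hom Finset.univ n (localizationMapPoly f y) := by
    intro y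
    obtain ⟨t, m, rfl⟩ := exists_cechFrac y
    rw [cechProjection_cechFrac, localizationMapPoly_cechFrac, localizationMapPoly_cechFrac,
      cechProjection_cechFrac]
    exact congrArg _ (h₁.proj.map_apply h₂.proj f.toAddMonoidHom hf _ m)
  have hcochain : ∀ y ∈ localizationComponent MvPolynomial.X d (fun n => (𝒩₁ n).toAddSubgroup)
      Finset.univ n, Pi.single Finset.univ y ∈
        cechCochains (MvPolynomial.X : Fin r → MvPolynomial (Fin r) k) d
          (fun n => (𝒩₁ n).toAddSubgroup) r n := by
    intro y hy
    refine mem_cechCochains.2 ⟨fun I hI => ?_, fun I hI => ?_⟩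
    · obtain rfl := (Finset.card_eq_iff_eq_univ I).1 (by rw [hI, Fintype.card_fin])
      rwa [Pi.single_eq_same]
    · rw [Pi.single_eq_of_ne]
      rintro rfl
      simp at hI
  have hmem : ∀ c ∈ cechCochains MvPolynomial.X d (fun n => (𝒩₁ n).toAddSubgroup) r n,
      cechMap f.toAddMonoidHom hfX c ∈
        cechCoboundaries MvPolynomial.X d (fun n => (𝒩₂ n).toAddSubgroup) r n ↔
      localizationMapPoly f (c Finset.univ) ∈ LinearMap.range (sumRestrict k r N₂) := fun c hc =>
    mem_cechCoboundaries_iff_mem_range h₂ (cechMap_mem h₁.hom hfX hf hc)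
  have hpairing : ∀ (g : N₁ →ₗ[MvPolynomial (Fin r) k] MvPolynomial (Fin r) k),
      g ∈ gradedDual d 𝒩₁ e → IsTopFunctional d 𝒩₁ n (residuePairing g) := fun g hg =>
    isTopFunctional_residuePairing h₁.hom hg
  constructor
  · intro hinj g hg
    -- The composite to the full top cohomology of N₂. Injectivity in degree n says that the
    -- functional of g kills its kernel; over a field the functional then extends.
    let φ := ((LinearMap.range (sumRestrict k r N₂)).restrictScalars k).mkQ ∘ₗ localizationMapPoly f
    have hφ : ∀ y, φ y = 0 → residuePairing g y = 0 := by
      intro y hy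
      have h3 : localizationMapPoly f y ∈ LinearMap.range (sumRestrict k r N₂) :=
        (Submodule.Quotient.mk_eq_zero _).1 hy
      obtain ⟨z, hz⟩ := h3
      have h4 := cechProjection_mem h₁.proj h₁.hom (n := n) y
      have h5 := (mem_cechCoboundaries_iff_mem_range h₁ (hcochain _ h4)).1
        (hinj _ (hcochain _ h4) ((hmem _ (hcochain _ h4)).2 (by
          rw [Pi.single_eq_same, hpi, ← hz, cechProjection_sumRestrict h₂]
          exact ⟨_, rfl⟩)))
      rw [Pi.single_eq_same] at h5
      obtain ⟨w, hw⟩ := h5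
      rw [← (hpairing g hg).apply_cechProjection h₁, ← hw]
      exact (hpairing g hg).sumRestrict_eq_zero w
    obtain ⟨l', hl'⟩ := exists_linearMap_comp_eq φ _ hφ
    -- The extension need not be concentrated in degree n; composing with the projection makes it
    -- so, and duality then represents it by a homomorphism of degree e.
    obtain ⟨h, hh, hh'⟩ := (isTopFunctional_comp_cechProjection h₂ n
      (l' ∘ₗ ((LinearMap.range (sumRestrict k r N₂)).restrictScalars k).mkQ) (fun y => by
        have h6 : ((LinearMap.range (sumRestrict k r N₂)).restrictScalars k).mkQ
          (sumRestrict k r N₂ y) = 0 := (Submodule.Quotient.mk_eq_zero _).2 ⟨y, rfl⟩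
        rw [LinearMap.comp_apply, h6, map_zero])).exists_eq_residuePairing hd h₂
    refine ⟨h, hh, residuePairing_injective (LinearMap.ext fun y => ?_)⟩
    rw [hcomp, hh']
    change l' (Submodule.mkQ _ (cechProjection h₂.proj h₂.hom Finset.univ n _)) = _
    rw [← hpi, ← (hpairing g hg).apply_cechProjection h₁, ← hl']
    rfl
  · intro hsurj c hc hfc
    rw [mem_cechCoboundaries_iff_mem_range h₁ hc]
    by_contra hn
    -- A class that is not a coboundary is separated from the coboundaries by a linear functional,
    -- whose degree-n part comes from a homomorphism g; extending g to N₂ gives the contradiction.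
    obtain ⟨l, hl0, hl⟩ := Submodule.exists_le_ker_of_notMem
      (p := (LinearMap.range (sumRestrict k r N₁)).restrictScalars k) hn
    obtain ⟨g, hg, hgl⟩ := (isTopFunctional_comp_cechProjection h₁ n l
      (fun y => hl ⟨y, rfl⟩)).exists_eq_residuePairing hd h₁
    obtain ⟨h, hh, rfl⟩ := hsurj g hg
    apply hl0
    have h3 : residuePairing (h ∘ₗ f) (c Finset.univ) = l (c Finset.univ) := by
      rw [hgl]
      change l (cechProjection h₁.proj h₁.hom Finset.univ n _) = _
      rw [cechProjection_eq_self h₁.proj h₁.hom ((mem_cechCochains.1 hc).1 _ (by simp))]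
    rw [← h3, hcomp]
    obtain ⟨z, hz⟩ := (hmem c hc).1 hfc
    rw [← hz]
    exact (isTopFunctional_residuePairing h₂.hom hh).sumRestrict_eq_zero z

end FieldDuality

/-! ### Graded presentations and base change to k[X]. -/

section PolynomialBaseChange

attribute [local instance] MvPolynomial.algebraMvPolynomial

section Presentation

variable {A : Type*} [CommRing A] {r : ℕ} {d : Fin r → ℕ} {Y : Type*} [AddCommGroup Y] [Module A Y]
  [Module (MvPolynomial (Fin r) A) Y] [IsScalarTower A (MvPolynomial (Fin r) A) Y]
  {𝒴 : ℤ → Submodule A Y} {p : ℤ → Y →ₗ[A] Y}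

theorem IsHomogeneousAction.linearCombination_mem
    (h : IsHomogeneousAction (MvPolynomial.X : Fin r → MvPolynomial (Fin r) A) d
      (fun n => (𝒴 n).toAddSubgroup)) {b : ℕ} {e : Fin b → ℤ} {t : Fin b → Y}
    (ht : ∀ j, t j ∈ 𝒴 (e j)) {n : ℤ} {v : Fin b → MvPolynomial (Fin r) A}
    (hv : v ∈ polyFreeComponent A d e n) :
    Fintype.linearCombination (MvPolynomial (Fin r) A) t v ∈ 𝒴 n := by
  rw [Fintype.linearCombination_apply]
  refine sum_mem fun j _ => ?_
  have h1 := (mem_polyFreeComponent d).1 hv j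
  rw [← MvPolynomial.support_sum_monomial_coeff (v j), Finset.sum_smul]
  refine sum_mem fun α hα => ?_
  have h2 := h.monomial_smul_mem α (MvPolynomial.coeff α (v j)) (ht j)
  have h3 := h1 (MvPolynomial.mem_support_iff.1 hα)
  rw [h3] at h2
  simpa using h2

/-- A finitely generated graded module is a graded quotient of a graded free module. -/
theorem IsPolyGrading.exists_presentation (h : IsPolyGrading d 𝒴 p)
    [Module.Finite (MvPolynomial (Fin r) A) Y] :
    ∃ (b : ℕ) (e : Fin b → ℤ) (π : (Fin b → MvPolynomial (Fin r) A) →ₗ[MvPolynomial (Fin r) A] Y),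
      Function.Surjective π ∧ ∀ n, ∀ v ∈ polyFreeComponent A d e n, π v ∈ 𝒴 n := by
  classical
  obtain ⟨s, hs⟩ := (Module.Finite.fg_top : (⊤ : Submodule (MvPolynomial (Fin r) A) Y).FG)
  choose F hF using h.proj.exists_sum
  let T : Finset (ℤ × Y) := s.biUnion fun y => (F y).image fun n => (n, p n y)
  let t : Fin T.card ≃ T := T.equivFin.symm
  have hT : ∀ j, (t j).1.2 ∈ 𝒴 (t j).1.1 := by
    intro j
    obtain ⟨y, hy, hj⟩ := Finset.mem_biUnion.1 (t j).2
    obtain ⟨n, hn, hj⟩ := Finset.mem_image.1 hj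
    rw [← hj]
    exact h.proj.mem n y
  let π := Fintype.linearCombination (MvPolynomial (Fin r) A) fun j => (t j).1.2
  refine ⟨T.card, fun j => (t j).1.1, π, ?_, ?_⟩
  · rw [← LinearMap.range_eq_top, eq_top_iff, ← hs, Submodule.span_le]
    intro y hy
    rw [SetLike.mem_coe, ← hF y]
    refine sum_mem fun n hn => ?_
    have h1 : (n, p n y) ∈ T := Finset.mem_biUnion.2 ⟨y, hy, Finset.mem_image.2 ⟨n, hn, rfl⟩⟩
    refine ⟨Pi.single (t.symm ⟨_, h1⟩) 1, ?_⟩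
    simp [π, Fintype.linearCombination_apply_single]
  · exact fun n v hv => h.hom.linearCombination_mem hT hv

theorem polyComponent_finite (hd : ∀ i, 0 < d i) (n : ℤ) :
    Module.Finite A (polyComponent A d n) := by
  rw [Module.Finite.iff_fg, polyComponent_eq_span]
  exact Submodule.fg_span ((finite_weight_eq hd n).image _)

theorem polyFreeComponent_finite (hd : ∀ i, 0 < d i) {b : ℕ} (e : Fin b → ℤ) (n : ℤ) :
    Module.Finite A (polyFreeComponent A d e n) := by
  rw [Module.Finite.iff_fg, polyFreeComponent]
  exact Submodule.fg_pi fun j => Module.Finite.iff_fg.1 (polyComponent_finite hd _)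

theorem IsPolyGrading.eq_map (h : IsPolyGrading d 𝒴 p) {b : ℕ} {e : Fin b → ℤ}
    {π : (Fin b → MvPolynomial (Fin r) A) →ₗ[MvPolynomial (Fin r) A] Y}
    (hπ : Function.Surjective π) (hπ' : ∀ n, ∀ v ∈ polyFreeComponent A d e n, π v ∈ 𝒴 n) (n : ℤ) :
    𝒴 n = (polyFreeComponent A d e n).map (π.restrictScalars A) := by
  apply le_antisymm
  · intro y hy
    obtain ⟨v, rfl⟩ := hπ y
    exact ⟨_, (isPolyGrading_free d e).proj.mem n v,
      ((isPolyGrading_free d e).proj.map_apply h.proj π.toAddMonoidHom hπ' n v).trans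
        (h.proj.eq_self n _ hy)⟩
  · rintro _ ⟨v, hv, rfl⟩
    exact hπ' n v hv

theorem IsPolyGrading.finite (hd : ∀ i, 0 < d i) (h : IsPolyGrading d 𝒴 p)
    [Module.Finite (MvPolynomial (Fin r) A) Y] (n : ℤ) : Module.Finite A (𝒴 n) := by
  obtain ⟨b, e, π, hπ, hπ'⟩ := h.exists_presentation
  rw [Module.Finite.iff_fg, h.eq_map hπ hπ' n]
  exact (Module.Finite.iff_fg.1 (polyFreeComponent_finite hd e n)).map _

end Presentation

/-- The base change of a module over a polynomial ring to the polynomial ring over `k`. -/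
def PolyFiber (A : Type*) (r : ℕ) (k Y : Type*) [CommRing A] [CommRing k] [Algebra A k]
    [AddCommGroup Y] [Module (MvPolynomial (Fin r) A) Y] : Type _ :=
  MvPolynomial (Fin r) k ⊗[MvPolynomial (Fin r) A] Y

namespace PolyFiber

section

variable {A : Type*} [CommRing A] {r : ℕ} (k : Type*) [CommRing k] [Algebra A k]
  {Y : Type*} [AddCommGroup Y] [Module (MvPolynomial (Fin r) A) Y]
  {Y' : Type*} [AddCommGroup Y'] [Module (MvPolynomial (Fin r) A) Y']

noncomputable instance : AddCommGroup (PolyFiber A r k Y) :=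
  inferInstanceAs (AddCommGroup (MvPolynomial (Fin r) k ⊗[MvPolynomial (Fin r) A] Y))

noncomputable instance : Module (MvPolynomial (Fin r) k) (PolyFiber A r k Y) :=
  inferInstanceAs (Module _ (MvPolynomial (Fin r) k ⊗[MvPolynomial (Fin r) A] Y))

noncomputable instance : Module k (PolyFiber A r k Y) :=
  Module.compHom _ (algebraMap k (MvPolynomial (Fin r) k))

instance : IsScalarTower k (MvPolynomial (Fin r) k) (PolyFiber A r k Y) :=
  IsScalarTower.of_algebraMap_smul fun _ _ => rfl

variable (A r Y) in
/-- The canonical map to the base change. -/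
noncomputable def of : Y →+ PolyFiber A r k Y :=
  (TensorProduct.mk (MvPolynomial (Fin r) A) (MvPolynomial (Fin r) k) Y 1).toAddMonoidHom

theorem of_smul (q : MvPolynomial (Fin r) A) (y : Y) :
    of A r k Y (q • y) = MvPolynomial.map (algebraMap A k) q • of A r k Y y := by
  change (1 : MvPolynomial (Fin r) k) ⊗ₜ[MvPolynomial (Fin r) A] (q • y) =
    MvPolynomial.map (algebraMap A k) q •
      ((1 : MvPolynomial (Fin r) k) ⊗ₜ[MvPolynomial (Fin r) A] y)
  rw [← TensorProduct.smul_tmul, TensorProduct.smul_tmul', Algebra.smul_def, smul_eq_mul]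
  rfl

theorem of_X_smul (i : Fin r) (y : Y) :
    of A r k Y ((MvPolynomial.X i : MvPolynomial (Fin r) A) • y) =
      (MvPolynomial.X i : MvPolynomial (Fin r) k) • of A r k Y y := by
  rw [of_smul, MvPolynomial.map_X]

/-- The map of base changes induced by a linear map. -/
noncomputable def map (f : Y →ₗ[MvPolynomial (Fin r) A] Y') :
    PolyFiber A r k Y →ₗ[MvPolynomial (Fin r) k] PolyFiber A r k Y' :=
  f.baseChange (MvPolynomial (Fin r) k)

@[simp]
theorem map_of (f : Y →ₗ[MvPolynomial (Fin r) A] Y') (y : Y) :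
    map k f (of A r k Y y) = of A r k Y' (f y) :=
  LinearMap.baseChange_tmul _ _ _

theorem map_surjective {f : Y →ₗ[MvPolynomial (Fin r) A] Y'} (hf : Function.Surjective f) :
    Function.Surjective (map k f) :=
  LinearMap.lTensor_surjective _ hf

theorem map_exact {Y'' : Type*} [AddCommGroup Y''] [Module (MvPolynomial (Fin r) A) Y'']
    {f : Y →ₗ[MvPolynomial (Fin r) A] Y'} {g : Y' →ₗ[MvPolynomial (Fin r) A] Y''}
    (hfg : Function.Exact f g) (hg : Function.Surjective g) :
    Function.Exact (map k f) (map k g) :=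
  lTensor_exact _ hfg hg

theorem exists_lift {N : Type*} [AddCommGroup N] [Module (MvPolynomial (Fin r) k) N] (f : Y →+ N)
    (hf : ∀ (q : MvPolynomial (Fin r) A) y, f (q • y) = MvPolynomial.map (algebraMap A k) q • f y) :
    ∃ g : PolyFiber A r k Y →ₗ[MvPolynomial (Fin r) k] N, ∀ y, g (of A r k Y y) = f y := by
  let : Module (MvPolynomial (Fin r) A) N :=
    Module.compHom N (algebraMap (MvPolynomial (Fin r) A) (MvPolynomial (Fin r) k))
  have : IsScalarTower (MvPolynomial (Fin r) A) (MvPolynomial (Fin r) k) N :=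
    IsScalarTower.of_algebraMap_smul fun _ _ => rfl
  let f' : Y →ₗ[MvPolynomial (Fin r) A] N := { f with map_smul' := hf }
  refine ⟨f'.liftBaseChange (MvPolynomial (Fin r) k), fun y => ?_⟩
  refine (LinearMap.liftBaseChange_tmul _ _ _ _).trans ?_
  rw [one_smul]
  rfl

@[elab_as_elim]
theorem induction' {P : PolyFiber A r k Y → Prop} (z : PolyFiber A r k Y) (zero : P 0)
    (smul : ∀ (q : MvPolynomial (Fin r) k) y, P (q • of A r k Y y))
    (add : ∀ z z', P z → P z' → P (z + z')) : P z := by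
  refine TensorProduct.induction_on (motive := P) z zero (fun q y => ?_) add
  have h := smul q y
  have h1 : q • of A r k Y y = q ⊗ₜ[MvPolynomial (Fin r) A] y := by
    refine (TensorProduct.smul_tmul' q (1 : MvPolynomial (Fin r) k) y).trans ?_
    rw [smul_eq_mul, mul_one]
  rwa [h1] at h

theorem hom_ext {N : Type*} [AddCommGroup N] [Module (MvPolynomial (Fin r) k) N]
    {f g : PolyFiber A r k Y →ₗ[MvPolynomial (Fin r) k] N}
    (h : ∀ y, f (of A r k Y y) = g (of A r k Y y)) : f = g := by
  ext z
  induction z using induction' with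
  | zero => rw [map_zero, map_zero]
  | smul q y => rw [map_smul, map_smul, h]
  | add z z' hz hz' => rw [map_add, map_add, hz, hz']

end

variable {A : Type*} [CommRing A] {r : ℕ} {d : Fin r → ℕ} {Y : Type*} [AddCommGroup Y] [Module A Y]
  [Module (MvPolynomial (Fin r) A) Y] [IsScalarTower A (MvPolynomial (Fin r) A) Y]
  {𝒴 : ℤ → Submodule A Y} {p : ℤ → Y →ₗ[A] Y} (k : Type*) [CommRing k] [Algebra A k]

variable (A r Y) in
/-- The base change to `k[X]` agrees with the base change to `k`. -/
noncomputable def equiv : PolyFiber A r k Y ≃ₗ[k] k ⊗[A] Y :=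
  (AddEquiv.toLinearEquiv (Algebra.IsPushout.cancelBaseChange A k (MvPolynomial (Fin r) A)
    (MvPolynomial (Fin r) k) Y).symm.toAddEquiv fun c z => by
      have h : ∀ w : MvPolynomial (Fin r) k ⊗[MvPolynomial (Fin r) A] Y,
          algebraMap k (MvPolynomial (Fin r) k) c • w = c • w := by
        intro w
        induction w with
        | zero => rw [smul_zero]; exact (smul_zero (A := MvPolynomial (Fin r) k ⊗[MvPolynomial (Fin r) A] Y) c).symm
        | tmul q y =>
          rw [TensorProduct.smul_tmul', TensorProduct.smul_tmul', algebraMap_smul]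
        | add w w' h h' => rw [smul_add, h, h']; exact (smul_add c w w').symm
      refine ((Algebra.IsPushout.cancelBaseChange A k (MvPolynomial (Fin r) A)
        (MvPolynomial (Fin r) k) Y).symm.map_smul c z).trans (h _).symm :
      k ⊗[A] Y ≃ₗ[k] PolyFiber A r k Y).symm

theorem equiv_symm_tmul (c : k) (y : Y) :
    (equiv A r Y k).symm (c ⊗ₜ y) = c • of A r k Y y := by
  refine (Algebra.IsPushout.cancelBaseChange_symm_tmul A k (MvPolynomial (Fin r) A)
    (MvPolynomial (Fin r) k) Y c y).trans ?_
  refine Eq.trans ?_ (TensorProduct.smul_tmul' (algebraMap k (MvPolynomial (Fin r) k) c)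
    (1 : MvPolynomial (Fin r) k) y).symm
  rw [smul_eq_mul, mul_one]

@[simp]
theorem equiv_of (y : Y) : equiv A r Y k (of A r k Y y) = 1 ⊗ₜ y := by
  rw [← LinearEquiv.eq_symm_apply, equiv_symm_tmul, one_smul]

@[elab_as_elim]
theorem induction {P : PolyFiber A r k Y → Prop} (z : PolyFiber A r k Y)
    (of : ∀ y : Y, P (of A r k Y y))
    (smul : ∀ (c : k) z, P z → P (c • z)) (add : ∀ z z', P z → P z' → P (z + z')) : P z := by
  obtain ⟨w, rfl⟩ := (equiv A r Y k).symm.surjective z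
  induction w with
  | zero => simpa only [map_zero] using of 0
  | tmul c y => rw [equiv_symm_tmul]; exact smul _ _ (of y)
  | add w w' h h' => rw [map_add]; exact add _ _ h h'

variable (𝒴) in
/-- The component of degree `n` of the base change of a graded module to `k[X]`. -/
noncomputable def component (n : ℤ) : Submodule k (PolyFiber A r k Y) :=
  Submodule.span k (of A r k Y '' 𝒴 n)

variable (p) in
/-- The projection of the base change of a graded module to `k[X]` onto its component of
degree `n`. -/
noncomputable def projection (n : ℤ) : PolyFiber A r k Y →ₗ[k] PolyFiber A r k Y :=
  (equiv A r Y k).symm.toLinearMap ∘ₗ (p n).baseChange k ∘ₗ (equiv A r Y k).toLinearMap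

@[simp]
theorem projection_of (n : ℤ) (y : Y) :
    projection p k n (of A r k Y y) = of A r k Y (p n y) := by
  simp [projection, equiv_symm_tmul]

omit [IsScalarTower A (MvPolynomial (Fin r) A) Y] in
theorem of_mem_component {n : ℤ} {y : Y} (hy : y ∈ 𝒴 n) : of A r k Y y ∈ component 𝒴 k n :=
  Submodule.subset_span ⟨y, hy, rfl⟩

theorem isPolyGrading (h : IsPolyGrading d 𝒴 p) :
    IsPolyGrading d (component (r := r) 𝒴 k) (projection p k) where
  proj :=
    { mem := fun n z => by
        change projection p k n z ∈ component 𝒴 k n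
        induction z using induction with
        | of y =>
          rw [projection_of]
          exact of_mem_component k (h.proj.mem n y)
        | smul c z hz => rw [map_smul]; exact Submodule.smul_mem _ c hz
        | add z z' hz hz' => rw [map_add]; exact add_mem hz hz'
      eq_self := fun n z hz => by
        change projection p k n z = z
        refine Submodule.span_induction ?_ (map_zero _) (fun _ _ _ _ h h' => by rw [map_add, h, h'])
          (fun c _ _ h => by rw [map_smul, h]) hz
        rintro _ ⟨y, hy, rfl⟩
        rw [projection_of]
        exact congrArg _ (h.proj.eq_self n y hy)
      eq_zero := fun n n' hn z hz => by
        change projection p k n z = 0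
        refine Submodule.span_induction ?_ (map_zero _)
          (fun _ _ _ _ h h' => by rw [map_add, h, h', add_zero])
          (fun c _ _ h => by rw [map_smul, h, smul_zero]) hz
        rintro _ ⟨y, hy, rfl⟩
        rw [projection_of]
        exact (congrArg _ (h.proj.eq_zero n n' hn y hy)).trans (map_zero _)
      exists_sum := fun z => by
        suffices H : ∃ F : Finset ℤ, ∀ F', F ⊆ F' → ∑ n ∈ F', projection p k n z = z from
          ⟨_, H.choose_spec _ subset_rfl⟩
        induction z using induction with
        | of y =>
          obtain ⟨F, hF⟩ := h.proj.exists_sum y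
          refine ⟨F, fun F' hF' => ?_⟩
          simp only [projection_of]
          rw [← map_sum]
          exact congrArg _ (h.proj.sum_eq_of_subset hF' hF)
        | smul c z hz =>
          obtain ⟨F, hF⟩ := hz
          refine ⟨F, fun F' hF' => ?_⟩
          simp only [map_smul]
          rw [← Finset.smul_sum, hF F' hF']
        | add z z' hz hz' =>
          obtain ⟨F, hF⟩ := hz
          obtain ⟨G, hG⟩ := hz'
          refine ⟨F ∪ G, fun F' hF' => ?_⟩
          simp only [map_add]
          rw [Finset.sum_add_distrib, hF F' (Finset.union_subset_left hF'),
            hG F' (Finset.union_subset_right hF')] }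
  hom := fun i n z hz => by
    change z ∈ component 𝒴 k n at hz
    refine Submodule.span_induction ?_ ?_ ?_ ?_ hz
    · rintro _ ⟨y, hy, rfl⟩
      rw [← of_X_smul]
      exact of_mem_component k (h.hom i n y hy)
    · rw [smul_zero]; exact zero_mem _
    · intro z z' _ _ h h'
      rw [smul_add]
      exact add_mem h h'
    · intro c z _ h
      rw [smul_comm]
      exact Submodule.smul_mem _ c h

variable (𝒴) in
theorem component_eq_range (n : ℤ) : component (r := r) 𝒴 k n =
    LinearMap.range ((equiv A r Y k).symm.toLinearMap ∘ₗ (𝒴 n).subtype.baseChange k) := by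
  apply le_antisymm
  · rw [component, Submodule.span_le]
    rintro _ ⟨y, hy, rfl⟩
    refine ⟨1 ⊗ₜ ⟨y, hy⟩, ?_⟩
    simp [equiv_symm_tmul]
  · rintro _ ⟨w, rfl⟩
    induction w with
    | zero => rw [map_zero]; exact zero_mem _
    | tmul c y =>
      simp only [LinearMap.comp_apply, LinearMap.baseChange_tmul, LinearEquiv.coe_coe,
        equiv_symm_tmul]
      exact Submodule.smul_mem _ c (of_mem_component k y.2)
    | add w w' h h' => rw [map_add]; exact add_mem h h'

theorem component_injective (h : IsPolyGrading d 𝒴 p) (n : ℤ) : Function.Injective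
    ((equiv A r Y k).symm.toLinearMap ∘ₗ (𝒴 n).subtype.baseChange k) := by
  refine (equiv A r Y k).symm.injective.comp ?_
  let ρ : Y →ₗ[A] 𝒴 n := (p n).codRestrict (𝒴 n) (h.proj.mem n)
  have h1 : ρ ∘ₗ (𝒴 n).subtype = LinearMap.id := by
    ext y
    exact h.proj.eq_self n y y.2
  refine Function.LeftInverse.injective (g := ρ.baseChange k) fun w => ?_
  rw [← LinearMap.comp_apply, ← LinearMap.baseChange_comp, h1, LinearMap.baseChange_id]
  rfl

/-- The degree projections make each Y_n a direct summand of Y, so the single element that makes Y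
flat makes all the finite modules Y_n flat at once. This uniformity in n is what the whole argument
rests on. -/
theorem exists_finrank_component [IsNoetherianRing A] [IsReduced A] {q : Ideal A}
    (hq : q ∈ minimalPrimes A) (hd : ∀ i, 0 < d i) (h : IsPolyGrading d 𝒴 p)
    [Module.Finite (MvPolynomial (Fin r) A) Y] :
    ∃ a, IsGoodAt q a ∧ ∃ ρ : ℤ → ℕ, ∀ (k : Type*) [Field k] [Algebra A k], algebraMap A k a ≠ 0 →
      ∀ n, Module.finrank k (component (r := r) 𝒴 k n) = ρ n := by
  have hqp : q.IsPrime := hq.1.1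
  obtain ⟨a, ha⟩ := exists_isGoodAt hq
  obtain ⟨b, hb, hflat⟩ := genericallyFlat_mvPolynomial hq r Y
  have hab := ha.mul hb
  have hflat' := hflat.of_dvd (Dvd.intro_left a rfl)
  have h1 : ∀ n, ∃ ρ : ℕ, ∀ (k : Type _) [Field k] [Algebra A k], algebraMap A k (a * b) ≠ 0 →
      Module.finrank k (k ⊗[A] 𝒴 n) = ρ := fun n => by
    have := h.finite hd n
    refine FlatAway.exists_finrank_eq hab (hflat'.of_retract (𝒴 n).subtype
      ((p n).codRestrict (𝒴 n) (h.proj.mem n)) ?_)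
    ext y
    exact h.proj.eq_self n y y.2
  choose ρ hρ using h1
  refine ⟨a * b, hab, ρ, fun k _ _ hk n => ?_⟩
  rw [← hρ n k hk, component_eq_range]
  exact LinearMap.finrank_range_of_inj (component_injective k h n)

end PolyFiber

end PolynomialBaseChange

/-! ### Gradings on kernels, cokernels and base changes. -/

section Induced

variable {A : Type*} [CommRing A] {r : ℕ} {d : Fin r → ℕ} {Y : Type*} [AddCommGroup Y] [Module A Y]
  [Module (MvPolynomial (Fin r) A) Y] [IsScalarTower A (MvPolynomial (Fin r) A) Y]
  {Y' : Type*} [AddCommGroup Y'] [Module A Y'] [Module (MvPolynomial (Fin r) A) Y']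
  [IsScalarTower A (MvPolynomial (Fin r) A) Y']
  {𝒴 : ℤ → Submodule A Y} {p : ℤ → Y →ₗ[A] Y}

/-- The grading induced on a quotient by a graded submodule. -/
theorem IsPolyGrading.of_surjective (h : IsPolyGrading d 𝒴 p)
    (f : Y →ₗ[MvPolynomial (Fin r) A] Y') (hf : Function.Surjective f)
    (hker : ∀ n y, f y = 0 → f (p n y) = 0) :
    ∃ p', IsPolyGrading d (fun n => (𝒴 n).map (f.restrictScalars A)) p' := by
  choose s hs using hf
  have key : ∀ n y, f (p n (s (f y))) = f (p n y) := fun n y => by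
    rw [← sub_eq_zero, ← map_sub, ← map_sub]
    exact hker n _ (by rw [map_sub, hs, sub_self])
  let p' : ℤ → Y' →ₗ[A] Y' := fun n =>
    { toFun := fun y => f (p n (s y))
      map_add' := fun y y' => by
        have h1 : y + y' = f (s y + s y') := by rw [map_add, hs, hs]
        rw [h1, key, map_add, map_add]
      map_smul' := fun c y => by
        have h1 : c • y = f (c • s y) := by rw [LinearMap.map_smul_of_tower, hs]
        rw [h1, key, map_smul, LinearMap.map_smul_of_tower]
        rfl }
  have hp' : ∀ n y, p' n (f y) = f (p n y) := key
  refine ⟨p', ⟨fun n y => ?_, fun n y hy => ?_, fun n n' hn y hy => ?_, fun y => ?_⟩, ?_⟩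
  · exact ⟨_, h.proj.mem n (s y), rfl⟩
  · obtain ⟨y, hy, rfl⟩ := hy
    exact (hp' n y).trans (congrArg f (h.proj.eq_self n y hy))
  · obtain ⟨y, hy, rfl⟩ := hy
    exact (hp' n y).trans ((congrArg f (h.proj.eq_zero n n' hn y hy)).trans (map_zero f))
  · obtain ⟨F, hF⟩ := h.proj.exists_sum (s y)
    refine ⟨F, ?_⟩
    conv_rhs => rw [← hs y, ← hF, map_sum]
    rfl
  · rintro i n _ ⟨y, hy, rfl⟩
    exact ⟨_, h.hom i n y hy, f.map_smul _ y⟩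

/-- The grading induced on a graded submodule. -/
theorem IsPolyGrading.of_injective (h : IsPolyGrading d 𝒴 p)
    (f : Y' →ₗ[MvPolynomial (Fin r) A] Y) (hf : Function.Injective f)
    (hrange : ∀ n y, ∃ y', f y' = p n (f y)) :
    ∃ p', IsPolyGrading d (fun n => (𝒴 n).comap (f.restrictScalars A)) p' := by
  choose s hs using hrange
  let p' : ℤ → Y' →ₗ[A] Y' := fun n =>
    { toFun := s n
      map_add' := fun y y' => hf (by rw [hs, map_add, map_add, map_add, hs, hs])
      map_smul' := fun c y => hf (by
        rw [hs, RingHom.id_apply, f.map_smul_of_tower, f.map_smul_of_tower c (s n y), hs, map_smul]) }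
  refine ⟨p', ⟨fun n y => ?_, fun n y hy => hf ?_, fun n n' hn y hy => hf ?_, fun y => ?_⟩, ?_⟩
  · change f (s n y) ∈ 𝒴 n
    rw [hs]
    exact h.proj.mem n _
  · exact (hs n y).trans (h.proj.eq_self n _ hy)
  · exact ((hs n y).trans (h.proj.eq_zero n n' hn _ hy)).trans (map_zero f).symm
  · obtain ⟨F, hF⟩ := h.proj.exists_sum (f y)
    refine ⟨F, hf ?_⟩
    rw [map_sum]
    exact (Finset.sum_congr rfl fun n _ => hs n y).trans hF
  · intro i n y hy
    change f _ ∈ 𝒴 _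
    rw [map_smul]
    exact h.hom i n _ hy

omit [IsScalarTower A (MvPolynomial (Fin r) A) Y'] in
theorem IsPolyGrading.kernel {p' : ℤ → Y' →ₗ[A] Y'} {𝒴' : ℤ → Submodule A Y'}
    (h : IsPolyGrading d 𝒴 p) (h' : IsPolyGrading d 𝒴' p') (f : Y →ₗ[MvPolynomial (Fin r) A] Y')
    (hf : ∀ n, ∀ y ∈ 𝒴 n, f y ∈ 𝒴' n) :
    ∃ p'', IsPolyGrading d
      (fun n => (𝒴 n).comap ((LinearMap.ker f).subtype.restrictScalars A)) p'' :=
  h.of_injective (LinearMap.ker f).subtype Subtype.val_injective fun n y =>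
    ⟨⟨p n y, (h.proj.map_apply h'.proj f.toAddMonoidHom hf n y).trans
      ((congrArg (p' n) y.2).trans (map_zero _))⟩, rfl⟩

omit [IsScalarTower A (MvPolynomial (Fin r) A) Y] in
theorem IsPolyGrading.cokernel {p' : ℤ → Y' →ₗ[A] Y'} {𝒴' : ℤ → Submodule A Y'}
    (h : IsPolyGrading d 𝒴 p) (h' : IsPolyGrading d 𝒴' p') (f : Y →ₗ[MvPolynomial (Fin r) A] Y')
    (hf : ∀ n, ∀ y ∈ 𝒴 n, f y ∈ 𝒴' n) :
    ∃ p'', IsPolyGrading d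
      (fun n => (𝒴' n).map ((LinearMap.range f).mkQ.restrictScalars A)) p'' :=
  h'.of_surjective (LinearMap.range f).mkQ (Submodule.mkQ_surjective _) fun n y hy => by
    obtain ⟨z, rfl⟩ := (Submodule.Quotient.mk_eq_zero _).1 hy
    exact (Submodule.Quotient.mk_eq_zero _).2
      ⟨p n z, h.proj.map_apply h'.proj f.toAddMonoidHom hf n z⟩

end Induced

namespace PolyFiber

variable {A : Type*} [CommRing A] {r : ℕ} {d : Fin r → ℕ} (k : Type*) [CommRing k] [Algebra A k]

section

variable {Y : Type*} [AddCommGroup Y] [Module A Y]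
  [Module (MvPolynomial (Fin r) A) Y] [IsScalarTower A (MvPolynomial (Fin r) A) Y]
  {Y' : Type*} [AddCommGroup Y'] [Module A Y'] [Module (MvPolynomial (Fin r) A) Y']
  [IsScalarTower A (MvPolynomial (Fin r) A) Y']
  {𝒴 : ℤ → Submodule A Y} {𝒴' : ℤ → Submodule A Y'}

omit [IsScalarTower A (MvPolynomial (Fin r) A) Y] [IsScalarTower A (MvPolynomial (Fin r) A) Y'] in
theorem map_mem_component (f : Y →ₗ[MvPolynomial (Fin r) A] Y') (hf : ∀ n, ∀ y ∈ 𝒴 n, f y ∈ 𝒴' n)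
    (n : ℤ) {z : PolyFiber A r k Y} (hz : z ∈ component 𝒴 k n) : map k f z ∈ component 𝒴' k n := by
  have h1 : component 𝒴 k n ≤ (component 𝒴' k n).comap ((map k f).restrictScalars k) := by
    rw [component, Submodule.span_le]
    rintro _ ⟨y, hy, rfl⟩
    change map k f _ ∈ component 𝒴' k n
    rw [map_of]
    exact of_mem_component k (hf n y hy)
  exact h1 hz

end

variable (A r) in
/-- The base change of a free module is free. -/
theorem exists_freeEquiv (b : ℕ) : ∃ Θ : (Fin b → MvPolynomial (Fin r) k) ≃ₗ[MvPolynomial (Fin r) k]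
      PolyFiber A r k (Fin b → MvPolynomial (Fin r) A),
    ∀ v, Θ v = Fintype.linearCombination (MvPolynomial (Fin r) k)
      (fun j => of A r k (Fin b → MvPolynomial (Fin r) A) (Pi.single j 1)) v := by
  obtain ⟨g, hg⟩ := exists_lift k (Y := Fin b → MvPolynomial (Fin r) A)
    (N := Fin b → MvPolynomial (Fin r) k)
    (AddMonoidHom.mk' (fun v j => MvPolynomial.map (algebraMap A k) (v j))
      (fun v w => by ext1 j; simp)) (fun (q : MvPolynomial (Fin r) A) v => by ext1 j; simp)
  let Ψ := Fintype.linearCombination (MvPolynomial (Fin r) k)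
      (fun j => of A r k (Fin b → MvPolynomial (Fin r) A) (Pi.single j 1))
  have h1 : g ∘ₗ Ψ = LinearMap.id := by
    refine LinearMap.pi_ext' fun j => LinearMap.ext_ring ?_
    simp only [LinearMap.comp_apply, LinearMap.single_apply, Ψ,
      Fintype.linearCombination_apply_single, one_smul, hg, LinearMap.id_apply]
    funext i
    by_cases hij : i = j
    · subst hij; simp
    · simp [hij]
  have h2 : Ψ ∘ₗ g = LinearMap.id := by
    refine hom_ext k fun v => ?_
    rw [LinearMap.comp_apply, hg, LinearMap.id_apply, Fintype.linearCombination_apply]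
    simp only [AddMonoidHom.mk'_apply, ← of_smul]
    rw [← map_sum]
    congr 1
    conv_rhs => rw [← Finset.univ_sum_single v]
    refine Finset.sum_congr rfl fun j _ => ?_
    rw [← Pi.single_smul, smul_eq_mul, mul_one]
  exact ⟨LinearEquiv.ofLinearMap Ψ g h2 h1, fun v => rfl⟩

/-- The base change of a free module. -/
noncomputable def freeEquiv (b : ℕ) : (Fin b → MvPolynomial (Fin r) k) ≃ₗ[MvPolynomial (Fin r) k]
    PolyFiber A r k (Fin b → MvPolynomial (Fin r) A) :=
  (exists_freeEquiv A r k b).choose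

theorem freeEquiv_apply (b : ℕ) (v) : freeEquiv (A := A) k b v =
    Fintype.linearCombination (MvPolynomial (Fin r) k)
      (fun j => of A r k (Fin b → MvPolynomial (Fin r) A) (Pi.single j 1)) v :=
  (exists_freeEquiv A r k b).choose_spec v

theorem freeEquiv_single (b : ℕ) (j : Fin b) :
    freeEquiv (A := A) (r := r) k b (Pi.single j 1) = of A r k _ (Pi.single j 1) := by
  rw [freeEquiv_apply, Fintype.linearCombination_apply_single, one_smul]

theorem single_mem_polyFreeComponent {b : ℕ} (e : Fin b → ℤ) (j : Fin b) :
    (Pi.single j 1 : Fin b → MvPolynomial (Fin r) A) ∈ polyFreeComponent A d e (e j) := by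
  refine (mem_polyFreeComponent d).2 fun i => ?_
  by_cases hij : i = j
  · subst hij
    rw [Pi.single_eq_same, sub_self]
    exact MvPolynomial.isWeightedHomogeneous_one _ _
  · rw [Pi.single_eq_of_ne hij]
    exact zero_mem _

theorem freeEquiv_mem {b : ℕ} (e : Fin b → ℤ) (n : ℤ) {v : Fin b → MvPolynomial (Fin r) k}
    (hv : v ∈ polyFreeComponent k d e n) :
    freeEquiv k b v ∈ component (polyFreeComponent A d e) k n := by
  rw [freeEquiv_apply]
  exact (isPolyGrading k (isPolyGrading_free d e)).hom.linearCombination_mem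
    (fun j => of_mem_component k (single_mem_polyFreeComponent e j)) hv

theorem freeEquiv_map {b : ℕ} (v : Fin b → MvPolynomial (Fin r) A) :
    freeEquiv k b (fun j => MvPolynomial.map (algebraMap A k) (v j)) = of A r k _ v := by
  rw [freeEquiv_apply, Fintype.linearCombination_apply]
  simp only [← of_smul]
  rw [← map_sum]
  congr 1
  conv_rhs => rw [← Finset.univ_sum_single v]
  refine Finset.sum_congr rfl fun j _ => ?_
  rw [← Pi.single_smul, smul_eq_mul, mul_one]

theorem component_free {b : ℕ} (e : Fin b → ℤ) (n : ℤ) :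
    component (polyFreeComponent A d e) k n =
      (polyFreeComponent k d e n).map ((freeEquiv (A := A) k b).toLinearMap.restrictScalars k) :=
  (isPolyGrading k (isPolyGrading_free d e)).eq_map (freeEquiv k b).surjective
    (fun _ _ hv => freeEquiv_mem k e _ hv) n

theorem exists_finrank_polyFreeComponent [IsNoetherianRing A] [IsReduced A] {q : Ideal A}
    (hq : q ∈ minimalPrimes A) (hd : ∀ i, 0 < d i) {b : ℕ} (e : Fin b → ℤ) :
    ∃ a, IsGoodAt q a ∧ ∃ ρ : ℤ → ℕ, ∀ (k : Type*) [Field k] [Algebra A k], algebraMap A k a ≠ 0 →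
      ∀ n, Module.finrank k (polyFreeComponent k d e n) = ρ n := by
  obtain ⟨a, ha, ρ, hρ⟩ := exists_finrank_component hq hd (isPolyGrading_free (A := A) d e)
  refine ⟨a, ha, ρ, fun k _ _ hk n => ?_⟩
  rw [← hρ k hk n, component_free]
  exact (((freeEquiv (A := A) k b).restrictScalars k).finrank_map_eq _).symm

end PolyFiber

/-! ### Constancy of the dimensions of the graded duals. -/

section DualRank

variable {A : Type*} [CommRing A] {r : ℕ} {d : Fin r → ℕ}

theorem map_mem_polyComponent {k : Type*} [CommRing k] [Algebra A k] {n : ℤ}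
    {u : MvPolynomial (Fin r) A} (hu : u ∈ polyComponent A d n) :
    MvPolynomial.map (algebraMap A k) u ∈ polyComponent k d n := fun α hα =>
  hu fun h => hα (by rw [MvPolynomial.coeff_map, h, map_zero])

theorem mulVec_mem_polyFreeComponent {b c : ℕ} {e : Fin b → ℤ} {e' : Fin c → ℤ}
    {M : Matrix (Fin c) (Fin b) (MvPolynomial (Fin r) A)}
    (hM : ∀ j i, M j i ∈ polyComponent A d (e i - e' j)) {n : ℤ}
    {v : Fin b → MvPolynomial (Fin r) A} (hv : v ∈ polyFreeComponent A d e n) :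
    M.mulVecLin v ∈ polyFreeComponent A d e' n := by
  refine (mem_polyFreeComponent d).2 fun j => ?_
  change ∑ i, M j i * v i ∈ polyComponent A d (n - e' j)
  refine sum_mem fun i _ => ?_
  have h1 := MvPolynomial.IsWeightedHomogeneous.mul (hM j i) ((mem_polyFreeComponent d).1 hv i)
  have h2 : e i - e' j + (n - e i) = n - e' j := by ring
  rw [h2] at h1
  exact h1

/-- A dimension count for the kernel of a graded matrix and the base change of its cokernel. -/
theorem finrank_ker_mulVec (hd : ∀ i, 0 < d i) {b c : ℕ} {e : Fin b → ℤ} {e' : Fin c → ℤ}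
    {M : Matrix (Fin c) (Fin b) (MvPolynomial (Fin r) A)}
    (hM : ∀ j i, M j i ∈ polyComponent A d (e i - e' j)) (k : Type*) [Field k] [Algebra A k]
    (n : ℤ) {K : Submodule k (Fin b → MvPolynomial (Fin r) k)}
    (hK : ∀ v, v ∈ K ↔ v ∈ polyFreeComponent k d e n ∧
      (M.map (MvPolynomial.map (algebraMap A k))).mulVecLin v = 0) :
    Module.finrank k K + Module.finrank k (polyFreeComponent k d e' n) =
      Module.finrank k (polyFreeComponent k d e n) + Module.finrank k (PolyFiber.component (r := r)
        (fun n => (polyFreeComponent A d e' n).map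
          ((LinearMap.range M.mulVecLin).mkQ.restrictScalars A)) k n) := by
  have hfin0 := polyFreeComponent_finite (A := k) hd e n
  have hfin1 := polyFreeComponent_finite (A := k) hd e' n
  let Mk := M.map (MvPolynomial.map (algebraMap A k))
  have hMk : ∀ j i, Mk j i ∈ polyComponent k d (e i - e' j) := fun j i =>
    map_mem_polyComponent (hM j i)
  obtain ⟨pC, hC⟩ := (isPolyGrading_free d e).cokernel (isPolyGrading_free d e') M.mulVecLin
    (fun n v hv => mulVec_mem_polyFreeComponent hM hv)
  let θ : (Fin c → MvPolynomial (Fin r) k) →ₗ[MvPolynomial (Fin r) k]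
      PolyFiber A r k ((Fin c → MvPolynomial (Fin r) A) ⧸ LinearMap.range M.mulVecLin) :=
    PolyFiber.map k (LinearMap.range M.mulVecLin).mkQ ∘ₗ (PolyFiber.freeEquiv k c).toLinearMap
  have hθs : Function.Surjective θ :=
    (PolyFiber.map_surjective k (Submodule.mkQ_surjective _)).comp (PolyFiber.freeEquiv k c).surjective
  have hcomm : (PolyFiber.freeEquiv k c).toLinearMap ∘ₗ Mk.mulVecLin =
      PolyFiber.map k M.mulVecLin ∘ₗ (PolyFiber.freeEquiv k b).toLinearMap := by
    refine LinearMap.pi_ext' fun i => LinearMap.ext_ring ?_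
    simp only [LinearMap.comp_apply, LinearMap.single_apply, LinearEquiv.coe_coe,
      PolyFiber.freeEquiv_single, PolyFiber.map_of]
    rw [← PolyFiber.freeEquiv_map]
    congr 1
    funext j
    simp [Mk]
  have hθker : ∀ v, θ v = 0 ↔ ∃ u, Mk.mulVecLin u = v := by
    intro v
    have h1 := PolyFiber.map_exact k (f := M.mulVecLin) (g := (LinearMap.range M.mulVecLin).mkQ)
      (LinearMap.exact_map_mkQ_range _) (Submodule.mkQ_surjective _)
    refine (h1 _).trans ⟨?_, ?_⟩
    · rintro ⟨w, hw⟩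
      obtain ⟨u, rfl⟩ := (PolyFiber.freeEquiv k b).surjective w
      refine ⟨u, (PolyFiber.freeEquiv (A := A) k c).injective ?_⟩
      exact (LinearMap.congr_fun hcomm u).trans hw
    · rintro ⟨u, rfl⟩
      exact ⟨PolyFiber.freeEquiv (A := A) k b u, (LinearMap.congr_fun hcomm u).symm⟩
  let 𝒞 := fun n => (polyFreeComponent A d e' n).map
    ((LinearMap.range M.mulVecLin).mkQ.restrictScalars A)
  have hθm : ∀ n, ∀ v ∈ polyFreeComponent k d e' n, θ v ∈ PolyFiber.component (r := r) 𝒞 k n :=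
    fun n v hv => PolyFiber.map_mem_component (𝒴 := polyFreeComponent A d e') (𝒴' := 𝒞) k _
      (fun n v hv => ⟨v, hv, rfl⟩) n (PolyFiber.freeEquiv_mem k e' n hv)
  rw [(PolyFiber.isPolyGrading k hC).eq_map hθs hθm n]
  let ψ' : polyFreeComponent k d e n →ₗ[k] (Fin c → MvPolynomial (Fin r) k) :=
    (Mk.mulVecLin.restrictScalars k).domRestrict _
  let θ' := (θ.restrictScalars k).domRestrict (polyFreeComponent k d e' n)
  have hψ := LinearMap.finrank_range_add_finrank_ker ψ'
  have hθ := LinearMap.finrank_range_add_finrank_ker θ'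
  have hK' : K = (LinearMap.ker ψ').map (polyFreeComponent k d e n).subtype := by
    ext v
    rw [hK]
    constructor
    · rintro ⟨hv, hv'⟩
      exact ⟨⟨v, hv⟩, hv', rfl⟩
    · rintro ⟨⟨v, hv⟩, hv', rfl⟩
      exact ⟨hv, hv'⟩
  -- The kernel of the cokernel map in degree n is the degree-n part of the image of the matrix: a
  -- preimage may be replaced by its projection to degree n. Two rank-nullity counts are then glued
  -- along this space.
  have hr : (LinearMap.ker θ').map (polyFreeComponent k d e' n).subtype = LinearMap.range ψ' := by
    ext v
    constructor
    · rintro ⟨⟨v, hv⟩, hv', rfl⟩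
      obtain ⟨u, hu⟩ := (hθker v).1 hv'
      refine ⟨⟨_, (isPolyGrading_free d e).proj.mem n u⟩, ?_⟩
      refine ((isPolyGrading_free d e).proj.map_apply (isPolyGrading_free d e').proj
        Mk.mulVecLin.toAddMonoidHom (fun n v hv => mulVec_mem_polyFreeComponent hMk hv) n u).trans ?_
      refine (congrArg _ hu).trans ?_
      exact (isPolyGrading_free d e').proj.eq_self n v hv
    · rintro ⟨⟨u, hu⟩, rfl⟩
      exact ⟨⟨_, mulVec_mem_polyFreeComponent hMk hu⟩, (hθker _).2 ⟨u, rfl⟩, rfl⟩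
  have hrθ : LinearMap.range θ' =
      (polyFreeComponent k d e' n).map (θ.restrictScalars k) := LinearMap.range_domRestrict _ _
  rw [hK', Submodule.finrank_map_subtype_eq, ← hrθ]
  rw [← hr, Submodule.finrank_map_subtype_eq] at hψ
  omega

variable {Y : Type*} [AddCommGroup Y] [Module A Y]
  [Module (MvPolynomial (Fin r) A) Y] [IsScalarTower A (MvPolynomial (Fin r) A) Y]
  {𝒴 : ℤ → Submodule A Y} {p : ℤ → Y →ₗ[A] Y}

/-- The homomorphisms of degree `m` from the base change of `Y` to `k[X]` in terms of a graded
presentation of `Y`. -/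
theorem exists_gradedDual_range (h : IsPolyGrading d 𝒴 p) {b c : ℕ} {e : Fin b → ℤ}
    {π : (Fin b → MvPolynomial (Fin r) A) →ₗ[MvPolynomial (Fin r) A] Y}
    (hπ : Function.Surjective π) (hπ' : ∀ n, ∀ v ∈ polyFreeComponent A d e n, π v ∈ 𝒴 n)
    {M : Matrix (Fin c) (Fin b) (MvPolynomial (Fin r) A)}
    (hM : ∀ u, π u = 0 ↔ ∃ w, u = M.vecMul w) (k : Type*) [Field k] [Algebra A k] (m : ℤ) :
    ∃ ev : gradedDual d (PolyFiber.component (r := r) 𝒴 k) m →ₗ[k] (Fin b → MvPolynomial (Fin r) k),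
      Function.Injective ev ∧ ∀ v, v ∈ LinearMap.range ev ↔
        v ∈ polyFreeComponent k d (fun i => - e i) m ∧
          (M.map (MvPolynomial.map (algebraMap A k))).mulVecLin v = 0 := by
  let φ := MvPolynomial.map (σ := Fin r) (algebraMap A k)
  let of := PolyFiber.of A r k Y
  let ev : gradedDual d (PolyFiber.component (r := r) 𝒴 k) m →ₗ[k]
      (Fin b → MvPolynomial (Fin r) k) :=
    -- A homomorphism is recorded by its values on the generators; the admissible vectors are those
    -- killed by the relations.
    { toFun := fun f i => f.1 (of (π (Pi.single i 1)))
      map_add' := fun _ _ => rfl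
      map_smul' := fun _ _ => rfl }
  have hevi : ∀ f i, ev f i = f.1 (of (π (Pi.single i 1))) := fun _ _ => rfl
  have hsum : ∀ (f : PolyFiber A r k Y →ₗ[MvPolynomial (Fin r) k] MvPolynomial (Fin r) k) u,
      f (of (π u)) = ∑ i, φ (u i) * f (of (π (Pi.single i 1))) := by
    intro f u
    conv_lhs => rw [← Finset.univ_sum_single u]
    rw [map_sum, map_sum, map_sum]
    refine Finset.sum_congr rfl fun i _ => ?_
    have h1 : (Pi.single i (u i) : Fin b → MvPolynomial (Fin r) A) = u i • Pi.single i 1 := by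
      rw [← Pi.single_smul, smul_eq_mul, mul_one]
    rw [h1, map_smul, PolyFiber.of_smul, map_smul, smul_eq_mul]
  refine ⟨ev, fun f g hfg => Subtype.ext (PolyFiber.hom_ext k fun y => ?_), fun v => ⟨?_, ?_⟩⟩
  · obtain ⟨u, rfl⟩ := hπ y
    refine (hsum _ _).trans (Eq.trans ?_ (hsum _ _).symm)
    exact Finset.sum_congr rfl fun i _ => congrArg _ (congrFun hfg i)
  · rintro ⟨f, rfl⟩
    refine ⟨(mem_polyFreeComponent d).2 fun i => ?_, ?_⟩
    · have h1 := f.2 (e i) (of (π (Pi.single i 1))) (PolyFiber.of_mem_component k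
        (hπ' _ _ (PolyFiber.single_mem_polyFreeComponent e i)))
      have h2 : m - -e i = e i + m := by ring
      rw [h2]
      exact h1
    · funext j
      have h1 : π (M j) = 0 := (hM _).2 ⟨Pi.single j 1, by simp; rfl⟩
      have h2 := hsum f.1 (M j)
      rw [h1, map_zero, map_zero] at h2
      exact h2.symm
  · rintro ⟨hv, hv'⟩
    let F : (Fin b → MvPolynomial (Fin r) A) →+ MvPolynomial (Fin r) k :=
      AddMonoidHom.mk' (fun u => ∑ i, φ (u i) * v i) fun u u' => by
        simp only [Pi.add_apply, map_add, add_mul, Finset.sum_add_distrib]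
    have hF0 : ∀ u, π u = 0 → F u = 0 := by
      intro u hu
      obtain ⟨w, rfl⟩ := (hM u).1 hu
      change ∑ i, φ (∑ j, w j * M j i) * v i = 0
      simp only [map_sum, map_mul, Finset.sum_mul]
      rw [Finset.sum_comm]
      refine Finset.sum_eq_zero fun j _ => ?_
      have h1 : ∑ i, φ (M j i) * v i = 0 := congrFun hv' j
      simp only [mul_assoc]
      rw [← Finset.mul_sum, h1, mul_zero]
    choose s hs using hπ
    have hFs : ∀ u, F (s (π u)) = F u := fun u => by
      rw [← sub_eq_zero, ← map_sub]
      exact hF0 _ (by rw [map_sub, hs, sub_self])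
    let f₀ : Y →+ MvPolynomial (Fin r) k := AddMonoidHom.mk' (fun y => F (s y)) fun y y' => by
      have h1 : y + y' = π (s y + s y') := by rw [map_add, hs, hs]
      rw [h1, hFs, map_add]
    obtain ⟨g, hg⟩ := PolyFiber.exists_lift k f₀ (fun (q : MvPolynomial (Fin r) A) y => by
      have h1 : q • y = π (q • s y) := by rw [map_smul, hs]
      change F (s _) = _ • F (s y)
      rw [h1, hFs]
      change ∑ i, φ (q * s y i) * v i = φ q * ∑ i, φ (s y i) * v i
      simp only [map_mul, mul_assoc, Finset.mul_sum])
    have hgπ : ∀ u, g (of (π u)) = F u := fun u => (hg _).trans (hFs u)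
    have hgm : g ∈ gradedDual d (PolyFiber.component (r := r) 𝒴 k) m := by
      intro a z hz
      have h1 : PolyFiber.component 𝒴 k a ≤
          (polyComponent k d (a + m)).comap (g.restrictScalars k) := by
        rw [PolyFiber.component, Submodule.span_le]
        rintro _ ⟨y, hy, rfl⟩
        rw [h.eq_map (fun y => ⟨s y, hs y⟩) hπ' a] at hy
        obtain ⟨u, hu, rfl⟩ := hy
        change g (of (π u)) ∈ polyComponent k d (a + m)
        rw [hgπ]
        change ∑ i, φ (u i) * v i ∈ polyComponent k d (a + m)
        refine sum_mem fun i _ => ?_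
        have h1 := MvPolynomial.IsWeightedHomogeneous.mul
          (map_mem_polyComponent (k := k) ((mem_polyFreeComponent d).1 hu i))
          ((mem_polyFreeComponent d).1 hv i)
        have h2 : a - e i + (m - -e i) = a + m := by ring
        rw [h2] at h1
        exact h1
      exact h1 hz
    refine ⟨⟨g, hgm⟩, funext fun i => ?_⟩
    rw [hevi, hgπ]
    change ∑ j, φ ((Pi.single i 1 : Fin b → MvPolynomial (Fin r) A) j) * v j = v i
    rw [Finset.sum_eq_single i]
    · simp
    · intro j _ hj
      rw [Pi.single_eq_of_ne hj, map_zero, zero_mul]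
    · simp

/-- Hom does not commute with base change, but it is the kernel of a matrix on free modules, and the
cokernel of that matrix does commute. The dimension of the kernel is thus determined by those of two
free modules and of the fibre of one finitely generated graded module. -/
theorem exists_finrank_gradedDual [IsNoetherianRing A] [IsReduced A] {q : Ideal A}
    (hq : q ∈ minimalPrimes A) (hd : ∀ i, 0 < d i) (h : IsPolyGrading d 𝒴 p)
    [Module.Finite (MvPolynomial (Fin r) A) Y] :
    ∃ a, IsGoodAt q a ∧ ∃ ρ : ℤ → ℕ, ∀ (k : Type*) [Field k] [Algebra A k], algebraMap A k a ≠ 0 →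
      ∀ n, Module.Finite k (gradedDual d (PolyFiber.component (r := r) 𝒴 k) n) ∧
        Module.finrank k (gradedDual d (PolyFiber.component (r := r) 𝒴 k) n) = ρ n := by
  have hqp : q.IsPrime := hq.1.1
  obtain ⟨b, e, π, hπ, hπ'⟩ := h.exists_presentation
  obtain ⟨pZ, hZ⟩ := (isPolyGrading_free d e).kernel h π hπ'
  have : Module.Finite (MvPolynomial (Fin r) A) (LinearMap.ker π) := inferInstance
  obtain ⟨c, e', π', hs, hs'⟩ := hZ.exists_presentation
  -- The rows of M generate the relations among the chosen generators of Y. Acting on columns, M is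
  -- the transposed presentation, which is why the degree shifts change sign.
  let M : Matrix (Fin c) (Fin b) (MvPolynomial (Fin r) A) := fun j => (π' (Pi.single j 1)).1
  have hM : ∀ u, π u = 0 ↔ ∃ w, u = M.vecMul w := by
    have h1 : ∀ w, M.vecMul w = (π' w).1 := by
      intro w
      conv_rhs => rw [← Finset.univ_sum_single w]
      rw [map_sum, AddSubmonoidClass.coe_finsetSum]
      funext i
      rw [Finset.sum_apply]
      change ∑ j, w j * M j i = _
      refine Finset.sum_congr rfl fun j _ => ?_
      have h1 : (Pi.single j (w j) : Fin c → MvPolynomial (Fin r) A) = w j • Pi.single j 1 := by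
        rw [← Pi.single_smul, smul_eq_mul, mul_one]
      rw [h1, map_smul]
      rfl
    intro u
    constructor
    · intro hu
      obtain ⟨w, hw⟩ := hs ⟨u, hu⟩
      exact ⟨w, by rw [h1, hw]⟩
    · rintro ⟨w, rfl⟩
      rw [h1]
      exact (π' w).2
  have hMd : ∀ j i, M j i ∈ polyComponent A d (-e i - -e' j) := fun j i => by
    have h1 := (mem_polyFreeComponent d).1
      (hs' _ _ (PolyFiber.single_mem_polyFreeComponent e' j)) i
    have h2 : -e i - -e' j = e' j - e i := by ring
    rw [h2]
    exact h1
  obtain ⟨pC, hC⟩ := (isPolyGrading_free d _).cokernel (isPolyGrading_free d _) M.mulVecLin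
    (fun n v hv => mulVec_mem_polyFreeComponent hMd hv)
  obtain ⟨a₀, ha₀, ρ₀, hρ₀⟩ := PolyFiber.exists_finrank_polyFreeComponent hq hd (fun i => -e i)
  obtain ⟨a₁, ha₁, ρ₁, hρ₁⟩ := PolyFiber.exists_finrank_polyFreeComponent hq hd (fun i => -e' i)
  obtain ⟨a₂, ha₂, ρ₂, hρ₂⟩ := PolyFiber.exists_finrank_component hq hd hC
  -- The subtraction is harmless: the dimension count gives `dim + ρ₁ n = ρ₀ n + ρ₂ n`.
  refine ⟨a₀ * a₁ * a₂, (ha₀.mul ha₁.1).mul ha₂.1, fun n => ρ₀ n + ρ₂ n - ρ₁ n, fun k _ _ hk n => ?_⟩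
  rw [map_mul, map_mul] at hk
  obtain ⟨ev, hev, hev'⟩ := exists_gradedDual_range h hπ hπ' hM k n
  have h1 := finrank_ker_mulVec hd hMd k n hev'
  rw [hρ₀ k (left_ne_zero_of_mul (left_ne_zero_of_mul hk)),
    hρ₁ k (right_ne_zero_of_mul (left_ne_zero_of_mul hk)), hρ₂ k (right_ne_zero_of_mul hk),
    LinearMap.finrank_range_of_inj hev] at h1
  refine ⟨?_, by
    change _ = ρ₀ n + ρ₂ n - ρ₁ n
    omega⟩
  have hfin := polyFreeComponent_finite (A := k) hd (fun i => -e i) n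
  let ev' := ev.codRestrict (polyFreeComponent k d (fun i => -e i) n) fun f => ((hev' _).1 ⟨f, rfl⟩).1
  exact Module.Finite.of_injective ev' fun f g hfg => hev (congrArg Subtype.val hfg)

end DualRank

/-! ### Transport of vanishing along graded isomorphisms. -/

section Transfer

variable {B N B' N' : Type*} [CommRing B] [AddCommGroup N] [Module B N] [CommRing B']
  [AddCommGroup N'] [Module B' N'] {r : ℕ} {x : Fin r → B} {x' : Fin r → B'} {d : Fin r → ℕ}
  {𝒩 : ℤ → AddSubgroup N} {𝒩' : ℤ → AddSubgroup N'}

theorem IsHomogeneousAction.of_addEquiv (h : IsHomogeneousAction x d 𝒩) (φ : N ≃+ N')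
    (hφ : ∀ i m, φ (x i • m) = x' i • φ m) (hmem : ∀ n m, φ m ∈ 𝒩' n ↔ m ∈ 𝒩 n) :
    IsHomogeneousAction x' d 𝒩' := by
  intro i n m hm
  obtain ⟨m, rfl⟩ := φ.surjective m
  rw [← hφ, hmem]
  exact h i n m ((hmem n m).1 hm)

/-- An isomorphism is a short exact sequence with zero kernel, so the long exact sequence applies;
the zero module is taken over ℤ with all elements `y` equal to 0. -/
theorem CechVanishes.of_addEquiv (h : IsHomogeneousAction x d 𝒩) (φ : N ≃+ N')
    (hφ : ∀ i m, φ (x i • m) = x' i • φ m) (hmem : ∀ n m, φ m ∈ 𝒩' n ↔ m ∈ 𝒩 n) {i : ℕ} {n : ℤ}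
    (hv : CechVanishes x d 𝒩 i n) : CechVanishes x' d 𝒩' i n := by
  let y : Fin r → ℤ := fun _ => 0
  have hex : IsCechExact y x x' d (fun _ => (⊤ : AddSubgroup PUnit)) 𝒩 𝒩'
      (0 : PUnit →+ N) φ.toAddMonoidHom :=
    { hom₁ := .top
      hom₂ := h
      hom₃ := h.of_addEquiv φ hφ hmem
      map_smul_left := fun i m => by simp
      map_smul_right := hφ
      injective := fun _ _ _ => rfl
      map_mem_left := fun n m _ => zero_mem _
      map_mem_right := fun n m hm => (hmem n m).2 hm
      comp_eq_zero := fun _ => map_zero φ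
      exists_of_eq_zero := fun n m _ hm0 =>
        ⟨0, AddSubgroup.mem_top _, (φ.map_eq_zero_iff.1 hm0).symm⟩
      exists_preimage := fun n m hm => ⟨φ.symm m, (hmem n _).1 (by rwa [φ.apply_symm_apply]),
        φ.apply_symm_apply m⟩ }
  refine hex.vanishes_right hv fun c hc _ => ?_
  have hc0 : c = 0 := by
    funext I
    obtain ⟨t, m, hm⟩ := exists_cechFrac (c I)
    rw [hm, Subsingleton.elim m 0, map_zero]
    rfl
  rw [hc0]
  exact zero_mem _

theorem cechVanishes_iff_of_addEquiv (h : IsHomogeneousAction x d 𝒩) (φ : N ≃+ N')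
    (hφ : ∀ i m, φ (x i • m) = x' i • φ m) (hmem : ∀ n m, φ m ∈ 𝒩' n ↔ m ∈ 𝒩 n) {i : ℕ} {n : ℤ} :
    CechVanishes x d 𝒩 i n ↔ CechVanishes x' d 𝒩' i n :=
  ⟨.of_addEquiv h φ hφ hmem, .of_addEquiv (h.of_addEquiv φ hφ hmem) φ.symm
    (fun i m => by rw [AddEquiv.symm_apply_eq, hφ, φ.apply_symm_apply])
    (fun n m => by rw [← hmem, φ.apply_symm_apply])⟩

end Transfer

/-! ### The top cohomology of a single module. -/

section TopDegree

variable {k : Type*} [Field k] {r : ℕ} {d : Fin r → ℕ}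
  {N : Type*} [AddCommGroup N] [Module k N] [Module (MvPolynomial (Fin r) k) N]
  [IsScalarTower k (MvPolynomial (Fin r) k) N] {𝒩 : ℤ → Submodule k N} {p : ℤ → N →ₗ[k] N}

omit [IsScalarTower k (MvPolynomial (Fin r) k) N] in
theorem cechDifferential_eq_zero_of_mem {n : ℤ} (h : IsPolyGrading d 𝒩 p)
    {c : (I : Finset (Fin r)) → CechLocalization N
      (MvPolynomial.X : Fin r → MvPolynomial (Fin r) k) I}
    (hc : c ∈ cechCochains MvPolynomial.X d (fun n => (𝒩 n).toAddSubgroup) r n) :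
    cechDifferential N MvPolynomial.X c = 0 := by
  have h1 := cechDifferential_mem h.hom hc
  funext I
  refine (mem_cechCochains.1 h1).2 I ?_
  have := Finset.card_le_univ I
  rw [Fintype.card_fin] at this
  omega

/-- Apply the duality to the map from N to the free module of rank zero: injectivity becomes
vanishing of the cohomology, surjectivity becomes vanishing of the dual. -/
theorem cechVanishes_top_degree_iff (hd : ∀ i, 0 < d i) (h : IsPolyGrading d 𝒩 p) (e : ℤ) :
    CechVanishes (MvPolynomial.X : Fin r → MvPolynomial (Fin r) k) d
      (fun n => (𝒩 n).toAddSubgroup) r (-e - ∑ i, (d i : ℤ)) ↔ gradedDual d 𝒩 e = ⊥ := by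
  let f : N →ₗ[MvPolynomial (Fin r) k] (Fin 0 → MvPolynomial (Fin r) k) := 0
  have h1 := top_injective_iff_gradedDual_surjective hd h (isPolyGrading_free (A := k) d Fin.elim0)
    f (fun n y _ => zero_mem _) (fun i m => Subsingleton.elim _ _) e
  have h2 : ∀ c, cechMap f.toAddMonoidHom (x := (MvPolynomial.X : Fin r → MvPolynomial (Fin r) k))
      (x' := (MvPolynomial.X : Fin r → MvPolynomial (Fin r) k))
      (fun i m => Subsingleton.elim _ _) c = 0 := by
    intro c
    funext I
    obtain ⟨t, m, hm⟩ := exists_cechFrac (c I)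
    rw [cechMap_apply, hm, cechLocalizationMap_cechFrac]
    exact map_zero _
  refine Iff.trans ⟨fun hv c hc _ => hv c hc (cechDifferential_eq_zero_of_mem h hc), fun hv c hc _ =>
    hv c hc (by rw [h2]; exact zero_mem _)⟩ (h1.trans ?_)
  rw [Submodule.eq_bot_iff]
  refine forall₂_congr fun g _ => ⟨?_, ?_⟩
  · rintro ⟨h', _, rfl⟩
    exact LinearMap.comp_zero _
  · rintro rfl
    exact ⟨0, zero_mem _, LinearMap.zero_comp _⟩

end TopDegree

theorem range_eq_top_iff_finrank_add {k U V W : Type*} [Field k] [AddCommGroup U] [Module k U]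
    [AddCommGroup V] [Module k V] [AddCommGroup W] [Module k W] [Module.Finite k V]
    [Module.Finite k W] (f : U →ₗ[k] V) (g : V →ₗ[k] W) (hf : Function.Injective f)
    (hfg : LinearMap.range f = LinearMap.ker g) : LinearMap.range g = ⊤ ↔
      Module.finrank k W + Module.finrank k U = Module.finrank k V := by
  have h := LinearMap.finrank_range_add_finrank_ker g
  rw [← hfg, LinearMap.finrank_range_of_inj hf] at h
  constructor
  · intro hg
    rw [hg, finrank_top] at h
    exact h
  · intro hg
    exact Submodule.eq_top_of_finrank_eq (by omega)

namespace PolyFiber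

variable {A : Type*} [CommRing A] {r : ℕ} {d : Fin r → ℕ}
  {Z : Type*} [AddCommGroup Z] [Module A Z] [Module (MvPolynomial (Fin r) A) Z]
  [IsScalarTower A (MvPolynomial (Fin r) A) Z]
  {G : Type*} [AddCommGroup G] [Module A G] [Module (MvPolynomial (Fin r) A) G]
  [IsScalarTower A (MvPolynomial (Fin r) A) G]
  {Y : Type*} [AddCommGroup Y] [Module A Y] [Module (MvPolynomial (Fin r) A) Y]
  [IsScalarTower A (MvPolynomial (Fin r) A) Y]
  {𝒵 : ℤ → Submodule A Z} {pZ : ℤ → Z →ₗ[A] Z} {𝒢 : ℤ → Submodule A G} {pG : ℤ → G →ₗ[A] G}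
  {𝒴 : ℤ → Submodule A Y} {pY : ℤ → Y →ₗ[A] Y}

theorem equiv_map (k : Type*) [CommRing k] [Algebra A k] (f : Z →ₗ[MvPolynomial (Fin r) A] G)
    (z : PolyFiber A r k Z) :
    equiv A r G k (map k f z) = (f.restrictScalars A).baseChange k (equiv A r Z k z) := by
  induction z using induction with
  | of y => simp
  | smul c z h => rw [LinearMap.map_smul_of_tower, map_smul, h, map_smul, map_smul]
  | add z z' h h' => simp only [map_add, h, h']

theorem map_injective {a : A} (k : Type*) [CommRing k] [Algebra A k] (ha : IsUnit (algebraMap A k a))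
    (hflat : FlatAway a Y) {f : Z →ₗ[MvPolynomial (Fin r) A] G} {g : G →ₗ[MvPolynomial (Fin r) A] Y}
    (hf : Function.Injective f) (hfg : Function.Exact f g) (hg : Function.Surjective g) :
    Function.Injective (map k f) := by
  have h1 := hflat.lTensor_injective (f.restrictScalars A) (g.restrictScalars A) hf hg hfg k ha
  intro z z' h
  apply (equiv A r Z k).injective
  apply h1
  have h2 := congrArg (equiv A r G k) h
  rw [equiv_map, equiv_map] at h2
  exact h2

/-- Flatness of Y keeps the left end injective. Homogeneous preimages exist because any preimage can
be projected to the right degree. -/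
theorem isCechExact {a : A} (k : Type*) [CommRing k] [Algebra A k] (ha : IsUnit (algebraMap A k a))
    (hflat : FlatAway a Y) (hZ : IsPolyGrading d 𝒵 pZ) (hG : IsPolyGrading d 𝒢 pG)
    (hY : IsPolyGrading d 𝒴 pY) {f : Z →ₗ[MvPolynomial (Fin r) A] G}
    {g : G →ₗ[MvPolynomial (Fin r) A] Y} (hfm : ∀ n, ∀ z ∈ 𝒵 n, f z ∈ 𝒢 n)
    (hgm : ∀ n, ∀ z ∈ 𝒢 n, g z ∈ 𝒴 n) (hf : Function.Injective f) (hfg : Function.Exact f g)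
    (hg : Function.Surjective g) :
    IsCechExact (MvPolynomial.X : Fin r → MvPolynomial (Fin r) k)
      (MvPolynomial.X : Fin r → MvPolynomial (Fin r) k)
      (MvPolynomial.X : Fin r → MvPolynomial (Fin r) k) d
      (fun n => (component (r := r) 𝒵 k n).toAddSubgroup) (fun n => (component (r := r) 𝒢 k n).toAddSubgroup)
      (fun n => (component (r := r) 𝒴 k n).toAddSubgroup) (map k f).toAddMonoidHom
      (map k g).toAddMonoidHom where
  hom₁ := (isPolyGrading k hZ).hom
  hom₂ := (isPolyGrading k hG).hom
  hom₃ := (isPolyGrading k hY).hom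
  map_smul_left i m := map_smul (map k f) _ m
  map_smul_right i m := map_smul (map k g) _ m
  injective := map_injective k ha hflat hf hfg hg
  map_mem_left n z hz := map_mem_component k f hfm n hz
  map_mem_right n z hz := map_mem_component k g hgm n hz
  comp_eq_zero z := (map_exact k hfg hg _).2 ⟨z, rfl⟩
  exists_of_eq_zero n z hz h := by
    obtain ⟨w, hw⟩ := (map_exact k hfg hg _).1 h
    refine ⟨_, (isPolyGrading k hZ).proj.mem n w, ?_⟩
    rw [(isPolyGrading k hZ).proj.map_apply (isPolyGrading k hG).proj (map k f).toAddMonoidHom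
      (fun n z hz => map_mem_component k f hfm n hz)]
    exact (congrArg _ hw).trans ((isPolyGrading k hG).proj.eq_self n z hz)
  exists_preimage n z hz := by
    obtain ⟨w, hw⟩ := map_surjective k hg z
    refine ⟨_, (isPolyGrading k hG).proj.mem n w, ?_⟩
    rw [(isPolyGrading k hG).proj.map_apply (isPolyGrading k hY).proj (map k g).toAddMonoidHom
      (fun n z hz => map_mem_component k g hgm n hz)]
    exact (congrArg _ hw).trans ((isPolyGrading k hY).proj.eq_self n z hz)

theorem cechVanishes_free (k : Type*) [CommRing k] [Algebra A k] {b : ℕ} (e : Fin b → ℤ) {i : ℕ}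
    (hi : i < r) (n : ℤ) : CechVanishes (MvPolynomial.X : Fin r → MvPolynomial (Fin r) k) d
      (fun n => (component (r := r) (polyFreeComponent A d e) k n).toAddSubgroup) i n := by
  refine (cechVanishes_polyFree e hi n).of_addEquiv (isPolyGrading_free d e).hom
    (freeEquiv (A := A) k b).toAddEquiv (fun i m => map_smul (freeEquiv k b) _ m) fun n m => ?_
  change freeEquiv k b m ∈ component (r := r) (polyFreeComponent A d e) k n ↔ m ∈ polyFreeComponent k d e n
  rw [component_free]
  constructor
  · rintro ⟨m', hm', h⟩
    exact (freeEquiv (A := A) k b).injective h ▸ hm'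
  · exact fun hm => ⟨m, hm, rfl⟩

/-- The dimension count deciding the surjectivity of the restriction of homomorphisms of degree
`m` to a submodule. -/
theorem gradedDual_surjective_iff {a : A} (k : Type*) [Field k] [Algebra A k]
    (ha : IsUnit (algebraMap A k a))
    (hflat : FlatAway a Y) (hZ : IsPolyGrading d 𝒵 pZ) (hG : IsPolyGrading d 𝒢 pG)
    (hY : IsPolyGrading d 𝒴 pY) {f : Z →ₗ[MvPolynomial (Fin r) A] G}
    {g : G →ₗ[MvPolynomial (Fin r) A] Y} (hfm : ∀ n, ∀ z ∈ 𝒵 n, f z ∈ 𝒢 n)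
    (hgm : ∀ n, ∀ z ∈ 𝒢 n, g z ∈ 𝒴 n) (hf : Function.Injective f) (hfg : Function.Exact f g)
    (hg : Function.Surjective g) (m : ℤ)
    (hfinZ : Module.Finite k (gradedDual d (component (r := r) 𝒵 k) m))
    (hfinG : Module.Finite k (gradedDual d (component (r := r) 𝒢 k) m)) :
    (∀ l ∈ gradedDual d (component (r := r) 𝒵 k) m, ∃ h ∈ gradedDual d (component (r := r) 𝒢 k) m,
      h ∘ₗ map k f = l) ↔
    Module.finrank k (gradedDual d (component (r := r) 𝒵 k) m) +
      Module.finrank k (gradedDual d (component (r := r) 𝒴 k) m) =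
      Module.finrank k (gradedDual d (component (r := r) 𝒢 k) m) := by
  have hex := isCechExact k ha hflat hZ hG hY hfm hgm hf hfg hg
  let L : gradedDual d (component (r := r) 𝒢 k) m →ₗ[k] gradedDual d (component (r := r) 𝒵 k) m :=
    { toFun := fun h => ⟨h.1 ∘ₗ map k f, fun a z hz => h.2 a _ (hex.map_mem_left a z hz)⟩
      map_add' := fun _ _ => rfl
      map_smul' := fun _ _ => rfl }
  let L' : gradedDual d (component (r := r) 𝒴 k) m →ₗ[k] gradedDual d (component (r := r) 𝒢 k) m :=
    { toFun := fun h => ⟨h.1 ∘ₗ map k g, fun a z hz => h.2 a _ (hex.map_mem_right a z hz)⟩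
      map_add' := fun _ _ => rfl
      map_smul' := fun _ _ => rfl }
  have hL' : Function.Injective L' := by
    intro h h' hh
    refine Subtype.ext (LinearMap.ext fun y => ?_)
    obtain ⟨w, rfl⟩ := map_surjective k hg y
    exact LinearMap.congr_fun (congrArg Subtype.val hh) w
  have hrange : LinearMap.range L' = LinearMap.ker L := by
    apply le_antisymm
    · rintro _ ⟨h, rfl⟩
      refine Subtype.ext (LinearMap.ext fun z => ?_)
      exact (congrArg h.1 (hex.comp_eq_zero z)).trans (map_zero _)
    · intro h hh
      -- A homomorphism vanishing on the image of Z factors through Y, by right exactness of base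
      -- change.
      have h1 : LinearMap.ker (map k g) ≤ LinearMap.ker h.1 := by
        intro w hw
        obtain ⟨z, rfl⟩ := (map_exact k hfg hg _).1 hw
        exact LinearMap.congr_fun (congrArg Subtype.val hh) z
      let l := (LinearMap.ker (map k g)).liftQ h.1 h1 ∘ₗ
        ((map k g).quotKerEquivOfSurjective (map_surjective k hg)).symm.toLinearMap
      have hl : ∀ w, l (map k g w) = h.1 w := by
        intro w
        have h2 : ((map k g).quotKerEquivOfSurjective (map_surjective k hg)).symm (map k g w) =
            Submodule.Quotient.mk w := by
          rw [LinearEquiv.symm_apply_eq]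
          rfl
        change (LinearMap.ker (map k g)).liftQ h.1 h1 (_) = _
        exact (congrArg _ h2).trans rfl
      refine ⟨⟨l, fun a y hy => ?_⟩, Subtype.ext (LinearMap.ext hl)⟩
      obtain ⟨w, hw, rfl⟩ := hex.exists_preimage a y hy
      have h3 := h.2 a w hw
      rw [← hl] at h3
      exact h3
  have h1 : (∀ l ∈ gradedDual d (component (r := r) 𝒵 k) m,
      ∃ h ∈ gradedDual d (component (r := r) 𝒢 k) m, h ∘ₗ map k f = l) ↔ LinearMap.range L = ⊤ := by
    rw [LinearMap.range_eq_top]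
    constructor
    · intro h l
      obtain ⟨h', hh', hh⟩ := h l.1 l.2
      exact ⟨⟨h', hh'⟩, Subtype.ext hh⟩
    · intro h l hl
      obtain ⟨h', hh⟩ := h ⟨l, hl⟩
      exact ⟨h'.1, h'.2, congrArg Subtype.val hh⟩
  rw [h1]
  exact range_eq_top_iff_finrank_add (k := k) (U := ↥(gradedDual d (component (r := r) 𝒴 k) m))
    (V := ↥(gradedDual d (component (r := r) 𝒢 k) m))
    (W := ↥(gradedDual d (component (r := r) 𝒵 k) m)) L' L hL' hrange

end PolyFiber

/-- The vanishing of the local cohomology of the fibres of a graded module in cohomological degree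
`i` is constant on a neighbourhood of the minimal prime `q`. -/
def HasConstantCohomology.{v} {A : Type*} [CommRing A] {r : ℕ} (q : Ideal A) (d : Fin r → ℕ)
    {Y : Type*} [AddCommGroup Y] [Module A Y] [Module (MvPolynomial (Fin r) A) Y]
    [IsScalarTower A (MvPolynomial (Fin r) A) Y] (𝒴 : ℤ → Submodule A Y) (i : ℕ) : Prop :=
  ∃ a, IsGoodAt q a ∧ ∃ c : ℤ → Prop, ∀ (k : Type v) [Field k] [Algebra A k], algebraMap A k a ≠ 0 →
    ∀ n, CechVanishes (MvPolynomial.X : Fin r → MvPolynomial (Fin r) k) d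
      (fun n => (PolyFiber.component (r := r) 𝒴 k n).toAddSubgroup) i n ↔ c n

/-! ### Generic constancy of the graded local cohomology of the fibres. -/

section Core

universe u v w

variable {A : Type u} [CommRing A] [IsNoetherianRing A] [IsReduced A] {q : Ideal A} {r : ℕ}
  {d : Fin r → ℕ} {Y : Type w} [AddCommGroup Y] [Module A Y]
  [Module (MvPolynomial (Fin r) A) Y] [IsScalarTower A (MvPolynomial (Fin r) A) Y]
  {𝒴 : ℤ → Submodule A Y} {p : ℤ → Y →ₗ[A] Y}

/-- For i + 1 < r a syzygy shifts the question one cohomological degree up. For i + 1 = r and i = r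
it becomes a question about dimensions of graded duals, and for i > r there are no cochains. -/
theorem IsPolyGrading.hasConstantCohomology_step (hq : q ∈ minimalPrimes A) (hd : ∀ i, 0 < d i)
    (h : IsPolyGrading d 𝒴 p) [Module.Finite (MvPolynomial (Fin r) A) Y] (i : ℕ)
    (ih : i + 1 < r → ∀ (Z : Type u) [AddCommGroup Z] [Module A Z] [Module (MvPolynomial (Fin r) A) Z]
      [IsScalarTower A (MvPolynomial (Fin r) A) Z] [Module.Finite (MvPolynomial (Fin r) A) Z]
      (𝒵 : ℤ → Submodule A Z) (pZ : ℤ → Z →ₗ[A] Z), IsPolyGrading d 𝒵 pZ →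
      HasConstantCohomology.{v} q d 𝒵 (i + 1)) : HasConstantCohomology.{v} q d 𝒴 i := by
  have hqp : q.IsPrime := hq.1.1
  rcases lt_trichotomy i r with hi | rfl | hi
  · obtain ⟨b, e, π, hπ, hπ'⟩ := h.exists_presentation
    obtain ⟨pZ, hZ⟩ := (isPolyGrading_free d e).kernel h π hπ'
    obtain ⟨a₁, ha₁⟩ := exists_isGoodAt hq
    obtain ⟨a₂, ha₂, hflat⟩ := genericallyFlat_mvPolynomial hq r Y
    have hexact : Function.Exact (LinearMap.ker π).subtype π := LinearMap.exact_subtype_ker_map π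
    rcases Nat.lt_or_ge (i + 1) r with hi' | hi'
    -- Both neighbouring cohomologies of the free module vanish, so H^i of Y and H^{i+1} of the
    -- syzygy vanish together.
    · obtain ⟨a₃, ha₃, c, hc⟩ := ih hi' _ _ pZ hZ
      refine ⟨a₁ * a₂ * a₃, (ha₁.mul ha₂).mul ha₃.1, c, fun k _ _ hk n => ?_⟩
      rw [map_mul, map_mul] at hk
      rw [← hc k (right_ne_zero_of_mul hk)]
      have hex := PolyFiber.isCechExact k
        (isUnit_iff_ne_zero.2 (right_ne_zero_of_mul (left_ne_zero_of_mul hk))) hflat hZ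
        (isPolyGrading_free d e) h (fun _ _ hz => hz) hπ' Subtype.val_injective hexact hπ
      refine ⟨fun hv => hex.vanishes_left (fun j hj => ?_) (PolyFiber.cechVanishes_free k e hi' n),
        fun hv => hex.vanishes_right (PolyFiber.cechVanishes_free k e hi n) hv⟩
      obtain rfl : j = i := by omega
      exact hv
    -- Now i = r - 1: vanishing means that the top cohomology of the syzygy injects into that of the
    -- free module, equivalently that an equality of dimensions of duals holds in degree -n - ∑ dᵢ.
    · obtain ⟨aZ, haZ, ρZ, hρZ⟩ := exists_finrank_gradedDual.{_, _, v} hq hd hZ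
      obtain ⟨aG, haG, ρG, hρG⟩ := exists_finrank_gradedDual.{_, _, v} hq hd
        (isPolyGrading_free (A := A) d e)
      obtain ⟨aY, haY, ρY, hρY⟩ := exists_finrank_gradedDual.{_, _, v} hq hd h
      refine ⟨a₁ * a₂ * aZ * aG * aY, (((ha₁.mul ha₂).mul haZ.1).mul haG.1).mul haY.1,
        fun n => ρZ (-n - ∑ i, (d i : ℤ)) + ρY (-n - ∑ i, (d i : ℤ)) = ρG (-n - ∑ i, (d i : ℤ)),
        fun k _ _ hk n => ?_⟩
      simp only [map_mul, mul_ne_zero_iff] at hk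
      obtain ⟨⟨⟨⟨-, hk₂⟩, hkZ⟩, hkG⟩, hkY⟩ := hk
      have hu := isUnit_iff_ne_zero.2 hk₂
      obtain rfl : r = i + 1 := by omega
      have hex := PolyFiber.isCechExact k hu hflat hZ
        (isPolyGrading_free d e) h (fun _ _ hz => hz) hπ' Subtype.val_injective hexact hπ
      have hfZ := hρZ k hkZ (-n - ∑ i, (d i : ℤ))
      have hfG := hρG k hkG (-n - ∑ i, (d i : ℤ))
      have h1 := PolyFiber.gradedDual_surjective_iff k hu hflat hZ
        (isPolyGrading_free d e) h (fun _ _ hz => hz) hπ' Subtype.val_injective hexact hπ _ hfZ.1 hfG.1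
      rw [hfZ.2, hfG.2, (hρY k hkY _).2, ← top_injective_iff_gradedDual_surjective hd
        (PolyFiber.isPolyGrading k hZ) (PolyFiber.isPolyGrading k (isPolyGrading_free d e)) _
        hex.map_mem_left hex.map_smul_left] at h1
      have hn : -(-n - ∑ i, (d i : ℤ)) - ∑ i, (d i : ℤ) = n := by ring
      rw [hn] at h1
      refine Iff.trans ?_ h1
      refine ⟨fun hv c _ hfc => hex.mem_coboundaries_left (fun j hj => ?_) hfc,
        fun hv => hex.vanishes_right_of_injective (PolyFiber.cechVanishes_free k e hi n)
          fun c hc _ hfc => hv c hc hfc⟩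
      obtain rfl : j = i := by omega
      exact hv
  · obtain ⟨a, ha, ρ, hρ⟩ := exists_finrank_gradedDual.{_, _, v} hq hd h
    refine ⟨a, ha, fun n => ρ (-n - ∑ i, (d i : ℤ)) = 0, fun k _ _ hk n => ?_⟩
    obtain ⟨hfin, hr⟩ := hρ k hk (-n - ∑ i, (d i : ℤ))
    have hn : -(-n - ∑ i, (d i : ℤ)) - ∑ i, (d i : ℤ) = n := by ring
    have h1 := cechVanishes_top_degree_iff hd (PolyFiber.isPolyGrading k h) (-n - ∑ i, (d i : ℤ))
    rw [hn] at h1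
    rw [h1]
    change _ ↔ ρ (-n - ∑ i, (d i : ℤ)) = 0
    rw [← hr, Submodule.finrank_eq_zero]
  · obtain ⟨a, ha⟩ := exists_isGoodAt hq
    exact ⟨a, ha, fun _ => True, fun k _ _ _ n => iff_of_true (cechVanishes_of_lt hi n) trivial⟩

/-- The local cohomology of the fibres of a finitely generated graded module has constant vanishing
behaviour near a minimal prime. -/
theorem IsPolyGrading.hasConstantCohomology (hq : q ∈ minimalPrimes A) (hd : ∀ i, 0 < d i)
    (h : IsPolyGrading d 𝒴 p) [Module.Finite (MvPolynomial (Fin r) A) Y] (i : ℕ) :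
    HasConstantCohomology.{v} q d 𝒴 i := by
  have key : ∀ j i, r ≤ i + j → ∀ (Z : Type u) [AddCommGroup Z] [Module A Z]
      [Module (MvPolynomial (Fin r) A) Z] [IsScalarTower A (MvPolynomial (Fin r) A) Z]
      [Module.Finite (MvPolynomial (Fin r) A) Z] (𝒵 : ℤ → Submodule A Z) (pZ : ℤ → Z →ₗ[A] Z),
      IsPolyGrading d 𝒵 pZ → HasConstantCohomology.{v} q d 𝒵 i := by
    intro j
    induction j with
    | zero =>
      intro i hi Z _ _ _ _ _ 𝒵 pZ hZ
      exact hZ.hasConstantCohomology_step hq hd i fun hi' => absurd hi (by omega)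
    | succ j ih =>
      intro i hi Z _ _ _ _ _ 𝒵 pZ hZ
      exact hZ.hasConstantCohomology_step hq hd i fun _ => ih (i + 1) (by omega)
  -- Syzygies are submodules of free modules and live in the universe of A, so the induction runs
  -- there; one further step reaches Y in its own universe.
  exact h.hasConstantCohomology_step hq hd i fun _ => key r (i + 1) (by omega)

theorem IsPolyGrading.exists_cechVanishes_iff (hq : q ∈ minimalPrimes A) (hd : ∀ i, 0 < d i)
    (h : IsPolyGrading d 𝒴 p) [Module.Finite (MvPolynomial (Fin r) A) Y] :
    ∃ a, IsGoodAt q a ∧ ∃ c : ℕ → ℤ → Prop, ∀ (k : Type v) [Field k] [Algebra A k],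
      algebraMap A k a ≠ 0 → ∀ i n, CechVanishes (MvPolynomial.X : Fin r → MvPolynomial (Fin r) k) d
        (fun n => (PolyFiber.component (r := r) 𝒴 k n).toAddSubgroup) i n ↔ c i n := by
  have hqp : q.IsPrime := hq.1.1
  choose a ha c hc using h.hasConstantCohomology.{u, v, w} hq hd
  have h1 : ∀ j, ∃ a', IsGoodAt q a' ∧ ∀ i < j, a i ∣ a' := by
    intro j
    induction j with
    | zero =>
      obtain ⟨a', ha'⟩ := exists_isGoodAt hq
      exact ⟨a', ha', fun i hi => absurd hi (by omega)⟩
    | succ j ih =>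
      obtain ⟨a', ha', hdvd⟩ := ih
      refine ⟨a' * a j, ha'.mul (ha j).1, fun i hi => ?_⟩
      rcases Nat.lt_succ_iff_lt_or_eq.1 hi with hi | rfl
      · exact (hdvd i hi).mul_right _
      · exact Dvd.intro_left _ rfl
  obtain ⟨a', ha', hdvd⟩ := h1 (r + 1)
  -- Only the degrees 0, …, r contribute, so a finite product of elements suffices; above r the
  -- condition is vacuous and the cohomology is zero.
  refine ⟨a', ha', fun i n => i ≤ r → c i n, fun k _ _ hk i n => ?_⟩
  by_cases hi : i ≤ r
  · rw [hc i k (fun h0 => hk (by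
      obtain ⟨b, hb⟩ := hdvd i (by omega)
      rw [hb, map_mul, h0, zero_mul])) n]
    exact ⟨fun h _ => h, fun h => h hi⟩
  · exact iff_of_true (cechVanishes_of_lt (by omega) n) fun h => absurd h hi

end Core

/-! ### Krull dimension from the growth of the Hilbert function. -/

section Dimension

/-- Incomparability makes contraction of primes strictly monotone, and lying over with going up
lifts chains. -/
theorem ringKrullDim_eq_of_integral {P B : Type*} [CommRing P] [CommRing B] [Algebra P B]
    [Algebra.IsIntegral P B] (h : Function.Injective (algebraMap P B)) :
    ringKrullDim B = ringKrullDim P := by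
  apply le_antisymm
  · exact Order.krullDim_le_of_strictMono (PrimeSpectrum.comap (algebraMap P B)) fun _ _ hlt =>
      Ideal.IsIntegral.comap_lt_comap hlt
  · refine iSup_le fun l => ?_
    have : FaithfulSMul P B := (faithfulSMul_iff_algebraMap_injective P B).2 h
    obtain ⟨Q, _, hQ, hQ'⟩ := Ideal.exists_ideal_over_prime_of_isIntegral
      (RelSeries.head l).asIdeal (⊥ : Ideal B) (by
        rw [← RingHom.ker_eq_comap_bot, (RingHom.injective_iff_ker_eq_bot _).1 h]
        exact bot_le)
    have : Q.LiesOver (RelSeries.head l).asIdeal := ⟨hQ'.symm⟩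
    obtain ⟨L, hL, -⟩ := Ideal.exists_ltSeries_of_hasGoingUp l Q
    exact le_iSup_of_le L (by rw [hL])

/-- Annihilators over W are contracted from B, so W modulo its annihilator embeds integrally into B
modulo its annihilator. This moves the dimension from the fibre ring to k[X]. -/
theorem supportDim_eq_ringKrullDim_of_addEquiv {W B N N₀ : Type*} [CommRing W] [CommRing B]
    [Algebra W B] [Algebra.IsIntegral W B] [AddCommGroup N] [Module B N] [Module.Finite B N]
    [AddCommGroup N₀] [Module W N₀] (φ : N ≃+ N₀)
    (hφ : ∀ (w : W) (n : N), φ (algebraMap W B w • n) = w • φ n) :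
    Module.supportDim B N = ringKrullDim (W ⧸ Module.annihilator W N₀) := by
  rw [Module.supportDim_eq_ringKrullDim_quotient_annihilator]
  have h1 : Module.annihilator W N₀ = (Module.annihilator B N).comap (algebraMap W B) := by
    ext w
    rw [Ideal.mem_comap, Module.mem_annihilator, Module.mem_annihilator]
    constructor
    · intro h n
      apply φ.injective
      rw [hφ, h, map_zero]
    · intro h n
      rw [← φ.apply_symm_apply n, ← hφ, h, map_zero]
  rw [h1]
  exact ringKrullDim_eq_of_integral Ideal.algebraMap_quotient_injective

variable {k : Type*} [Field k]

theorem mem_restrictDegree_iff_degreeOf {n t : ℕ} {p : MvPolynomial (Fin n) k} :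
    p ∈ MvPolynomial.restrictDegree (Fin n) k t ↔ ∀ i, p.degreeOf i ≤ t := by
  rw [MvPolynomial.mem_restrictDegree]
  simp only [MvPolynomial.degreeOf_le_iff]
  exact ⟨fun h i s hs => h s hs i, fun h s hs i => h i s hs⟩

theorem mul_mem_restrictDegree {n s t : ℕ} {p q : MvPolynomial (Fin n) k}
    (hp : p ∈ MvPolynomial.restrictDegree (Fin n) k s)
    (hq : q ∈ MvPolynomial.restrictDegree (Fin n) k t) :
    p * q ∈ MvPolynomial.restrictDegree (Fin n) k (s + t) := by
  rw [mem_restrictDegree_iff_degreeOf] at *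
  exact fun i => (MvPolynomial.degreeOf_mul_le i p q).trans (add_le_add (hp i) (hq i))

/-- Bounding the degree in each variable separately, instead of the total degree, makes the
dimension an exact power. -/
theorem finrank_restrictDegree (n t : ℕ) :
    Module.finrank k (MvPolynomial.restrictDegree (Fin n) k t) = (t + 1) ^ n := by
  rw [MvPolynomial.restrictDegree, Module.finrank_eq_nat_card_basis
    (MvPolynomial.basisRestrictSupport k {f : Fin n →₀ ℕ | ∀ i, f i ≤ t})]
  have h : {f : Fin n →₀ ℕ | ∀ i, f i ≤ t} ≃ (Fin n → Fin (t + 1)) :=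
    { toFun := fun f i => ⟨f.1 i, Nat.lt_succ_of_le (f.2 i)⟩
      invFun := fun f => ⟨Finsupp.equivFunOnFinite.symm fun i => f i, fun i => Nat.le_of_lt_succ (f i).2⟩
      left_inv := fun f => Subtype.ext (Finsupp.ext fun i => rfl)
      right_inv := fun f => rfl }
  rw [Nat.card_congr h]
  simp

variable {N : Type*} [AddCommGroup N] [Module k N] {m : ℕ} [Module (MvPolynomial (Fin m) k) N]
  [IsScalarTower k (MvPolynomial (Fin m) k) N]

/-- The combinations of the elements `g j` whose coefficients have degree at most `t` in every
variable. -/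
noncomputable def boxSpan {s : ℕ} (m : ℕ) [Module (MvPolynomial (Fin m) k) N]
    [IsScalarTower k (MvPolynomial (Fin m) k) N] (g : Fin s → N) (t : ℕ) : Submodule k N :=
  LinearMap.range (((Fintype.linearCombination (MvPolynomial (Fin m) k) g).restrictScalars k) ∘ₗ
    (LinearMap.pi fun j => (MvPolynomial.restrictDegree (Fin m) k t).subtype ∘ₗ LinearMap.proj j :
      (Fin s → MvPolynomial.restrictDegree (Fin m) k t) →ₗ[k] (Fin s → MvPolynomial (Fin m) k)))

theorem mem_boxSpan {s : ℕ} {g : Fin s → N} {t : ℕ} {y : N} : y ∈ boxSpan (k := k) m g t ↔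
    ∃ v : Fin s → MvPolynomial (Fin m) k, (∀ j, v j ∈ MvPolynomial.restrictDegree (Fin m) k t) ∧
      ∑ j, v j • g j = y := by
  constructor
  · rintro ⟨v, rfl⟩
    exact ⟨fun j => v j, fun j => (v j).2, rfl⟩
  · rintro ⟨v, hv, rfl⟩
    exact ⟨fun j => ⟨v j, hv j⟩, rfl⟩

theorem finite_boxSpan {s : ℕ} (g : Fin s → N) (t : ℕ) :
    Module.Finite k (boxSpan (k := k) m g t) := by
  unfold boxSpan
  infer_instance

theorem finrank_boxSpan_le {s : ℕ} (g : Fin s → N) (t : ℕ) :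
    Module.finrank k (boxSpan (k := k) m g t) ≤ s * (t + 1) ^ m := by
  refine (LinearMap.finrank_range_le _).trans ?_
  rw [Module.finrank_pi_fintype]
  simp [finrank_restrictDegree]

theorem boxSpan_mono {s : ℕ} (g : Fin s → N) {t t' : ℕ} (h : t ≤ t') :
    boxSpan (k := k) m g t ≤ boxSpan m g t' := by
  intro y hy
  obtain ⟨v, hv, rfl⟩ := mem_boxSpan.1 hy
  exact mem_boxSpan.2 ⟨v, fun j => MvPolynomial.restrictSupport_mono k
    (fun f hf i => (hf i).trans h) (hv j), rfl⟩

theorem exists_mem_boxSpan {s : ℕ} {g : Fin s → N}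
    (hg : Submodule.span (MvPolynomial (Fin m) k) (Set.range g) = ⊤) (y : N) :
    ∃ t, y ∈ boxSpan (k := k) m g t := by
  have hy : y ∈ Submodule.span (MvPolynomial (Fin m) k) (Set.range g) := hg ▸ Submodule.mem_top
  obtain ⟨v, rfl⟩ := (Submodule.mem_span_range_iff_exists_fun _).1 hy
  refine ⟨∑ j, (v j).totalDegree, mem_boxSpan.2 ⟨v, fun j => ?_, rfl⟩⟩
  exact mem_restrictDegree_iff_degreeOf.2 fun i => (MvPolynomial.degreeOf_le_totalDegree _ _).trans
    (Finset.single_le_sum (f := fun j => (v j).totalDegree) (fun _ _ => Nat.zero_le _)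
      (Finset.mem_univ j))

theorem exists_mem_boxSpan_forall {s : ℕ} {g : Fin s → N}
    (hg : Submodule.span (MvPolynomial (Fin m) k) (Set.range g) = ⊤) {J : Type*} [Finite J]
    (y : J → N) : ∃ t, ∀ j, y j ∈ boxSpan (k := k) m g t := by
  have := Fintype.ofFinite J
  choose t ht using fun j => exists_mem_boxSpan (k := k) hg (y j)
  exact ⟨∑ j, t j, fun j => boxSpan_mono g
    (Finset.single_le_sum (fun _ _ => Nat.zero_le _) (Finset.mem_univ j)) (ht j)⟩

theorem smul_mem_boxSpan {s : ℕ} {g : Fin s → N} {t D : ℕ} {p : MvPolynomial (Fin m) k} {y : N}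
    (hp : p ∈ MvPolynomial.restrictDegree (Fin m) k t) (hy : y ∈ boxSpan (k := k) m g D) :
    p • y ∈ boxSpan (k := k) m g (t + D) := by
  obtain ⟨v, hv, rfl⟩ := mem_boxSpan.1 hy
  exact mem_boxSpan.2 ⟨fun j => p * v j, fun j => mul_mem_restrictDegree hp (hv j), by
    simp only [mul_smul, Finset.smul_sum]⟩

/-- Two commuting polynomial actions have comparable growth. -/
theorem exists_smul_mem_boxSpan {n : ℕ} [Module (MvPolynomial (Fin n) k) N]
    [IsScalarTower k (MvPolynomial (Fin n) k) N]
    [SMulCommClass (MvPolynomial (Fin n) k) (MvPolynomial (Fin m) k) N]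
    {s : ℕ} {g : Fin s → N} (hg : Submodule.span (MvPolynomial (Fin m) k) (Set.range g) = ⊤)
    {J : Type*} [Finite J] (y : J → N) :
    ∃ D, ∀ t, ∀ q ∈ MvPolynomial.restrictDegree (Fin n) k t, ∀ j,
      q • y j ∈ boxSpan (k := k) m g (D * (t + 1)) := by
  obtain ⟨D₀, hD₀⟩ := exists_mem_boxSpan_forall (k := k) hg y
  obtain ⟨D, hD⟩ := exists_mem_boxSpan_forall (k := k) hg
    fun a : Fin n × Fin s => (MvPolynomial.X a.1 : MvPolynomial (Fin n) k) • g a.2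
  have h1 : ∀ i t, ∀ z ∈ boxSpan (k := k) m g t,
      (MvPolynomial.X i : MvPolynomial (Fin n) k) • z ∈ boxSpan (k := k) m g (t + D) := by
    intro i t z hz
    obtain ⟨v, hv, rfl⟩ := mem_boxSpan.1 hz
    rw [Finset.smul_sum]
    refine sum_mem fun j _ => ?_
    rw [smul_comm]
    exact smul_mem_boxSpan (hv j) (hD (i, j))
  have h2 : ∀ (F : Finset (Fin n)) (α : Fin n → ℕ) t, ∀ z ∈ boxSpan (k := k) m g t,
      (∏ i ∈ F, (MvPolynomial.X i : MvPolynomial (Fin n) k) ^ α i) • z ∈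
        boxSpan (k := k) m g (t + (∑ i ∈ F, α i) * D) := by
    intro F α
    induction F using Finset.induction_on with
    | empty => simp
    | insert i F hi ih =>
      intro t z hz
      rw [Finset.prod_insert hi, Finset.sum_insert hi, mul_smul]
      have h3 : ∀ a t, ∀ z ∈ boxSpan (k := k) m g t,
          (MvPolynomial.X i ^ a : MvPolynomial (Fin n) k) • z ∈ boxSpan (k := k) m g (t + a * D) := by
        intro a
        induction a with
        | zero => simp
        | succ a ih =>
          intro t z hz
          rw [pow_succ, mul_smul]
          have h4 := ih _ _ (h1 i _ _ hz)
          rwa [add_assoc, add_comm D, ← Nat.succ_mul] at h4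
      have h4 := h3 (α i) _ _ (ih t z hz)
      rwa [add_assoc, add_comm (_ * D), ← add_mul] at h4
  -- `D₀` places the elements `y j` in a box, and each multiplication by one of the n variables
  -- enlarges the box by D; a monomial of degree at most t in every variable uses at most n t
  -- multiplications.
  refine ⟨D₀ + n * D, fun t q hq j => ?_⟩
  rw [← MvPolynomial.support_sum_monomial_coeff q, Finset.sum_smul]
  refine sum_mem fun α hα => ?_
  have h4 : MvPolynomial.monomial α (MvPolynomial.coeff α q) =
      MvPolynomial.coeff α q • MvPolynomial.monomial α 1 := by
    rw [MvPolynomial.smul_monomial, smul_eq_mul, mul_one]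
  rw [h4, smul_assoc]
  refine Submodule.smul_mem _ _ ?_
  rw [MvPolynomial.monomial_eq, map_one, one_mul, Finsupp.prod_fintype _ _ (fun _ => pow_zero _)]
  refine boxSpan_mono g ?_ (h2 _ _ _ _ (hD₀ j))
  have h5 : ∑ i, α i ≤ n * t := by
    have h6 : ∑ i, α i ≤ ∑ _i : Fin n, t := Finset.sum_le_sum fun i _ =>
      (MvPolynomial.mem_restrictDegree _ _ _).1 hq α hα i
    simpa using h6
  nlinarith [Nat.mul_le_mul_right D h5]

/-- The exponents `e` such that `n ↦ ∑ ρ j`, the sum being over `|j| ≤ n`, is `O(nᵉ)`. -/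
def growthExponents (ρ : ℤ → ℕ) : Set ℕ :=
  {e | ∃ C : ℕ, ∀ n : ℕ, ∑ j ∈ Finset.Icc (-(n : ℤ)) n, ρ j ≤ C * (n + 1) ^ e}

open Classical in
/-- The dimension of a graded module with Hilbert function `ρ`. -/
noncomputable def hilbertDim (ρ : ℤ → ℕ) : WithBot ℕ∞ :=
  if ∀ n, ρ n = 0 then ⊥ else ((sInf (growthExponents ρ) : ℕ) : WithBot ℕ∞)

variable {r : ℕ} {d : Fin r → ℕ} [Module (MvPolynomial (Fin r) k) N]
  [IsScalarTower k (MvPolynomial (Fin r) k) N] {𝒩 : ℤ → Submodule k N} {p : ℤ → N →ₗ[k] N}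

omit [IsScalarTower k (MvPolynomial (Fin r) k) N] in
theorem IsPolyGrading.sum_finrank_le (h : IsPolyGrading d 𝒩 p) (F : Finset ℤ) (V : Submodule k N)
    [Module.Finite k V] (hV : ∀ n ∈ F, 𝒩 n ≤ V) :
    ∑ n ∈ F, Module.finrank k (𝒩 n) ≤ Module.finrank k V := by
  have hfin : ∀ n : F, Module.Finite k (𝒩 n) := fun n =>
    Submodule.finiteDimensional_of_le (hV n n.2)
  let f : (∀ n : F, 𝒩 n) →ₗ[k] V :=
    ∑ n : F, Submodule.inclusion (hV n n.2) ∘ₗ LinearMap.proj n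
  have hf : ∀ v, (f v : N) = ∑ n : F, (v n : N) := by
    intro v
    simp [f, LinearMap.sum_apply]
  have hinj : Function.Injective f := by
    rw [injective_iff_map_eq_zero]
    intro v hv
    funext n
    have h1 : ∑ n : F, (v n : N) = 0 := by rw [← hf, hv]; rfl
    have h2 : p n (∑ n : F, (v n : N)) = v n := by
      rw [map_sum, Finset.sum_eq_single n]
      · exact h.proj.eq_self n _ (v n).2
      · exact fun n' _ hn => h.proj.eq_zero n n' (fun h' => hn (Subtype.ext h'.symm)) _ (v n').2
      · exact fun h' => absurd (Finset.mem_univ n) h'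
    rw [h1, map_zero] at h2
    exact Subtype.ext h2.symm
  have h3 := LinearMap.finrank_le_finrank_of_injective hinj
  rw [Module.finrank_pi_fintype] at h3
  rwa [Finset.univ_eq_attach, Finset.sum_attach F fun n => Module.finrank k (𝒩 n)] at h3

theorem finrank_le_sum_finrank {F : Finset ℤ} {V : Submodule k N}
    [∀ n, Module.Finite k (𝒩 n)] (hV : V ≤ ⨆ n ∈ F, 𝒩 n) :
    Module.finrank k V ≤ ∑ n ∈ F, Module.finrank k (𝒩 n) := by
  have hle : (⨆ n ∈ F, 𝒩 n) ≤ LinearMap.range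
      (∑ n : F, (𝒩 n).subtype ∘ₗ LinearMap.proj n : (∀ n : F, 𝒩 n) →ₗ[k] N) := by
    refine iSup₂_le fun n hn y hy => ?_
    refine ⟨Pi.single ⟨n, hn⟩ ⟨y, hy⟩, ?_⟩
    rw [LinearMap.sum_apply, Finset.sum_eq_single ⟨n, hn⟩]
    · simp
    · intro n' _ hn'
      simp [Pi.single_eq_of_ne hn']
    · exact fun h' => absurd (Finset.mem_univ _) h'
  refine (Submodule.finrank_mono (hV.trans hle)).trans ((LinearMap.finrank_range_le _).trans ?_)
  rw [Module.finrank_pi_fintype]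
  rw [Finset.univ_eq_attach, Finset.sum_attach F fun n => Module.finrank k (𝒩 n)]

theorem IsPolyGrading.exists_homogeneous_generators (h : IsPolyGrading d 𝒩 p)
    [Module.Finite (MvPolynomial (Fin r) k) N] (hd : ∀ i, 0 < d i) :
    ∃ (b : ℕ) (g : Fin b → N) (E : ℕ),
      Submodule.span (MvPolynomial (Fin r) k) (Set.range g) = ⊤ ∧
      (∀ n : ℕ, ∀ j ∈ Finset.Icc (-(n : ℤ)) n, 𝒩 j ≤ boxSpan r g (n + E)) ∧
      ∀ t, boxSpan r g t ≤ ⨆ j ∈ Finset.Icc (-((t * ∑ i, d i + E : ℕ) : ℤ)) (t * ∑ i, d i + E : ℕ), 𝒩 j := by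
  obtain ⟨b, e, π, hπ, hπ'⟩ := h.exists_presentation
  have hsum : ∀ v, π v = ∑ j, v j • π (Pi.single j 1) := by
    intro v
    conv_lhs => rw [pi_eq_sum_univ' v]
    rw [map_sum]
    refine Finset.sum_congr rfl fun j _ => ?_
    rw [← map_smul]
  have hE : ∀ j, |e j| ≤ ((∑ j, (e j).natAbs : ℕ) : ℤ) := by
    intro j
    rw [Int.abs_eq_natAbs]
    exact_mod_cast Finset.single_le_sum (f := fun j => (e j).natAbs) (fun _ _ => Nat.zero_le _)
      (Finset.mem_univ j)
  refine ⟨b, fun j => π (Pi.single j 1), ∑ j, (e j).natAbs, ?_, ?_, ?_⟩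
  · rw [eq_top_iff]
    rintro y -
    obtain ⟨v, rfl⟩ := hπ y
    rw [hsum]
    exact sum_mem fun j _ => Submodule.smul_mem _ _ (Submodule.subset_span ⟨j, rfl⟩)
  · intro n m hm y hy
    rw [h.eq_map hπ hπ' m] at hy
    obtain ⟨v, hv, rfl⟩ := hy
    refine mem_boxSpan.2 ⟨v, fun j => ?_, (hsum v).symm⟩
    rw [MvPolynomial.mem_restrictDegree]
    intro α hα i
    have h1 : Finsupp.weight (fun i => (d i : ℤ)) α = m - e j :=
      (mem_polyFreeComponent d).1 hv j (MvPolynomial.mem_support_iff.1 hα)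
    rw [Finsupp.weight_apply, Finsupp.sum_fintype _ _ (by simp)] at h1
    have h2 : (α i : ℤ) ≤ ∑ i, α i • (d i : ℤ) := by
      refine le_trans ?_ (Finset.single_le_sum (f := fun i => α i • (d i : ℤ))
        (fun _ _ => by positivity) (Finset.mem_univ i))
      have := hd i
      simp only [nsmul_eq_mul]
      nlinarith [(by exact_mod_cast this : (1 : ℤ) ≤ d i)]
    have h3 := neg_le_of_abs_le (hE j)
    rw [Finset.mem_Icc] at hm
    zify
    push_cast at h3
    linarith
  · intro t y hy
    obtain ⟨v, hv, rfl⟩ := mem_boxSpan.1 hy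
    refine sum_mem fun j _ => ?_
    rw [← MvPolynomial.support_sum_monomial_coeff (v j), Finset.sum_smul]
    refine sum_mem fun α hα => ?_
    have h1 := h.hom.monomial_smul_mem α (MvPolynomial.coeff α (v j))
      (hπ' (e j) _ (PolyFiber.single_mem_polyFreeComponent (A := k) (d := d) e j))
    refine Submodule.mem_iSup_of_mem _ (Submodule.mem_iSup_of_mem ?_ h1)
    have h2 : Finsupp.weight (fun i => (d i : ℤ)) α ≤ t * ∑ i, (d i : ℤ) := by
      rw [Finsupp.weight_apply, Finsupp.sum_fintype _ _ (by simp), Finset.mul_sum]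
      refine Finset.sum_le_sum fun i _ => ?_
      rw [nsmul_eq_mul]
      have := (MvPolynomial.mem_restrictDegree _ _ _).1 (hv j) α hα i
      gcongr
    have h3 : 0 ≤ Finsupp.weight (fun i => (d i : ℤ)) α := by
      rw [Finsupp.weight_apply, Finsupp.sum_fintype _ _ (by simp)]
      exact Finset.sum_nonneg fun i _ => by positivity
    have h4 := abs_le.1 (hE j)
    have h5 : (0 : ℤ) ≤ t * ∑ i, (d i : ℤ) := by positivity
    push_cast at h4 ⊢
    rw [Finset.mem_Icc]
    constructor <;> linarith

/-- The growth of the Hilbert function is governed by the number of variables of a Noether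
normalization. -/
theorem IsPolyGrading.growthExponents_eq (h : IsPolyGrading d 𝒩 p) (hd : ∀ i, 0 < d i)
    [Module.Finite (MvPolynomial (Fin r) k) N] [Module.Finite (MvPolynomial (Fin m) k) N]
    [FaithfulSMul (MvPolynomial (Fin m) k) N]
    [SMulCommClass (MvPolynomial (Fin r) k) (MvPolynomial (Fin m) k) N] {ρ : ℤ → ℕ}
    (hρ : ∀ n, Module.finrank k (𝒩 n) = ρ n) : growthExponents ρ = Set.Ici m := by
  have := SMulCommClass.symm (MvPolynomial (Fin r) k) (MvPolynomial (Fin m) k) N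
  have hfin : ∀ n, Module.Finite k (𝒩 n) := h.finite hd
  obtain ⟨b, g, E, hg, hle, hge⟩ := h.exists_homogeneous_generators hd
  ext e
  constructor
  · rintro ⟨C, hC⟩
    obtain ⟨D, hD⟩ := exists_smul_mem_boxSpan (k := k) (n := m) hg g
    set T := ∑ i, d i
    -- The lower bound on growth: by faithfulness, a polynomial in the m variables is determined by
    -- its action on the b generators. This embeds a box of dimension (t+1)^m into b copies of a
    -- space controlled by the Hilbert function.
    have h1 : ∀ t : ℕ, (t + 1) ^ m ≤ b * (C * ((D * (t + 1)) * T + E + 1) ^ e) := by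
      intro t
      let f : MvPolynomial.restrictDegree (Fin m) k t →ₗ[k]
          (Fin b → boxSpan (k := k) r g (D * (t + 1))) :=
        LinearMap.pi fun j =>
          { toFun := fun q => ⟨(q : MvPolynomial (Fin m) k) • g j, hD t q q.2 j⟩
            map_add' := fun q q' => Subtype.ext (add_smul _ _ _)
            map_smul' := fun c q => Subtype.ext (smul_assoc c (q : MvPolynomial (Fin m) k) (g j)) }
      have hf : Function.Injective f := by
        rw [injective_iff_map_eq_zero]
        intro q hq
        apply Subtype.ext
        apply FaithfulSMul.eq_of_smul_eq_smul (α := N)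
        intro y
        have hy : y ∈ Submodule.span (MvPolynomial (Fin r) k) (Set.range g) := hg ▸ Submodule.mem_top
        obtain ⟨v, rfl⟩ := (Submodule.mem_span_range_iff_exists_fun _).1 hy
        rw [Finset.smul_sum, Finset.smul_sum]
        refine Finset.sum_congr rfl fun j _ => ?_
        have h2 : (q : MvPolynomial (Fin m) k) • g j = 0 :=
          congrArg Subtype.val (congrFun hq j : f q j = 0)
        rw [smul_comm, h2, smul_zero]
        exact (zero_smul _ _).symm
      have hfinb := fun t => finite_boxSpan (k := k) (m := r) g t
      have h2 := LinearMap.finrank_le_finrank_of_injective hf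
      rw [finrank_restrictDegree, Module.finrank_pi_fintype] at h2
      simp only [Finset.sum_const, Finset.card_univ, Fintype.card_fin, smul_eq_mul] at h2
      refine h2.trans (Nat.mul_le_mul_left b ((finrank_le_sum_finrank (hge _)).trans ?_))
      simp only [hρ]
      exact hC _
    by_contra hlt
    rw [Set.mem_Ici, not_le] at hlt
    -- An exponent e < m would leave at least one uncancelled factor t + 1, which would then be
    -- bounded independently of t.
    have h3 : ∀ t : ℕ, t + 1 ≤ b * (C * (D * T + E + 1) ^ e) := by
      intro t
      have h4 : (D * (t + 1)) * T + E + 1 ≤ (D * T + E + 1) * (t + 1) := by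
        nlinarith [Nat.zero_le (E * t)]
      have h5 : (t + 1) * (t + 1) ^ e ≤ (b * (C * (D * T + E + 1) ^ e)) * (t + 1) ^ e := by
        calc (t + 1) * (t + 1) ^ e = (t + 1) ^ (e + 1) := by rw [pow_succ, mul_comm]
          _ ≤ (t + 1) ^ m := Nat.pow_le_pow_right (Nat.succ_pos t) hlt
          _ ≤ _ := h1 t
          _ ≤ b * (C * ((D * T + E + 1) * (t + 1)) ^ e) := by gcongr
          _ = _ := by rw [mul_pow]; ring
      exact Nat.le_of_mul_le_mul_right h5 (by positivity)
    exact absurd (h3 (b * (C * (D * T + E + 1) ^ e))) (by omega)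
  -- The upper bound: elements of degree at most n in absolute value lie in a box for the original
  -- variables, hence in a box of size linear in n for the m new ones.
  · intro hme
    obtain ⟨S, hS⟩ := (Module.Finite.fg_top : (⊤ : Submodule (MvPolynomial (Fin m) k) N).FG)
    obtain ⟨s, z, hz⟩ : ∃ (s : ℕ) (z : Fin s → N), Set.range z = S :=
      ⟨S.card, fun i => S.equivFin.symm i, by
        ext y
        exact ⟨by rintro ⟨i, rfl⟩; exact (S.equivFin.symm i).2,
          fun hy => ⟨S.equivFin ⟨y, hy⟩, by simp⟩⟩⟩
    rw [← hz] at hS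
    obtain ⟨D, hD⟩ := exists_smul_mem_boxSpan (k := k) (n := r) hS g
    refine ⟨s * (D * (E + 1) + 1) ^ m, fun n => ?_⟩
    have hfinb := finite_boxSpan (k := k) (m := m) z (D * (n + E + 1))
    have h1 : boxSpan (k := k) r g (n + E) ≤ boxSpan m z (D * (n + E + 1)) := by
      intro y hy
      obtain ⟨v, hv, rfl⟩ := mem_boxSpan.1 hy
      exact sum_mem fun j _ => hD _ _ (hv j) j
    have h2 := h.sum_finrank_le (Finset.Icc (-(n : ℤ)) n) _ fun j hj => (hle n j hj).trans h1
    simp only [hρ] at h2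
    have h4 : D * (n + E + 1) + 1 ≤ (D * (E + 1) + 1) * (n + 1) := by
      nlinarith [Nat.zero_le (D * E * n)]
    calc _ ≤ _ := h2
      _ ≤ s * (D * (n + E + 1) + 1) ^ m := finrank_boxSpan_le z _
      _ ≤ s * ((D * (E + 1) + 1) * (n + 1)) ^ m := by gcongr
      _ = s * (D * (E + 1) + 1) ^ m * (n + 1) ^ m := by rw [mul_pow, mul_assoc]
      _ ≤ _ := Nat.mul_le_mul_left _ (Nat.pow_le_pow_right (Nat.succ_pos n) hme)

/-- Noether normalization makes B finite over a polynomial ring in m = dim B variables, which acts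
faithfully on N because B does. The growth of the Hilbert function then has smallest exponent m. -/
theorem IsPolyGrading.ringKrullDim_eq_hilbertDim (h : IsPolyGrading d 𝒩 p)
    (hd : ∀ i, 0 < d i) [Module.Finite (MvPolynomial (Fin r) k) N] {ρ : ℤ → ℕ}
    (hρ : ∀ n, Module.finrank k (𝒩 n) = ρ n) {B : Type*} [CommRing B] [Algebra k B]
    [Algebra (MvPolynomial (Fin r) k) B] [IsScalarTower k (MvPolynomial (Fin r) k) B] [Module B N]
    [IsScalarTower (MvPolynomial (Fin r) k) B N] [FaithfulSMul B N]
    (hB : Function.Surjective (algebraMap (MvPolynomial (Fin r) k) B)) :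
    ringKrullDim B = hilbertDim ρ := by
  have hfin : ∀ n, Module.Finite k (𝒩 n) := h.finite hd
  have hzero : (∀ n, ρ n = 0) ↔ Subsingleton N := by
    constructor
    · intro h0
      refine ⟨fun y y' => ?_⟩
      have h1 : ∀ y : N, y = 0 := by
        intro y
        obtain ⟨F, hF⟩ := h.proj.exists_sum y
        rw [← hF]
        refine Finset.sum_eq_zero fun n _ => ?_
        have h2 := h.proj.mem n y
        have h3 : 𝒩 n = ⊥ := Submodule.finrank_eq_zero.1 ((hρ n).trans (h0 n))
        rw [h3] at h2
        exact h2
      rw [h1 y, h1 y']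
    · intro _ n
      rw [← hρ, Module.finrank_zero_of_subsingleton]
  unfold hilbertDim
  split_ifs with h0
  · have := hzero.1 h0
    have : Subsingleton B := ⟨fun a b => FaithfulSMul.eq_of_smul_eq_smul (α := N)
      fun y => Subsingleton.elim _ _⟩
    exact ringKrullDim_eq_bot_of_subsingleton
  · have hnt : Nontrivial N := not_subsingleton_iff_nontrivial.1 (mt hzero.2 h0)
    have : Nontrivial B := by
      by_contra hB
      have := not_nontrivial_iff_subsingleton.1 hB
      have := Module.subsingleton B N
      exact not_subsingleton N this
    have : Algebra.FiniteType k B := Algebra.FiniteType.of_surjective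
      (IsScalarTower.toAlgHom k (MvPolynomial (Fin r) k) B) hB
    have hw : ∀ (w : MvPolynomial (Fin r) k) (y : N), algebraMap _ B w • y = w • y :=
      fun w y => algebraMap_smul B w y
    have : IsScalarTower k B N := ⟨fun c a y => by
      obtain ⟨w, rfl⟩ := hB a
      rw [← algebraMap_smul (MvPolynomial (Fin r) k) c (algebraMap _ B w), smul_assoc,
        algebraMap_smul]⟩
    obtain ⟨m, f, hf, hff⟩ := exists_finite_inj_algHom_of_fg k B
    let _ : Algebra (MvPolynomial (Fin m) k) B := f.toRingHom.toAlgebra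
    have : Module.Finite (MvPolynomial (Fin m) k) B := hff
    have hdim : ringKrullDim B = m := by
      rw [ringKrullDim_eq_of_integral (P := MvPolynomial (Fin m) k) hf,
        MvPolynomial.ringKrullDim_of_isNoetherianRing, ringKrullDim_eq_zero_of_field]
      simp
    let _ : Module (MvPolynomial (Fin m) k) N := Module.compHom N f.toRingHom
    have hsmul : ∀ (q : MvPolynomial (Fin m) k) (y : N), q • y = f q • y := fun _ _ => rfl
    have : IsScalarTower (MvPolynomial (Fin m) k) B N := ⟨fun q a y => by
      rw [hsmul, ← mul_smul]
      rfl⟩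
    have : IsScalarTower k (MvPolynomial (Fin m) k) N := ⟨fun c q y => by
      rw [hsmul, hsmul, map_smul, smul_assoc]⟩
    have : SMulCommClass (MvPolynomial (Fin r) k) (MvPolynomial (Fin m) k) N := ⟨fun a q y => by
      rw [hsmul, hsmul, ← hw, ← hw, smul_comm]⟩
    have : FaithfulSMul (MvPolynomial (Fin m) k) N := ⟨fun {q q'} hq =>
      hf (FaithfulSMul.eq_of_smul_eq_smul (α := N) hq)⟩
    have : Module.Finite B N :=
      Module.Finite.of_restrictScalars_finite (MvPolynomial (Fin r) k) B N
    have : Module.Finite (MvPolynomial (Fin m) k) N := Module.Finite.trans B N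
    rw [hdim, h.growthExponents_eq (m := m) hd hρ, csInf_Ici]

theorem IsPolyGrading.ringKrullDim_quotient_annihilator (h : IsPolyGrading d 𝒩 p)
    (hd : ∀ i, 0 < d i) [Module.Finite (MvPolynomial (Fin r) k) N] {ρ : ℤ → ℕ}
    (hρ : ∀ n, Module.finrank k (𝒩 n) = ρ n) :
    ringKrullDim (MvPolynomial (Fin r) k ⧸ Module.annihilator (MvPolynomial (Fin r) k) N) =
      hilbertDim ρ := by
  have htors := Module.isTorsionBySet_annihilator (MvPolynomial (Fin r) k) N
  let _ : Module (MvPolynomial (Fin r) k ⧸ Module.annihilator (MvPolynomial (Fin r) k) N) N :=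
    htors.module
  have : IsScalarTower (MvPolynomial (Fin r) k)
      (MvPolynomial (Fin r) k ⧸ Module.annihilator (MvPolynomial (Fin r) k) N) N :=
    htors.isScalarTower
  have : FaithfulSMul (MvPolynomial (Fin r) k ⧸ Module.annihilator (MvPolynomial (Fin r) k) N) N :=
    ⟨fun {a b} hab => by
      obtain ⟨v, rfl⟩ := Ideal.Quotient.mk_surjective a
      obtain ⟨w, rfl⟩ := Ideal.Quotient.mk_surjective b
      rw [Ideal.Quotient.eq, Module.mem_annihilator]
      intro y
      have h1 : v • y = w • y := hab y
      rw [sub_smul, h1, sub_self]⟩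
  exact h.ringKrullDim_eq_hilbertDim hd hρ Ideal.Quotient.mk_surjective

end Dimension

/-! ### The given graded algebra and its modules over the polynomial ring. -/

section GradedAlgebra

variable {A R : Type*} [CommRing A] [CommRing R] [Algebra A R] (𝒜 : ℕ → Submodule A R)
  [GradedAlgebra 𝒜] {r : ℕ} {x : Fin r → R} {d : Fin r → ℕ}
  [Algebra (MvPolynomial (Fin r) A) R] [IsScalarTower A (MvPolynomial (Fin r) A) R]

/-- A graded algebra is finite over a polynomial ring mapping onto generators of its irrelevant
ideal if its component of degree zero is finite. -/
theorem finite_of_span_eq_irrelevant [Module.Finite A (𝒜 0)]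
    (hX : ∀ i, algebraMap (MvPolynomial (Fin r) A) R (MvPolynomial.X i) = x i)
    (hd : ∀ i, 0 < d i) (hx : ∀ i, x i ∈ 𝒜 (d i))
    (hspan : Ideal.span (Set.range x) = (HomogeneousIdeal.irrelevant 𝒜).toIdeal) :
    Module.Finite (MvPolynomial (Fin r) A) R := by
  obtain ⟨s, hs⟩ := Module.Finite.iff_fg.1 (inferInstance : Module.Finite A (𝒜 0))
  have hmem : ∀ n, ∀ y ∈ 𝒜 n, y ∈ Submodule.span (MvPolynomial (Fin r) A) (s : Set R) := by
    intro n
    induction n using Nat.strong_induction_on with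
    | _ n ih =>
      intro y hy
      rcases Nat.eq_zero_or_pos n with rfl | hn
      · rw [← hs] at hy
        exact Submodule.span_le_restrictScalars A (MvPolynomial (Fin r) A) _ hy
      · have h1 : y ∈ Ideal.span (Set.range x) := by
          rw [hspan, HomogeneousIdeal.mem_iff, HomogeneousIdeal.mem_irrelevant_iff,
            GradedRing.proj_apply, DirectSum.decompose_of_mem_ne 𝒜 hy hn.ne']
        -- An element of positive degree n is ∑ c_i x_i. Taking degree-n parts replaces c_i by its
        -- component of degree n - d_i < n, to which induction applies.
        obtain ⟨c, hc⟩ := (Submodule.mem_span_range_iff_exists_fun _).1 h1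
        have h2 : GradedRing.proj 𝒜 n y = y := by
          rw [GradedRing.proj_apply, DirectSum.decompose_of_mem_same 𝒜 hy]
        rw [← h2, ← hc, map_sum]
        refine sum_mem fun i _ => ?_
        rw [GradedRing.proj_apply, smul_eq_mul]
        by_cases hin : d i ≤ n
        · rw [DirectSum.coe_decompose_mul_of_right_mem_of_le 𝒜 (hx i) hin, mul_comm, ← hX,
            ← Algebra.smul_def]
          exact Submodule.smul_mem _ _ (ih _ (by have := hd i; omega) _ (SetLike.coe_mem _))
        · rw [DirectSum.coe_decompose_mul_of_right_mem_of_not_le 𝒜 (hx i) hin]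
          exact zero_mem _
  classical
  refine ⟨⟨s, eq_top_iff.2 fun y _ => ?_⟩⟩
  rw [← DirectSum.sum_support_decompose 𝒜 y]
  exact sum_mem fun n _ => hmem n _ (SetLike.coe_mem _)

/-- The projection of a graded algebra onto its component of degree `n`. -/
noncomputable def intProjection (n : ℤ) : R →ₗ[A] R :=
  if 0 ≤ n then (𝒜 n.toNat).subtype ∘ₗ DirectSum.component A ℕ (fun i => 𝒜 i) n.toNat ∘ₗ
    (DirectSum.decomposeLinearEquiv 𝒜).toLinearMap else 0

theorem intProjection_natCast (n : ℕ) (y : R) :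
    intProjection 𝒜 (n : ℤ) y = DirectSum.decompose 𝒜 y n := by
  simp [intProjection]
  rfl

theorem intProjection_of_neg {n : ℤ} (hn : n < 0) (y : R) : intProjection 𝒜 n y = 0 := by
  simp [intProjection, hn.not_ge]

omit [GradedAlgebra 𝒜] in
theorem intComponent_natCast (n : ℕ) : intComponent 𝒜 (n : ℤ) = 𝒜 n := by
  simp [intComponent]

omit [GradedAlgebra 𝒜] in
theorem intComponent_of_neg {n : ℤ} (hn : n < 0) : intComponent 𝒜 n = ⊥ := by
  simp [intComponent, hn.not_ge]

theorem isGradingProjection_intComponent :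
    IsGradingProjection (fun n => (intComponent 𝒜 n).toAddSubgroup)
      (fun n => (intProjection 𝒜 n).toAddMonoidHom) where
  mem n y := by
    change intProjection 𝒜 n y ∈ intComponent 𝒜 n
    rcases lt_or_ge n 0 with hn | hn
    · rw [intProjection_of_neg 𝒜 hn]
      exact zero_mem _
    · lift n to ℕ using hn
      rw [intProjection_natCast, intComponent_natCast]
      exact SetLike.coe_mem _
  eq_self n y hy := by
    change y ∈ intComponent 𝒜 n at hy
    change intProjection 𝒜 n y = y
    rcases lt_or_ge n 0 with hn | hn
    · rw [intComponent_of_neg 𝒜 hn, Submodule.mem_bot] at hy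
      rw [hy, map_zero]
    · lift n to ℕ using hn
      rw [intComponent_natCast] at hy
      rw [intProjection_natCast, DirectSum.decompose_of_mem_same 𝒜 hy]
  eq_zero n n' hnn y hy := by
    change y ∈ intComponent 𝒜 n' at hy
    change intProjection 𝒜 n y = 0
    rcases lt_or_ge n 0 with hn | hn
    · exact intProjection_of_neg 𝒜 hn y
    · rcases lt_or_ge n' 0 with hn' | hn'
      · rw [intComponent_of_neg 𝒜 hn', Submodule.mem_bot] at hy
        rw [hy, map_zero]
      · lift n to ℕ using hn
        lift n' to ℕ using hn'
        rw [intComponent_natCast] at hy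
        rw [intProjection_natCast, DirectSum.decompose_of_mem_ne 𝒜 hy (by exact_mod_cast hnn.symm)]
  exists_sum y := by
    classical
    refine ⟨(DirectSum.decompose 𝒜 y).support.map Nat.castEmbedding, ?_⟩
    rw [Finset.sum_map]
    exact (Finset.sum_congr rfl fun n _ => intProjection_natCast 𝒜 n y).trans
      (DirectSum.sum_support_decompose 𝒜 y)

omit [GradedAlgebra 𝒜] in
theorem mem_freeComponent {s : ℕ} {μ : Fin s → ℤ} {n : ℤ} {v : Fin s → R} :
    v ∈ freeComponent 𝒜 μ n ↔ ∀ j, v j ∈ intComponent 𝒜 (n - μ j) := by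
  simp [freeComponent, Submodule.mem_pi]

theorem isGradingProjection_freeComponent {s : ℕ} (μ : Fin s → ℤ) :
    IsGradingProjection (fun n => (freeComponent 𝒜 μ n).toAddSubgroup)
      (fun n => (LinearMap.pi fun j => intProjection 𝒜 (n - μ j) ∘ₗ LinearMap.proj j :
        (Fin s → R) →ₗ[A] (Fin s → R)).toAddMonoidHom) where
  mem n v := (mem_freeComponent 𝒜).2 fun j => (isGradingProjection_intComponent 𝒜).mem _ (v j)
  eq_self n v hv := funext fun j => (isGradingProjection_intComponent 𝒜).eq_self _ _
    ((mem_freeComponent 𝒜).1 hv j)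
  eq_zero n n' hn v hv := funext fun j => (isGradingProjection_intComponent 𝒜).eq_zero _ _
    (by omega) _ ((mem_freeComponent 𝒜).1 hv j)
  exists_sum v := by
    classical
    choose F hF using fun j => (isGradingProjection_intComponent 𝒜).exists_sum (v j)
    refine ⟨Finset.univ.biUnion fun j => (F j).image (· + μ j), ?_⟩
    funext j
    rw [Finset.sum_apply]
    have h1 := (isGradingProjection_intComponent 𝒜).sum_eq_of_subset
      (F' := (Finset.univ.biUnion fun j => (F j).image (· + μ j)).image (· - μ j)) (by
        intro n hn
        exact Finset.mem_image.2 ⟨n + μ j, Finset.mem_biUnion.2 ⟨j, Finset.mem_univ _,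
          Finset.mem_image_of_mem _ hn⟩, by ring⟩) (hF j)
    rw [Finset.sum_image (fun a _ b _ hab => by simpa using hab)] at h1
    exact h1

end GradedAlgebra

theorem isScalarTower_of_algebraMap (A R S M : Type*) [CommRing A] [CommRing R] [CommRing S]
    [Algebra A R] [Algebra A S] [Algebra S R] [IsScalarTower A S R] [AddCommGroup M] [Module A M]
    [Module R M] [IsScalarTower A R M] [Module S M] [IsScalarTower S R M] : IsScalarTower A S M :=
  ⟨fun a q m => by
    rw [← algebraMap_smul R (a • q) m, ← algebraMap_smul R q m, Algebra.algebraMap_eq_smul_one,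
      Algebra.algebraMap_eq_smul_one, smul_assoc a q (1 : R), smul_assoc]⟩

section GradedModule

variable {A R M : Type*} [CommRing A] [CommRing R] [Algebra A R] [AddCommGroup M] [Module A M]
  [Module R M] [IsScalarTower A R M] {𝒜 : ℕ → Submodule A R} {ℳ : ℤ → Submodule A M} {r : ℕ}
  {x : Fin r → R} {d : Fin r → ℕ}
  [Algebra (MvPolynomial (Fin r) A) R] [IsScalarTower A (MvPolynomial (Fin r) A) R]
  [Module (MvPolynomial (Fin r) A) M] [IsScalarTower (MvPolynomial (Fin r) A) R M]

omit [IsScalarTower A R M] [IsScalarTower A (MvPolynomial (Fin r) A) R] in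
theorem IsGradedModule.exists_isPolyGrading (h : IsGradedModule 𝒜 ℳ)
    (hX : ∀ i, algebraMap (MvPolynomial (Fin r) A) R (MvPolynomial.X i) = x i)
    (hx : ∀ i, x i ∈ 𝒜 (d i)) : ∃ p, IsPolyGrading d ℳ p := by
  classical
  let := h.isInternal.chooseDecomposition
  refine ⟨fun n => (ℳ n).subtype ∘ₗ DirectSum.component A ℤ (fun i => ℳ i) n ∘ₗ
    (DirectSum.decomposeLinearEquiv ℳ).toLinearMap, ⟨fun n m => ?_, fun n m hm => ?_,
      fun n n' hn m hm => ?_, fun m => ?_⟩, fun i n m hm => ?_⟩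
  · exact SetLike.coe_mem _
  · exact DirectSum.decompose_of_mem_same ℳ hm
  · exact DirectSum.decompose_of_mem_ne ℳ hm hn.symm
  · exact ⟨(DirectSum.decompose ℳ m).support, DirectSum.sum_support_decompose ℳ m⟩
  · have h1 := h.smul_mem (d i) n (x i) m (hx i) hm
    rw [← hX, algebraMap_smul, add_comm] at h1
    exact h1

/-- The kernel of f is homogeneous because ι ∘ f is a graded map to a graded free module with the
same kernel, so it commutes with the degree projections. This is how the embedding yields the
grading on M¹. -/
theorem IsGradedModule.exists_isPolyGrading_map [GradedAlgebra 𝒜] (h : IsGradedModule 𝒜 ℳ)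
    {N : Type*} [AddCommGroup N] [Module A N] [Module R N] [IsScalarTower A R N]
    [Module (MvPolynomial (Fin r) A) N] [IsScalarTower (MvPolynomial (Fin r) A) R N]
    {f : M →ₗ[R] N} (hf : Function.Surjective f) {s : ℕ} {μ : Fin s → ℤ}
    {ι : N →ₗ[R] (Fin s → R)} (hι : Function.Injective ι)
    (hhom : ∀ n, ∀ m ∈ ℳ n, ι (f m) ∈ freeComponent 𝒜 μ n)
    (hX : ∀ i, algebraMap (MvPolynomial (Fin r) A) R (MvPolynomial.X i) = x i)
    (hx : ∀ i, x i ∈ 𝒜 (d i)) :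
    ∃ p, IsPolyGrading d (fun n => (ℳ n).map (f.restrictScalars A)) p := by
  obtain ⟨p, hp⟩ := h.exists_isPolyGrading hX hx
  have := isScalarTower_of_algebraMap A R (MvPolynomial (Fin r) A) M
  have := isScalarTower_of_algebraMap A R (MvPolynomial (Fin r) A) N
  refine hp.of_surjective (f.restrictScalars (MvPolynomial (Fin r) A)) hf fun n m hm => hι ?_
  have h1 := hp.proj.map_apply (isGradingProjection_freeComponent 𝒜 μ)
    (ι ∘ₗ f).toAddMonoidHom hhom n m
  refine h1.trans ?_
  have h2 : (ι ∘ₗ f) m = 0 := (congrArg ι hm).trans (map_zero _)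
  rw [map_zero]
  exact (congrArg _ h2).trans (map_zero _)

end GradedModule

/-! ### Identification of the specialization with the fibre of M¹. -/

section TensorFiber

variable (A R k : Type*) [CommRing A] [CommRing R] [Algebra A R] [CommRing k] [Algebra A k]
  {N F : Type*} [AddCommGroup N] [Module A N] [Module R N] [IsScalarTower A R N]
  [AddCommGroup F] [Module A F] [Module R F] [IsScalarTower A R F]

variable (N) in
/-- The base change of an `R`-module to `R ⊗ k` agrees with its base change to `k`. -/
noncomputable def tensorFiberEquiv : (R ⊗[A] k) ⊗[R] N ≃+ k ⊗[A] N :=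
  (TensorProduct.comm R (R ⊗[A] k) N).toAddEquiv.trans
    ((TensorProduct.AlgebraTensorModule.cancelBaseChange A R R N k).toAddEquiv.trans
      (TensorProduct.comm A N k).toAddEquiv)

theorem tensorFiberEquiv_tmul (b : R) (c : k) (y : N) :
    tensorFiberEquiv A R k N ((b ⊗ₜ[A] c) ⊗ₜ[R] y) = c ⊗ₜ[A] (b • y) :=
  rfl

theorem tensorFiberEquiv_symm_tmul (c : k) (y : N) :
    (tensorFiberEquiv A R k N).symm (c ⊗ₜ[A] y) = ((1 : R) ⊗ₜ[A] c) ⊗ₜ[R] y := by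
  rw [AddEquiv.symm_apply_eq, tensorFiberEquiv_tmul, one_smul]

theorem tensorFiberEquiv_baseChange (f : N →ₗ[R] F) (z : (R ⊗[A] k) ⊗[R] N) :
    tensorFiberEquiv A R k F (f.baseChange (R ⊗[A] k) z) =
      (f.restrictScalars A).lTensor k (tensorFiberEquiv A R k N z) := by
  induction z with
  | zero => simp
  | add z z' h h' => rw [map_add, map_add, h, h', map_add, map_add]
  | tmul b y =>
    induction b with
    | zero => simp
    | add b b' h h' =>
      rw [TensorProduct.add_tmul, map_add, map_add, h, h', map_add, map_add]
    | tmul b c =>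
      rw [LinearMap.baseChange_tmul, tensorFiberEquiv_tmul, tensorFiberEquiv_tmul,
        LinearMap.lTensor_tmul, LinearMap.restrictScalars_apply, map_smul]

variable {k} in
/-- An injective map stays injective after the base change to `R ⊗ k` if its cokernel is flat. -/
theorem baseChange_injective_of_flatAway {f : N →ₗ[R] F} (hf : Function.Injective f) {a : A}
    (ha : IsUnit (algebraMap A k a)) (hflat : FlatAway a (F ⧸ LinearMap.range f)) :
    Function.Injective (f.baseChange (R ⊗[A] k)) := by
  have h1 := hflat.lTensor_injective (f.restrictScalars A)
    ((LinearMap.range f).mkQ.restrictScalars A : F →ₗ[A] F ⧸ LinearMap.range f) hf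
    (Submodule.mkQ_surjective (LinearMap.range f)) (LinearMap.exact_map_mkQ_range f) k ha
  intro z z' h
  apply (tensorFiberEquiv A R k N).injective
  apply h1
  rw [← tensorFiberEquiv_baseChange, h, tensorFiberEquiv_baseChange]

end TensorFiber

section Specialization

variable {A R N : Type*} [CommRing A] [CommRing R] [Algebra A R] [AddCommGroup N] [Module A N]
  [Module R N] [IsScalarTower A R N] {𝒩 : ℤ → Submodule A N} {r : ℕ} {x : Fin r → R}
  [Algebra (MvPolynomial (Fin r) A) R] [IsScalarTower A (MvPolynomial (Fin r) A) R]
  [Module (MvPolynomial (Fin r) A) N] [IsScalarTower (MvPolynomial (Fin r) A) R N]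
  [IsScalarTower A (MvPolynomial (Fin r) A) N]
  (k : Type*) [Field k] [Algebra A k]

variable (R N r) in
/-- The base change of an `R`-module to `k[X]` agrees with its base change to `R ⊗ k`. -/
noncomputable def fiberEquiv : PolyFiber A r k N ≃+ (R ⊗[A] k) ⊗[R] N :=
  (PolyFiber.equiv A r N k).toAddEquiv.trans (tensorFiberEquiv A R k N).symm

omit [Algebra (MvPolynomial (Fin r) A) R] [IsScalarTower A (MvPolynomial (Fin r) A) R]
  [IsScalarTower (MvPolynomial (Fin r) A) R N] in
theorem fiberEquiv_smul_of (c : k) (y : N) :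
    fiberEquiv R N r k (c • PolyFiber.of A r k N y) = ((1 : R) ⊗ₜ[A] c) ⊗ₜ[R] y := by
  rw [← PolyFiber.equiv_symm_tmul, ← tensorFiberEquiv_symm_tmul]
  exact congrArg (tensorFiberEquiv A R k N).symm
    ((PolyFiber.equiv A r N k).apply_symm_apply (c ⊗ₜ[A] y))

omit [IsScalarTower A (MvPolynomial (Fin r) A) R] in
theorem fiberEquiv_X_smul (hX : ∀ i, algebraMap (MvPolynomial (Fin r) A) R (MvPolynomial.X i) = x i)
    (i : Fin r) (z : PolyFiber A r k N) :
    fiberEquiv R N r k ((MvPolynomial.X i : MvPolynomial (Fin r) k) • z) =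
      algebraMap R (R ⊗[A] k) (x i) • fiberEquiv R N r k z := by
  have key : ∀ (c : k) (y : N), fiberEquiv R N r k
      ((MvPolynomial.X i : MvPolynomial (Fin r) k) • (c • PolyFiber.of A r k N y)) =
        algebraMap R (R ⊗[A] k) (x i) • fiberEquiv R N r k (c • PolyFiber.of A r k N y) := by
    intro c y
    rw [smul_comm, ← PolyFiber.of_X_smul, fiberEquiv_smul_of, fiberEquiv_smul_of, algebraMap_smul,
      ← algebraMap_smul R (MvPolynomial.X i : MvPolynomial (Fin r) A) y, hX,
      ← TensorProduct.tmul_smul]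
  obtain ⟨w, rfl⟩ := (PolyFiber.equiv A r N k).symm.surjective z
  induction w with
  | zero => simp
  | tmul c y => rw [PolyFiber.equiv_symm_tmul, key]
  | add w w' h h' => rw [map_add, smul_add, map_add, map_add, smul_add, h, h']

omit [Algebra (MvPolynomial (Fin r) A) R] [IsScalarTower A (MvPolynomial (Fin r) A) R]
  [IsScalarTower (MvPolynomial (Fin r) A) R N] in
theorem fiberEquiv_C_smul (c : k) (z : PolyFiber A r k N) :
    fiberEquiv R N r k (c • z) = ((1 : R) ⊗ₜ[A] c) • fiberEquiv R N r k z := by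
  obtain ⟨w, rfl⟩ := (PolyFiber.equiv A r N k).symm.surjective z
  induction w with
  | zero => simp
  | tmul c' y =>
    rw [PolyFiber.equiv_symm_tmul, ← mul_smul, fiberEquiv_smul_of, fiberEquiv_smul_of,
      TensorProduct.smul_tmul', smul_eq_mul, Algebra.TensorProduct.tmul_mul_tmul, one_mul]
  | add w w' h h' => rw [map_add, smul_add, map_add, map_add, smul_add, h, h']

variable (𝒩) in
/-- The component of degree `n` of the image of `f ⊗ k`. -/
def fiberComponent {F : Type*} [AddCommGroup F] [Module R F] (f : N →ₗ[R] F) (n : ℤ) :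
    AddSubgroup (LinearMap.range (f.baseChange (R ⊗[A] k))) :=
  AddSubgroup.closure {z | ∃ (c : k) (y : N), y ∈ 𝒩 n ∧
    (z : (R ⊗[A] k) ⊗[R] F) = ((1 : R) ⊗ₜ[A] c) ⊗ₜ[R] f y}

variable {k} {F : Type*} [AddCommGroup F] [Module R F] {f : N →ₗ[R] F}

variable (r) in
/-- The image of `f ⊗ k` agrees with the base change of the source if `f ⊗ k` is injective. -/
noncomputable def fiberRangeEquiv (hf : Function.Injective (f.baseChange (R ⊗[A] k))) :
    LinearMap.range (f.baseChange (R ⊗[A] k)) ≃+ PolyFiber A r k N :=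
  ((fiberEquiv R N r k).trans (LinearEquiv.ofInjective (f.baseChange (R ⊗[A] k)) hf).toAddEquiv).symm

variable {hf : Function.Injective (f.baseChange (R ⊗[A] k))}

omit [Algebra (MvPolynomial (Fin r) A) R] [IsScalarTower A (MvPolynomial (Fin r) A) R]
  [IsScalarTower (MvPolynomial (Fin r) A) R N] in
theorem fiberRangeEquiv_symm_apply (z : PolyFiber A r k N) :
    ((fiberRangeEquiv r hf).symm z : (R ⊗[A] k) ⊗[R] F) =
      f.baseChange (R ⊗[A] k) (fiberEquiv R N r k z) :=
  rfl

omit [IsScalarTower A (MvPolynomial (Fin r) A) R] in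
theorem fiberRangeEquiv_X_smul
    (hX : ∀ i, algebraMap (MvPolynomial (Fin r) A) R (MvPolynomial.X i) = x i)
    (i : Fin r) (z : LinearMap.range (f.baseChange (R ⊗[A] k))) :
    fiberRangeEquiv r hf (algebraMap R (R ⊗[A] k) (x i) • z) =
      (MvPolynomial.X i : MvPolynomial (Fin r) k) • fiberRangeEquiv r hf z := by
  obtain ⟨w, rfl⟩ := (fiberRangeEquiv r hf).symm.surjective z
  rw [← AddEquiv.eq_symm_apply, AddEquiv.apply_symm_apply]
  apply Subtype.ext
  rw [Submodule.coe_smul, fiberRangeEquiv_symm_apply, fiberRangeEquiv_symm_apply,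
    fiberEquiv_X_smul k hX, map_smul]

omit [Algebra (MvPolynomial (Fin r) A) R] [IsScalarTower A (MvPolynomial (Fin r) A) R]
  [IsScalarTower (MvPolynomial (Fin r) A) R N] in
theorem fiberRangeEquiv_C_smul (c : k) (z : LinearMap.range (f.baseChange (R ⊗[A] k))) :
    fiberRangeEquiv r hf (((1 : R) ⊗ₜ[A] c) • z) = c • fiberRangeEquiv r hf z := by
  obtain ⟨w, rfl⟩ := (fiberRangeEquiv r hf).symm.surjective z
  rw [← AddEquiv.eq_symm_apply, AddEquiv.apply_symm_apply]
  apply Subtype.ext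
  rw [Submodule.coe_smul, fiberRangeEquiv_symm_apply, fiberRangeEquiv_symm_apply,
    fiberEquiv_C_smul, map_smul]

omit [Algebra (MvPolynomial (Fin r) A) R] [IsScalarTower A (MvPolynomial (Fin r) A) R]
  [IsScalarTower (MvPolynomial (Fin r) A) R N] in
theorem fiberRangeEquiv_mem_component (n : ℤ) (z : LinearMap.range (f.baseChange (R ⊗[A] k))) :
    fiberRangeEquiv r hf z ∈ (PolyFiber.component (r := r) 𝒩 k n).toAddSubgroup ↔
      z ∈ fiberComponent 𝒩 k f n := by
  constructor
  · obtain ⟨w, rfl⟩ := (fiberRangeEquiv r hf).symm.surjective z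
    rw [AddEquiv.apply_symm_apply]
    intro hw
    change w ∈ Submodule.span k _ at hw
    induction hw using Submodule.closure_induction with
    | zero => rw [map_zero]; exact zero_mem _
    | add w w' _ _ h h' => rw [map_add]; exact add_mem h h'
    | smul_mem c w hw =>
      obtain ⟨y, hy, rfl⟩ := hw
      refine AddSubgroup.subset_closure ⟨c, y, hy, ?_⟩
      rw [fiberRangeEquiv_symm_apply, fiberEquiv_smul_of, LinearMap.baseChange_tmul]
  · have h1 : fiberComponent 𝒩 k f n ≤
        (PolyFiber.component (r := r) 𝒩 k n).toAddSubgroup.comap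
          (fiberRangeEquiv r hf).toAddMonoidHom := by
      rw [fiberComponent, AddSubgroup.closure_le]
      rintro z ⟨c, y, hy, hz⟩
      have h2 : z = (fiberRangeEquiv r hf).symm (c • PolyFiber.of A r k N y) := by
        apply Subtype.ext
        rw [hz, fiberRangeEquiv_symm_apply, fiberEquiv_smul_of, LinearMap.baseChange_tmul]
      change fiberRangeEquiv r hf z ∈ PolyFiber.component (r := r) 𝒩 k n
      rw [h2, AddEquiv.apply_symm_apply]
      exact Submodule.smul_mem _ _ (PolyFiber.of_mem_component k hy)
    exact fun hz => h1 hz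

end Specialization

section PolyFiberFinite

attribute [local instance] MvPolynomial.algebraMvPolynomial in
instance PolyFiber.finite {A : Type*} [CommRing A] {r : ℕ} (k : Type*) [CommRing k] [Algebra A k]
    {Y : Type*} [AddCommGroup Y] [Module (MvPolynomial (Fin r) A) Y]
    [Module.Finite (MvPolynomial (Fin r) A) Y] :
    Module.Finite (MvPolynomial (Fin r) k) (PolyFiber A r k Y) :=
  inferInstanceAs (Module.Finite _ (MvPolynomial (Fin r) k ⊗[MvPolynomial (Fin r) A] Y))

end PolyFiberFinite

/-! ### The fibre ring as an integral algebra over k[X]. -/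

section FiberPolynomialAction

variable {A R : Type*} [CommRing A] [CommRing R] [Algebra A R] {r : ℕ} (x : Fin r → R)
  (k : Type*) [Field k] [Algebra A k]

/-- The map from the polynomial ring over `k` to `R ⊗ k` sending the variables to `x`. -/
noncomputable def fiberPolyHom : MvPolynomial (Fin r) k →+* R ⊗[A] k :=
  MvPolynomial.eval₂Hom (Algebra.TensorProduct.includeRight : k →ₐ[A] R ⊗[A] k).toRingHom
    fun i => algebraMap R (R ⊗[A] k) (x i)

theorem fiberPolyHom_C (c : k) : fiberPolyHom x k (MvPolynomial.C c) = (1 : R) ⊗ₜ[A] c :=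
  MvPolynomial.eval₂Hom_C _ _ _

theorem fiberPolyHom_X (i : Fin r) :
    fiberPolyHom x k (MvPolynomial.X i) = algebraMap R (R ⊗[A] k) (x i) :=
  MvPolynomial.eval₂Hom_X' _ _ _

variable [Algebra (MvPolynomial (Fin r) A) R] [IsScalarTower A (MvPolynomial (Fin r) A) R] {x}

theorem fiberPolyHom_comp_map
    (hX : ∀ i, algebraMap (MvPolynomial (Fin r) A) R (MvPolynomial.X i) = x i) :
    (fiberPolyHom x k).comp (MvPolynomial.map (algebraMap A k)) =
      (algebraMap R (R ⊗[A] k)).comp (algebraMap (MvPolynomial (Fin r) A) R) := by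
  refine MvPolynomial.ringHom_ext (fun a => ?_) fun i => ?_
  · rw [RingHom.comp_apply, RingHom.comp_apply, MvPolynomial.map_C, fiberPolyHom_C,
      ← MvPolynomial.algebraMap_eq, ← IsScalarTower.algebraMap_apply A (MvPolynomial (Fin r) A) R,
      Algebra.TensorProduct.algebraMap_apply, Algebra.algebraMap_self, RingHom.id_apply,
      Algebra.algebraMap_eq_smul_one, Algebra.algebraMap_eq_smul_one, TensorProduct.tmul_smul,
      TensorProduct.smul_tmul']
  · rw [RingHom.comp_apply, RingHom.comp_apply, MvPolynomial.map_X, fiberPolyHom_X, hX]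

/-- Sums and products reduce to elements b ⊗ 1 and 1 ⊗ c: the first inherits the integral equation
of b over A[X], the second is the image of a constant. -/
theorem fiberPolyHom_isIntegral
    (hX : ∀ i, algebraMap (MvPolynomial (Fin r) A) R (MvPolynomial.X i) = x i)
    [Algebra.IsIntegral (MvPolynomial (Fin r) A) R] : (fiberPolyHom (A := A) x k).IsIntegral := by
  intro b
  induction b with
  | zero => exact RingHom.isIntegralElem_zero _
  | add b b' h h' => exact RingHom.IsIntegralElem.add _ h h'
  | tmul b c =>
    have h1 : b ⊗ₜ[A] c = (b ⊗ₜ[A] (1 : k)) * ((1 : R) ⊗ₜ[A] c) := by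
      rw [Algebra.TensorProduct.tmul_mul_tmul, one_mul, mul_one]
    rw [h1]
    refine RingHom.IsIntegralElem.mul _ ?_ ?_
    · obtain ⟨P, hP, hb⟩ := Algebra.IsIntegral.isIntegral (R := MvPolynomial (Fin r) A) b
      refine ⟨P.map (MvPolynomial.map (algebraMap A k)), hP.map _, ?_⟩
      rw [Polynomial.eval₂_map, fiberPolyHom_comp_map k hX]
      change Polynomial.eval₂ _ (algebraMap R (R ⊗[A] k) b) P = 0
      rw [← Polynomial.hom_eval₂, hb, map_zero]
    · rw [← fiberPolyHom_C x]
      exact RingHom.isIntegralElem_map _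

variable {k}
variable {N F : Type*} [AddCommGroup N] [Module A N]
  [Module R N] [IsScalarTower A R N] {𝒩 : ℤ → Submodule A N}
  [Module (MvPolynomial (Fin r) A) N] [IsScalarTower (MvPolynomial (Fin r) A) R N]
  [IsScalarTower A (MvPolynomial (Fin r) A) N] [AddCommGroup F] [Module R F] {f : N →ₗ[R] F}
  {hf : Function.Injective (f.baseChange (R ⊗[A] k))}

omit [IsScalarTower A (MvPolynomial (Fin r) A) R] in
theorem fiberRangeEquiv_smul
    (hX : ∀ i, algebraMap (MvPolynomial (Fin r) A) R (MvPolynomial.X i) = x i)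
    (w : MvPolynomial (Fin r) k) (z : LinearMap.range (f.baseChange (R ⊗[A] k))) :
    fiberRangeEquiv r hf (fiberPolyHom (A := A) x k w • z) = w • fiberRangeEquiv r hf z := by
  induction w using MvPolynomial.induction_on generalizing z with
  | C c =>
    rw [fiberPolyHom_C, fiberRangeEquiv_C_smul, ← MvPolynomial.algebraMap_eq, algebraMap_smul]
  | add w w' h h' => rw [map_add, add_smul, map_add, h, h', add_smul]
  | mul_X w i h =>
    rw [map_mul, mul_smul, h, fiberPolyHom_X, fiberRangeEquiv_X_smul hX, mul_smul]

theorem supportDim_fiberRange [Module.Finite R N]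
    (hf : Function.Injective (f.baseChange (R ⊗[A] k)))
    (hX : ∀ i, algebraMap (MvPolynomial (Fin r) A) R (MvPolynomial.X i) = x i)
    [Algebra.IsIntegral (MvPolynomial (Fin r) A) R] :
    Module.supportDim (R ⊗[A] k) (LinearMap.range (f.baseChange (R ⊗[A] k))) =
      ringKrullDim (MvPolynomial (Fin r) k ⧸
        Module.annihilator (MvPolynomial (Fin r) k) (PolyFiber A r k N)) := by
  let := (fiberPolyHom (A := A) x k).toAlgebra
  have : Algebra.IsIntegral (MvPolynomial (Fin r) k) (R ⊗[A] k) := ⟨fiberPolyHom_isIntegral k hX⟩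
  exact supportDim_eq_ringKrullDim_of_addEquiv (fiberRangeEquiv r hf) (fiberRangeEquiv_smul hX)

omit [IsScalarTower A (MvPolynomial (Fin r) A) R] in
theorem cechVanishes_fiberRange {d : Fin r → ℕ} {p : ℤ → N →ₗ[A] N} (h : IsPolyGrading d 𝒩 p)
    (hf : Function.Injective (f.baseChange (R ⊗[A] k)))
    (hX : ∀ i, algebraMap (MvPolynomial (Fin r) A) R (MvPolynomial.X i) = x i) (i : ℕ) (n : ℤ) :
    CechVanishes (fun j => algebraMap R (R ⊗[A] k) (x j)) d (fiberComponent 𝒩 k f) i n ↔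
      CechVanishes (MvPolynomial.X : Fin r → MvPolynomial (Fin r) k) d
        (fun n => (PolyFiber.component (r := r) 𝒩 k n).toAddSubgroup) i n := by
  refine (cechVanishes_iff_of_addEquiv (PolyFiber.isPolyGrading k h).hom (fiberRangeEquiv r hf).symm
    (fun i m => ?_) fun n m => ?_).symm
  · rw [AddEquiv.symm_apply_eq, fiberRangeEquiv_X_smul hX, AddEquiv.apply_symm_apply]
  · rw [← fiberRangeEquiv_mem_component (r := r) (hf := hf), AddEquiv.apply_symm_apply]

omit [IsScalarTower A (MvPolynomial (Fin r) A) R] in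
-- For the depth the ungraded complex over the fibre ring is needed; it is carried to k[X] and only
-- there split into degrees.
theorem cechVanishes_top_fiberRange {d : Fin r → ℕ} {p : ℤ → N →ₗ[A] N} (h : IsPolyGrading d 𝒩 p)
    (hf : Function.Injective (f.baseChange (R ⊗[A] k)))
    (hX : ∀ i, algebraMap (MvPolynomial (Fin r) A) R (MvPolynomial.X i) = x i) (i : ℕ) :
    CechVanishes (fun j => algebraMap R (R ⊗[A] k) (x j)) d
      (fun _ => (⊤ : AddSubgroup (LinearMap.range (f.baseChange (R ⊗[A] k))))) i 0 ↔
      ∀ n, CechVanishes (MvPolynomial.X : Fin r → MvPolynomial (Fin r) k) d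
        (fun n => (PolyFiber.component (r := r) 𝒩 k n).toAddSubgroup) i n := by
  rw [← cechVanishes_top_iff (PolyFiber.isPolyGrading k h).proj (PolyFiber.isPolyGrading k h).hom]
  exact cechVanishes_iff_of_addEquiv
    (𝒩 := fun _ => (⊤ : AddSubgroup (LinearMap.range (f.baseChange (R ⊗[A] k)))))
    (𝒩' := fun _ => (⊤ : AddSubgroup (PolyFiber A r k N)))
    (fun _ _ _ _ => AddSubgroup.mem_top _) (fiberRangeEquiv r hf)
    (fun i m => fiberRangeEquiv_X_smul hX i m)
    fun n m => iff_of_true (AddSubgroup.mem_top _) (AddSubgroup.mem_top _)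

end FiberPolynomialAction

/-! ### Constancy of the invariants near each minimal prime. -/

section Main

universe u v

variable {A : Type u} [CommRing A] [IsNoetherianRing A] [IsReduced A] {q : Ideal A}
  {R N F : Type*} [CommRing R] [Algebra A R] [Algebra.FiniteType A R] {r : ℕ} {x : Fin r → R}
  {d : Fin r → ℕ} [Algebra (MvPolynomial (Fin r) A) R] [IsScalarTower A (MvPolynomial (Fin r) A) R]
  [Module.Finite (MvPolynomial (Fin r) A) R]
  [AddCommGroup N] [Module A N] [Module R N] [IsScalarTower A R N] [Module.Finite R N]
  [Module (MvPolynomial (Fin r) A) N] [IsScalarTower (MvPolynomial (Fin r) A) R N]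
  [AddCommGroup F] [Module A F] [Module R F] [IsScalarTower A R F] [Module.Finite R F]
  [Module (MvPolynomial (Fin r) A) F] [IsScalarTower (MvPolynomial (Fin r) A) R F]
  {𝒩 : ℤ → Submodule A N} {p : ℤ → N →ₗ[A] N}

/-- Near a minimal prime of `A`, the dimension, the depth and the `a`-invariants of the image of
`f ⊗ k` do not depend on the `A`-field `k`. -/
theorem exists_constant_invariants (hq : q ∈ minimalPrimes A) (hd : ∀ i, 0 < d i)
    (hX : ∀ i, algebraMap (MvPolynomial (Fin r) A) R (MvPolynomial.X i) = x i)
    (h : IsPolyGrading d 𝒩 p) {f : N →ₗ[R] F} (hf : Function.Injective f) :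
    ∃ a ∉ q, ∃ (D : WithBot ℕ∞) (δ : ℕ∞) (α : ℕ → EReal), ∀ (k : Type v) [Field k] [Algebra A k],
      algebraMap A k a ≠ 0 →
      Module.supportDim (R ⊗[A] k) (LinearMap.range (f.baseChange (R ⊗[A] k))) = D ∧
      idealDepth ((Ideal.span (Set.range x)).map (algebraMap R (R ⊗[A] k)))
        (LinearMap.range (f.baseChange (R ⊗[A] k))) = δ ∧
      ∀ i, aInvariant (fun j => algebraMap R (R ⊗[A] k) (x j)) d (fiberComponent 𝒩 k f) i = α i := by
  have hqp : q.IsPrime := hq.1.1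
  have := isScalarTower_of_algebraMap A R (MvPolynomial (Fin r) A) N
  have := isScalarTower_of_algebraMap A R (MvPolynomial (Fin r) A) (F ⧸ LinearMap.range f)
  have : Module.Finite (MvPolynomial (Fin r) A) N := Module.Finite.trans R N
  have : Module.Finite (MvPolynomial (Fin r) A) (F ⧸ LinearMap.range f) :=
    Module.Finite.trans R _
  obtain ⟨a₁, ha₁, hflat⟩ := genericallyFlat_mvPolynomial hq r (F ⧸ LinearMap.range f)
  obtain ⟨a₂, ha₂, ρ, hρ⟩ := PolyFiber.exists_finrank_component hq hd h
  obtain ⟨a₃, ha₃, c, hc⟩ := h.exists_cechVanishes_iff.{u, v, _} hq hd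
  -- `a₁` makes the cokernel of f flat, so that f ⊗ k is injective; `a₂` fixes the Hilbert function
  -- of the fibre and `a₃` its cohomology. The constant values are written in terms of the last two
  -- data only.
  refine ⟨a₁ * a₂ * a₃, hqp.mul_notMem (hqp.mul_notMem ha₁ ha₂.1) ha₃.1, hilbertDim ρ,
    ⨆ (t : ℕ) (_ : ∀ i < t, ∀ n, c i n), (t : ℕ∞),
    fun i => sSup ((fun n : ℤ => ((n : ℝ) : EReal)) '' {n | ¬ c i n}), fun k _ _ hk => ?_⟩
  simp only [map_mul, mul_ne_zero_iff] at hk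
  obtain ⟨⟨hk₁, hk₂⟩, hk₃⟩ := hk
  have hinj := baseChange_injective_of_flatAway A R hf (isUnit_iff_ne_zero.2 hk₁) hflat
  refine ⟨?_, ?_, fun i => ?_⟩
  · rw [supportDim_fiberRange hinj hX]
    exact (PolyFiber.isPolyGrading k h).ringKrullDim_quotient_annihilator hd (hρ k hk₂)
  -- The depth criterion uses associated primes over the fibre ring, which is Noetherian because it
  -- is of finite type over k.
  · have : IsNoetherianRing (k ⊗[A] R) := Algebra.FiniteType.isNoetherianRing k _
    have : IsNoetherianRing (R ⊗[A] k) :=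
      isNoetherianRing_of_ringEquiv _ (Algebra.TensorProduct.comm A k R).toRingEquiv
    rw [Ideal.map_span, ← Set.range_comp]
    refine (idealDepth_span_range (x := fun j => algebraMap R (R ⊗[A] k) (x j)) (d := d)).trans ?_
    simp only [cechVanishes_top_fiberRange h hinj hX, hc k hk₃]
  · unfold aInvariant
    simp only [nontrivial_gradedLocalCohomology_iff, cechVanishes_fiberRange h hinj hX, hc k hk₃]

end Main

/-! ### Gluing over the minimal primes. -/

section LocallyConstant

variable {A : Type*} [CommRing A]

/-- A union of basic open sets containing all minimal primes is dense. -/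
theorem dense_iSup_basicOpen {a : minimalPrimes A → A} (ha : ∀ q, a q ∉ q.1) :
    Dense ((⨆ q, PrimeSpectrum.basicOpen (a q) : TopologicalSpace.Opens (PrimeSpectrum A)) :
      Set (PrimeSpectrum A)) := by
  intro p
  obtain ⟨q, hq, hqp⟩ := Ideal.exists_minimalPrimes_le (J := p.asIdeal) (I := (⊥ : Ideal A)) bot_le
  have h1 : (⟨q, hq.1.1⟩ : PrimeSpectrum A) ⤳ p := (PrimeSpectrum.le_iff_specializes _ _).1 hqp
  refine closure_mono (Set.singleton_subset_iff.2 ?_) h1.mem_closure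
  exact TopologicalSpace.Opens.mem_iSup.2 ⟨⟨q, hq⟩, ha ⟨q, hq⟩⟩

theorem isLocallyConstant_of_basicOpen {T : Type*} {J : Type*} {a : J → A}
    {f : PrimeSpectrum A → T} {v : J → T} (h : ∀ j (p : PrimeSpectrum A), a j ∉ p.asIdeal → f p = v j) :
    IsLocallyConstant (fun p : (⨆ j, PrimeSpectrum.basicOpen (a j) :
      TopologicalSpace.Opens (PrimeSpectrum A)) => f p.1) := by
  rw [IsLocallyConstant.iff_exists_open]
  intro p
  obtain ⟨j, hj⟩ := TopologicalSpace.Opens.mem_iSup.1 p.2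
  refine ⟨_, (PrimeSpectrum.basicOpen (a j)).2.preimage continuous_subtype_val, hj, fun p' hp' => ?_⟩
  rw [h j p'.1 hp', h j p.1 hj]

end LocallyConstant

theorem mainTheorem10
    {A : Type*} [CommRing A] [IsNoetherianRing A] [IsReduced A]
    {R : Type*} [CommRing R] [Algebra A R] [Algebra.FiniteType A R]
    (𝒜 : ℕ → Submodule A R) [GradedAlgebra 𝒜] [Module.Finite A (𝒜 0)]
    {M : Type*} [AddCommGroup M] [Module A M] [Module R M] [IsScalarTower A R M]
    [Module.Finite R M]
    (ℳ : ℤ → Submodule A M) (hℳ : IsGradedModule 𝒜 ℳ) (hrank : HasRank R M)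
    -- a graded embedding of `M / τ_R(M)` into a finitely generated graded free module
    {s : ℕ} (μ : Fin s → ℤ) (ι : TorsionFreeQuotient R M →ₗ[R] (Fin s → R))
    (hι : IsGradedEmbedding 𝒜 ℳ μ ι)
    -- homogeneous generators of `𝔪 = [R]_+`
    {r : ℕ} (x : Fin r → R) (d : Fin r → ℕ) (hd : ∀ i, 0 < d i) (hx : ∀ i, x i ∈ 𝒜 (d i))
    (hspan : Ideal.span (Set.range x) = (HomogeneousIdeal.irrelevant 𝒜).toIdeal) :
    ∃ U : TopologicalSpace.Opens (PrimeSpectrum A), Dense (U : Set (PrimeSpectrum A)) ∧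
      IsLocallyConstant (fun p : U =>
        Module.supportDim (FiberRing A R p.1) (specialization ι p.1)) ∧
      IsLocallyConstant (fun p : U =>
        idealDepth ((HomogeneousIdeal.irrelevant 𝒜).toIdeal.map
          (algebraMap R (FiberRing A R p.1))) (specialization ι p.1)) ∧
      (∀ i : ℕ, IsLocallyConstant (fun p : U =>
        aInvariant (fun j => algebraMap R (FiberRing A R p.1) (x j)) d
          (specializationComponent ℳ ι p.1) i)) ∧
      IsLocallyConstant (fun p : U =>
        regularity (fun j => algebraMap R (FiberRing A R p.1) (x j)) d
          (specializationComponent ℳ ι p.1)) := by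
  -- R and M become modules over A[X_1, …, X_r] by letting X_i act as x_i.
  let : Algebra (MvPolynomial (Fin r) A) R := (MvPolynomial.aeval x).toAlgebra
  have : IsScalarTower A (MvPolynomial (Fin r) A) R :=
    IsScalarTower.of_algebraMap_eq fun a => (MvPolynomial.aeval_C x a).symm
  have hX : ∀ i, algebraMap (MvPolynomial (Fin r) A) R (MvPolynomial.X i) = x i :=
    MvPolynomial.aeval_X x
  let : Module (MvPolynomial (Fin r) A) M :=
    Module.compHom M (algebraMap (MvPolynomial (Fin r) A) R)
  have : IsScalarTower (MvPolynomial (Fin r) A) R M :=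
    IsScalarTower.of_algebraMap_smul fun _ _ => rfl
  have : Module.Finite (MvPolynomial (Fin r) A) R := finite_of_span_eq_irrelevant 𝒜 hX hd hx hspan
  obtain ⟨p, hp⟩ := hℳ.exists_isPolyGrading_map (f := (Submodule.torsion R M).mkQ)
    (Submodule.mkQ_surjective _) hι.injective hι.homogeneous hX hx
  have hcomp : ∀ p : PrimeSpectrum A, specializationComponent ℳ ι p = fiberComponent
      (fun n => (ℳ n).map ((Submodule.torsion R M).mkQ.restrictScalars A))
      p.asIdeal.ResidueField ι := by
    intro p
    funext n
    unfold specializationComponent fiberComponent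
    congr 1
    ext z
    constructor
    · rintro ⟨c, m, hm, h⟩
      exact ⟨c, _, ⟨m, hm, rfl⟩, h⟩
    · rintro ⟨c, _, ⟨m, hm, rfl⟩, h⟩
      exact ⟨c, m, hm, h⟩
  -- One basic open set for each minimal prime, with the constant values of all invariants there;
  -- residue fields of points of D(a_q) are exactly those in which a_q stays nonzero.
  choose a ha D δ α h using fun q : minimalPrimes A =>
    exists_constant_invariants (q := q.1) q.2 hd hX hp hι.injective
  have hne : ∀ (q : minimalPrimes A) (p : PrimeSpectrum A), a q ∉ p.asIdeal →
      algebraMap A p.asIdeal.ResidueField (a q) ≠ 0 := fun q p hq h0 =>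
    hq (Ideal.algebraMap_residueField_eq_zero.1 h0)
  have hα : ∀ i (q : minimalPrimes A) (p : PrimeSpectrum A), a q ∉ p.asIdeal →
      aInvariant (fun j => algebraMap R (FiberRing A R p) (x j)) d
        (specializationComponent ℳ ι p) i = α q i := fun i q p hq =>
    (congrArg (fun 𝒮 => aInvariant (fun j => algebraMap R (FiberRing A R p) (x j)) d 𝒮 i)
      (hcomp p)).trans ((h q p.asIdeal.ResidueField (hne q p hq)).2.2 i)
  refine ⟨⨆ q, PrimeSpectrum.basicOpen (a q), dense_iSup_basicOpen ha, ?_, ?_, fun i => ?_, ?_⟩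
  · exact isLocallyConstant_of_basicOpen fun q p hq => (h q p.asIdeal.ResidueField (hne q p hq)).1
  · rw [← hspan]
    exact isLocallyConstant_of_basicOpen fun q p hq => (h q p.asIdeal.ResidueField (hne q p hq)).2.1
  · exact isLocallyConstant_of_basicOpen (hα i)
  -- The regularity is a supremum over all i, and the same open set serves every i, so no further
  -- shrinking is needed.
  · exact isLocallyConstant_of_basicOpen fun q p hq => iSup_congr fun i =>
      congrArg (· + (((i : ℕ) : ℝ) : EReal)) (hα i q p hq)
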